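/- Let $k$ be a field of characteristic zero and let $P$ be a quadratic operad in $k$-vector spaces (for instance a quadratic Koszul operad): $P=\Gamma(E)/(R)$, where $E=P(2)$ is a finite-dimensional right $\Sigma_2$-module and $R\subset\Gamma(E)(3)$. Let $P^!=\Gamma(E^\vee)/(R^\perp)$, $E^\vee=E^\#\otimes\mathrm{sgn}_2$, be its quadratic dual, let $\mathfrak s$ denote the operadic suspension, $(\mathfrak sO)(n)=\,\uparrow^{n-1}O(n)\otimes\mathrm{sgn}_n$, and let $\chi\in\mathfrak s(P\otimes P^!)(2)$ be the canonical element, which corresponds to $\mathrm{id}_{P(2)}$. For a $P$-algebra $A$ with structure map $\alpha:P\to\mathcal End_A$ let $$C^m_P(A;A)=\left[\mathfrak s(\mathcal End_A\otimes P^!)(m+1)\right]^{\Sigma_{m+1}}\ (m\ge 0),\qquad d_P f=[\chi_A,f]=\chi_A\circ f-(-1)^m f\circ\chi_A ,$$ where $\chi_A=\mathfrak s(\alpha\otimes\mathrm{id})(\chi)$, $f\circ g=\sum_i f\circ_i g$ in the operad $\mathfrak s(\mathcal End_A\otimes P^!)$, and invariants are identified with coinvariants by averaging. Let $H^*_P(A;A)$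 be the cohomology of $(C^*_P(A;A),d_P)$. Let $B_P=\{B_P^d(n)\}$ be the dg operad of natural operations. An element of $B^d_P(n)$ is a family, indexed by all $P$-algebras $A$, of $n$-linear operations of degree $d$ on $C^*_P(A;A)$ each of whose components $C^{m_1}\otimes\cdots\otimes C^{m_n}\to C^{m_1+\cdots+m_n+d}$ is a linear combination, with coefficients that do not depend on $A$, of operations $U_{(T,\Phi)}$. Here $T$ is a rooted tree with $m_1+\cdots+m_n+d+1$ labelled input legs, $n$ white vertices $w_1,\dots,w_n$ of arities $m_i+1$ with linearly ordered inputs, and black vertices of arity at least two decorated by elements of $P$; $\Phi$ is a linear map $\bigotimes_i\mathfrak sP^!(m_i+1)\to\mathfrak sP^!(m_1+\cdots+m_n+d+1)$; and $U_{(T,\Phi)}(f_1,\dots,f_n)$ is obtained by composing along $T$ in $\mathcal End_A$ the $\mathcal End_A$-factors of the $f_i$, placed at the $w_i$, with the images under $\alpha$ of the decorations of the black vertices, applying $\Phi$ to the $P^!$-factors, and averaging over the symmetric group. The operad structure is that of multilinear operations on graded vector spaces (with the Koszul sign rule), and $$\delta_P(U)(f_1,\dots,f_n)=d_PU(f_1,\dots,f_n)-(-1)^{|U|}\sum_i(-1)^{|f_1|+\cdots+|f_{i-1}|}U(f_1,\dots,d_Pf_i,\dots,f_n).$$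 Let $\mathit{cup}$ be the map from $\mathfrak s(P\otimes P^!)$ to families of operations given by $\mathit{cup}(t)(f_1,\dots,f_n)=\mathrm{Aver}\big(\mathfrak s(\alpha\otimes\mathrm{id})(t)(f_1,\dots,f_n)\big)$, the composition being taken in $\mathfrak s(\mathcal End_A\otimes P^!)$, and let $\mathcal Z_P\subset\mathfrak s(P\otimes P^!)$ consist of those $t$ for which $\mathit{cup}(t)$ is $\delta_P$-closed. (Both $\mathfrak s(P\otimes P^!)$ and $\mathcal Z_P$ vanish in arity zero.) Then: 1. $\mathcal Z_P$ is a suboperad of $\mathfrak s(P\otimes P^!)$, the operad structure of $B_P$ induces one on $H^*(B_P,\delta_P)$, and for $t\in\mathcal Z_P$ the operation $\mathit{cup}(t)$ is a cocycle of $B_P$. The assignment $t\mapsto[\mathit{cup}(t)]$ is a morphism of operads $$\mathit{cup}:\mathcal Z_P\to H^*(B_P,\delta_P).$$ 2. For each $P$-algebra $A$, the formula $[U]([f_1],\dots,[f_n])=[U(f_1,\dots,f_n)]$ is well defined and makes $H^*_P(A;A)$ an algebra over $H^*(B_P,\delta_P)$. Consequently, via $\mathit{cup}$, $H^*_P(A;A)$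 is naturally a $\mathcal Z_P$-algebra, with $t([f_1],\dots,[f_n])=[\mathit{cup}(t)(f_1,\dots,f_n)]$ for $t\in\mathcal Z_P(n)$. -/

import Mathlib

open scoped TensorProduct DirectSum

universe u

noncomputable section

namespace OperadicCohomology

/-! ### Partial compositions: positions of inputs -/

/-- The inputs of `p ∘ᵢ q`, where `p` has `m` inputs and `q` has `n` inputs, are the inputs of `p`
other than the `i`-th one together with the inputs of `q`, which are inserted in the place of the
`i`-th input of `p`. All inputs are numbered from `0`. -/
def slot {m n r : ℕ} (h : r + 1 = m + n) (i : Fin m) : Fin r ≃ {x : Fin m // x ≠ i} ⊕ Fin n where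
  toFun z :=
    if h1 : z.val < i.val then Sum.inl ⟨⟨z.val, by omega⟩, by intro hz; simp [Fin.ext_iff] at hz; omega⟩
    else if h2 : z.val < i.val + n then Sum.inr ⟨z.val - i.val, by omega⟩
    else Sum.inl ⟨⟨z.val + 1 - n, by omega⟩, by intro hz; simp [Fin.ext_iff] at hz; omega⟩
  invFun s := match s with
    | Sum.inl x => if hx : x.1.val < i.val then ⟨x.1.val, by omega⟩
        else ⟨x.1.val + n - 1, by
          have h1 := x.1.isLt
          have h2 : x.1.val ≠ i.val := fun e => x.2 (Fin.ext e)
          omega⟩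
    | Sum.inr y => ⟨i.val + y.val, by omega⟩
  left_inv z := by
    by_cases h1 : z.val < i.val
    · simp [h1]
    · by_cases h2 : z.val < i.val + n
      · simp [h1, h2, Fin.ext_iff]; omega
      · have h3 : ¬ (z.val + 1 - n < i.val) := by omega
        simp [h1, h2, h3, Fin.ext_iff]; omega
  right_inv s := by
    rcases s with ⟨x, hx⟩ | y
    · have hx' : x.val ≠ i.val := fun e => hx (Fin.ext e)
      by_cases h1 : x.val < i.val
      · simp [h1]
      · have h2 : ¬ (x.val + n - 1 < i.val) := by omega
        have h3 : ¬ (x.val + n - 1 < i.val + n) := by omega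
        simp [h1, h2, h3, Fin.ext_iff]; omega
    · simp

/-- The block permutation `σ ∘ᵢ τ` for which `(p σ) ∘ᵢ (q τ) = (p ∘_{σ i} q) (σ ∘ᵢ τ)`. -/
def permCirc {m n r : ℕ} (h : r + 1 = m + n) (i : Fin m) (σ : Equiv.Perm (Fin m))
    (τ : Equiv.Perm (Fin n)) : Equiv.Perm (Fin r) :=
  ((slot h i).trans
    (Equiv.sumCongr (σ.subtypeEquiv (fun _ => (not_congr σ.injective.eq_iff).symm)) τ)).trans
    (slot h (σ i)).symm

/-! ### Operads -/

/-- A collection of right `Σₙ`-modules with a unit and partial compositions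
`∘ᵢ : O(m) ⊗ O(n) → O(r)`, `r = m + n - 1`. -/
structure OperadData (k : Type u) [Field k] where
  obj : ℕ → Type u
  [acg : ∀ n, AddCommGroup (obj n)]
  [mod : ∀ n, Module k (obj n)]
  one : obj 1
  circ : ∀ {m n r : ℕ} (_ : r + 1 = m + n) (_ : Fin m), obj m →ₗ[k] obj n →ₗ[k] obj r
  act : ∀ {n : ℕ} (_ : Equiv.Perm (Fin n)), obj n →ₗ[k] obj n
  act_one : ∀ {n : ℕ} (x : obj n), act 1 x = x
  act_mul : ∀ {n : ℕ} (σ τ : Equiv.Perm (Fin n)) (x : obj n), act (σ * τ) x = act τ (act σ x)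

attribute [instance] OperadData.acg OperadData.mod

/-- A (symmetric, unital) operad in the category of `k`-vector spaces. -/
structure Operad (k : Type u) [Field k] extends OperadData k where
  one_circ : ∀ {n : ℕ} (h : n + 1 = 1 + n) (q : obj n), circ h 0 one q = q
  circ_one : ∀ {m : ℕ} (i : Fin m) (p : obj m), circ (rfl : m + 1 = m + 1) i p one = p
  circ_seq : ∀ {l m n a b c : ℕ} (h₁ : a + 1 = l + m) (h₂ : b + 1 = a + n) (h₃ : c + 1 = m + n)
    (h₄ : b + 1 = l + c) (i : Fin l) (j : Fin m) (t : Fin a) (_ : t.val = i.val + j.val)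
    (p : obj l) (q : obj m) (s : obj n),
    circ h₂ t (circ h₁ i p q) s = circ h₄ i p (circ h₃ j q s)
  circ_par : ∀ {l m n a b c : ℕ} (h₁ : a + 1 = l + m) (h₂ : b + 1 = a + n) (h₃ : c + 1 = l + n)
    (h₄ : b + 1 = c + m) (i j : Fin l) (_ : i < j) (t : Fin a) (_ : t.val + 1 = j.val + m)
    (t' : Fin c) (_ : t'.val = i.val) (p : obj l) (q : obj m) (s : obj n),
    circ h₂ t (circ h₁ i p q) s = circ h₄ t' (circ h₃ j p s) q
  circ_act : ∀ {m n r : ℕ} (h : r + 1 = m + n) (i : Fin m) (σ : Equiv.Perm (Fin m))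
    (τ : Equiv.Perm (Fin n)) (p : obj m) (q : obj n),
    circ h i (act σ p) (act τ q) = act (permCirc h i σ τ) (circ h (σ i) p q)

variable {k : Type u} [Field k]

/-- Morphisms of operads. -/
structure OperadHom (O Q : OperadData k) where
  map : ∀ n : ℕ, O.obj n →ₗ[k] Q.obj n
  map_one : map 1 O.one = Q.one
  map_circ : ∀ {m n r : ℕ} (h : r + 1 = m + n) (i : Fin m) (p : O.obj m) (q : O.obj n),
    map r (O.circ h i p q) = Q.circ h i (map m p) (map n q)
  map_act : ∀ {n : ℕ} (σ : Equiv.Perm (Fin n)) (p : O.obj n),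
    map n (O.act σ p) = Q.act σ (map n p)

namespace OperadData

/-- The identity map of `O(N) = O(r)`. -/
def castArity (O : OperadData k) {N r : ℕ} (e : N = r) : O.obj N →ₗ[k] O.obj r :=
  match e with
  | rfl => LinearMap.id

/-- Auxiliary to `gamma`: plug `f₀, f₁, …` successively into the last `n` inputs of an element of
`O(s + n)`. -/
def gammaAux (O : OperadData k) : ∀ (n s N r : ℕ) (a : Fin n → ℕ) (_ : N = s + n)
    (_ : r = s + ∑ i, a i),
    O.obj N →ₗ[k] MultilinearMap k (fun i : Fin n => O.obj (a i)) (O.obj r)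
  | 0, s, N, r, a, hN, hr =>
      (MultilinearMap.constLinearEquivOfIsEmpty (R := k) (S := k)
        (M₁ := fun i : Fin 0 => O.obj (a i)) (M₂ := O.obj r)).toLinearMap ∘ₗ
        O.castArity (by simp at hr; omega)
  | n + 1, s, N, r, a, hN, hr =>
      (multilinearCurryLeftEquiv k (fun i : Fin (n + 1) => O.obj (a i))
        (O.obj r)).symm.toLinearMap ∘ₗ
      (LinearMap.llcomp k (O.obj (a 0)) (O.obj (s + a 0 + n))
        (MultilinearMap k (fun i : Fin n => O.obj (a i.succ)) (O.obj r))
        (gammaAux O n (s + a 0) (s + a 0 + n) r (fun i => a i.succ) rfl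
          (by rw [hr, Fin.sum_univ_succ]; omega))) ∘ₗ
      O.circ (m := N) (n := a 0) (r := s + a 0 + n) (by omega) ⟨s, by omega⟩

/-- The full operadic composition `γ(t; f₁, …, fₙ)`, obtained from the partial compositions as
`(⋯((t ∘₁ f₁) ∘_{a₁+1} f₂) ⋯) ∘_{a₁+⋯+aₙ₋₁+1} fₙ`. -/
def gamma (O : OperadData k) {n r : ℕ} (a : Fin n → ℕ) (hr : r = ∑ i, a i) :
    O.obj n →ₗ[k] MultilinearMap k (fun i : Fin n => O.obj (a i)) (O.obj r) :=
  O.gammaAux n 0 n r a (by omega) (by omega)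

/-- The arity-wise tensor product `O ⊗ Q` of operads. -/
@[reducible] def hadamard (O Q : OperadData k) : OperadData k where
  obj n := O.obj n ⊗[k] Q.obj n
  one := O.one ⊗ₜ Q.one
  circ h i := TensorProduct.map₂ (O.circ h i) (Q.circ h i)
  act σ := TensorProduct.map (O.act σ) (Q.act σ)
  act_one {n} x := by
    have h1 : O.act (1 : Equiv.Perm (Fin n)) = LinearMap.id := LinearMap.ext O.act_one
    have h2 : Q.act (1 : Equiv.Perm (Fin n)) = LinearMap.id := LinearMap.ext Q.act_one
    rw [h1, h2, TensorProduct.map_id]; rfl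
  act_mul σ τ x := by
    have h1 : O.act (σ * τ) = O.act τ ∘ₗ O.act σ := LinearMap.ext (O.act_mul σ τ)
    have h2 : Q.act (σ * τ) = Q.act τ ∘ₗ Q.act σ := LinearMap.ext (Q.act_mul σ τ)
    rw [h1, h2, TensorProduct.map_comp]; rfl

/-- The operadic suspension: `(𝔰O)(n) = ↑ⁿ⁻¹ O(n) ⊗ sgnₙ`. An element of `(𝔰O)(n)` has degree
`n - 1`, and the underlying vector space is that of `O(n)`; as for the endomorphism operad of the
one-dimensional space in degree `-1`, the composition `∘ᵢ` (`i = 0, 1, …`) with an element of arity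
`n` acquires the sign `(-1)^{(n-1)i}`. -/
@[reducible] def susp (O : OperadData k) : OperadData k where
  obj := O.obj
  one := O.one
  circ {_ n _} h i := ((-1 : k) ^ ((n + 1) * i.val)) • O.circ h i
  act σ := ((Equiv.Perm.sign σ : ℤ) : k) • O.act σ
  act_one x := by simp [O.act_one]
  act_mul σ τ x := by
    simp only [LinearMap.smul_apply, map_smul, O.act_mul, smul_smul, Equiv.Perm.sign_mul,
      Units.val_mul, Int.cast_mul]

/-- The subspace `O(n)^{Σₙ}` of invariants. -/
def invariants (O : OperadData k) (n : ℕ) : Submodule k (O.obj n) where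
  carrier := {x | ∀ σ : Equiv.Perm (Fin n), O.act σ x = x}
  add_mem' hx hy σ := by rw [map_add, hx σ, hy σ]
  zero_mem' σ := map_zero _
  smul_mem' c x hx σ := by rw [map_smul, hx σ]

/-- The averaging map `O(n) → O(n)^{Σₙ}`. -/
def aver (O : OperadData k) (n : ℕ) : O.obj n →ₗ[k] O.invariants n :=
  LinearMap.codRestrict (O.invariants n)
    ((Nat.factorial n : k)⁻¹ • ∑ σ : Equiv.Perm (Fin n), O.act σ) (by
      intro x τ
      simp only [LinearMap.smul_apply, LinearMap.sum_apply, map_smul, map_sum, ← O.act_mul]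
      congr 1
      exact Fintype.sum_equiv (Equiv.mulRight τ) _ _ (fun _ => rfl))

end OperadData

/-! ### Endomorphism operads and algebras -/

section EndOperad

variable (V : Type u) [AddCommGroup V] [Module k V]

variable {V} in
/-- The inputs of the outer map in `φ ∘ᵢ ψ`. -/
def outerInput {m n r : ℕ} (h : r + 1 = m + n) (i : Fin m)
    (ψ : MultilinearMap k (fun _ : Fin n => V) V) (x : Fin r → V) (j : Fin m) : V :=
  if hj : j = i then ψ (fun y => x ((slot h i).symm (Sum.inr y)))
  else x ((slot h i).symm (Sum.inl ⟨j, hj⟩))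

variable {V} in
theorem outerInput_update_inr {m n r : ℕ} (h : r + 1 = m + n) (i : Fin m)
    (ψ : MultilinearMap k (fun _ : Fin n => V) V) (x : Fin r → V) (y : Fin n) (v : V) :
    outerInput h i ψ (Function.update x ((slot h i).symm (Sum.inr y)) v) =
      Function.update (outerInput h i ψ x) i
        (ψ (Function.update (fun y => x ((slot h i).symm (Sum.inr y))) y v)) := by
  funext j
  by_cases hj : j = i
  · subst hj
    simp only [outerInput, dif_pos, Function.update_self]
    congr 1
    funext y'
    by_cases hy : y' = y
    · subst hy; simp
    · rw [Function.update_of_ne (by simpa using hy), Function.update_of_ne hy]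
  · simp only [outerInput, dif_neg hj, Function.update_of_ne hj]
    rw [Function.update_of_ne (by simp)]

variable {V} in
theorem outerInput_update_inl {m n r : ℕ} (h : r + 1 = m + n) (i : Fin m)
    (ψ : MultilinearMap k (fun _ : Fin n => V) V) (x : Fin r → V) (j : {j : Fin m // j ≠ i})
    (v : V) :
    outerInput h i ψ (Function.update x ((slot h i).symm (Sum.inl j)) v) =
      Function.update (outerInput h i ψ x) j.1 v := by
  funext j'
  by_cases hj : j' = i
  · subst hj
    rw [Function.update_of_ne (Ne.symm j.2)]
    simp only [outerInput, dif_pos]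
    congr 1
    funext y'
    rw [Function.update_of_ne (by simp)]
  · by_cases hjj : j' = j.1
    · subst hjj; simp [outerInput, hj]
    · rw [Function.update_of_ne hjj]
      simp only [outerInput, dif_neg hj]
      rw [Function.update_of_ne]
      simpa [Subtype.ext_iff] using hjj

variable {V} in
/-- The partial composition `φ ∘ᵢ ψ` of multilinear maps. -/
def endCirc {m n r : ℕ} (h : r + 1 = m + n) (i : Fin m)
    (φ : MultilinearMap k (fun _ : Fin m => V) V) (ψ : MultilinearMap k (fun _ : Fin n => V) V) :
    MultilinearMap k (fun _ : Fin r => V) V :=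
  MultilinearMap.mk' (fun x => φ (outerInput h i ψ x))
    (by
      intro x z v w
      obtain ⟨s, rfl⟩ := (slot h i).symm.surjective z
      rcases s with j | y
      · simp only [outerInput_update_inl, MultilinearMap.map_update_add]
      · simp only [outerInput_update_inr, MultilinearMap.map_update_add])
    (by
      intro x z c v
      obtain ⟨s, rfl⟩ := (slot h i).symm.surjective z
      rcases s with j | y
      · simp only [outerInput_update_inl, MultilinearMap.map_update_smul]
      · simp only [outerInput_update_inr, MultilinearMap.map_update_smul])

variable {V} in
theorem outerInput_eq_update {m n r : ℕ} (h : r + 1 = m + n) (i : Fin m)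
    (ψ : MultilinearMap k (fun _ : Fin n => V) V) (x : Fin r → V) :
    outerInput h i ψ x = Function.update (outerInput h i (0 : MultilinearMap k _ V) x) i
      (ψ (fun y => x ((slot h i).symm (Sum.inr y)))) := by
  funext j
  by_cases hj : j = i
  · subst hj; simp [outerInput]
  · simp [outerInput, hj]

/-- The endomorphism operad `Lin(V^{⊗n}, V)`. The right action is
`(φ σ)(x₁, …, xₙ) = φ(x_{σ⁻¹(1)}, …, x_{σ⁻¹(n)})`. -/
@[reducible] def EndOp : OperadData k where
  obj n := MultilinearMap k (fun _ : Fin n => V) V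
  one := MultilinearMap.ofSubsingleton k V V (0 : Fin 1) LinearMap.id
  circ h i := LinearMap.mk₂ k (endCirc h i)
    (fun _ _ _ => rfl) (fun _ _ _ => rfl)
    (fun φ ψ ψ' => by
      ext x
      simp only [endCirc, MultilinearMap.mk'_apply, add_apply]
      rw [outerInput_eq_update h i (ψ + ψ'), outerInput_eq_update h i ψ,
        outerInput_eq_update h i ψ', add_apply, MultilinearMap.map_update_add])
    (fun c φ ψ => by
      ext x
      simp only [endCirc, MultilinearMap.mk'_apply, smul_apply]
      rw [outerInput_eq_update h i (c • ψ), outerInput_eq_update h i ψ,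
        smul_apply, MultilinearMap.map_update_smul])
  act σ := (MultilinearMap.domDomCongrLinearEquiv k k V V σ⁻¹).toLinearMap
  act_one φ := by ext x; rfl
  act_mul σ τ φ := by
    ext x
    simp [mul_inv_rev, Equiv.Perm.mul_apply]

end EndOperad

/-- A `P`-algebra: a vector space `A` with a morphism of operads `α : P → End_A`. -/
structure PAlg (P : Operad k) where
  carrier : Type u
  [acg : AddCommGroup carrier]
  [mod : Module k carrier]
  str : OperadHom P.toOperadData (EndOp (k := k) carrier)

attribute [instance] PAlg.acg PAlg.mod

/-! ### Operads presented by binary generators and relations in arity three -/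

section Presentation

variable (k)

/-- Formal operadic expressions in binary generators from `E`. The expression `tri r` stands for the
element `∑ᵤ ∑ (e ∘₁ e') cᵘ` of arity three of the free operad on `E`, where `r u = ∑ e ⊗ e'` and
`c = finRotate 3` is the cyclic permutation; in this way `E ⊗ E ⊕ E ⊗ E ⊕ E ⊗ E` is identified with
the arity three part of the free operad on `E` (the three summands belong to the three binary trees
with three labelled leaves). -/
inductive Term (E : Type u) [AddCommGroup E] [Module k E] : ℕ → Type u
  | gen : E → Term E 2
  | tri : (Fin 3 → E ⊗[k] E) → Term E 3
  | one : Term E 1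
  | circ {m n r : ℕ} (h : r + 1 = m + n) (i : Fin m) : Term E m → Term E n → Term E r
  | act {n : ℕ} (σ : Equiv.Perm (Fin n)) : Term E n → Term E n
  | zero {n : ℕ} : Term E n
  | add {n : ℕ} : Term E n → Term E n → Term E n
  | smul {n : ℕ} (c : k) : Term E n → Term E n

variable {k}
variable {E : Type u} [AddCommGroup E] [Module k E]

/-- The identities between formal expressions: the axioms of an operad, linearity and equivariance
of the inclusion of the generators, the meaning of `tri`, and the relations `R`. -/
inductive Rel (ρ : Equiv.Perm (Fin 2) → E →ₗ[k] E) (R : Submodule k (Fin 3 → E ⊗[k] E)) :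
    ∀ {n : ℕ}, Term k E n → Term k E n → Prop
  -- congruence
  | circ_left {m n r : ℕ} (h : r + 1 = m + n) (i : Fin m) {p p' : Term k E m} (q : Term k E n) :
      Rel ρ R p p' → Rel ρ R (.circ h i p q) (.circ h i p' q)
  | circ_right {m n r : ℕ} (h : r + 1 = m + n) (i : Fin m) (p : Term k E m) {q q' : Term k E n} :
      Rel ρ R q q' → Rel ρ R (.circ h i p q) (.circ h i p q')
  | act_congr {n : ℕ} (σ : Equiv.Perm (Fin n)) {p p' : Term k E n} :
      Rel ρ R p p' → Rel ρ R (.act σ p) (.act σ p')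
  | add_left {n : ℕ} {p p' : Term k E n} (q : Term k E n) :
      Rel ρ R p p' → Rel ρ R (.add p q) (.add p' q)
  | add_right {n : ℕ} (p : Term k E n) {q q' : Term k E n} :
      Rel ρ R q q' → Rel ρ R (.add p q) (.add p q')
  | smul_congr {n : ℕ} (c : k) {p p' : Term k E n} :
      Rel ρ R p p' → Rel ρ R (.smul c p) (.smul c p')
  -- vector space axioms
  | add_comm {n : ℕ} (p q : Term k E n) : Rel ρ R (.add p q) (.add q p)
  | add_assoc {n : ℕ} (p q s : Term k E n) :
      Rel ρ R (.add (.add p q) s) (.add p (.add q s))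
  | zero_add {n : ℕ} (p : Term k E n) : Rel ρ R (.add .zero p) p
  | neg_add {n : ℕ} (p : Term k E n) : Rel ρ R (.add (.smul (-1) p) p) .zero
  | smul_add {n : ℕ} (c : k) (p q : Term k E n) :
      Rel ρ R (.smul c (.add p q)) (.add (.smul c p) (.smul c q))
  | add_smul {n : ℕ} (c d : k) (p : Term k E n) :
      Rel ρ R (.smul (c + d) p) (.add (.smul c p) (.smul d p))
  | mul_smul {n : ℕ} (c d : k) (p : Term k E n) :
      Rel ρ R (.smul (c * d) p) (.smul c (.smul d p))
  | one_smul {n : ℕ} (p : Term k E n) : Rel ρ R (.smul 1 p) p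
  -- linearity of the structure maps
  | circ_add_left {m n r : ℕ} (h : r + 1 = m + n) (i : Fin m) (p p' : Term k E m)
      (q : Term k E n) :
      Rel ρ R (.circ h i (.add p p') q) (.add (.circ h i p q) (.circ h i p' q))
  | circ_smul_left {m n r : ℕ} (h : r + 1 = m + n) (i : Fin m) (c : k) (p : Term k E m)
      (q : Term k E n) : Rel ρ R (.circ h i (.smul c p) q) (.smul c (.circ h i p q))
  | circ_add_right {m n r : ℕ} (h : r + 1 = m + n) (i : Fin m) (p : Term k E m)
      (q q' : Term k E n) :
      Rel ρ R (.circ h i p (.add q q')) (.add (.circ h i p q) (.circ h i p q'))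
  | circ_smul_right {m n r : ℕ} (h : r + 1 = m + n) (i : Fin m) (c : k) (p : Term k E m)
      (q : Term k E n) : Rel ρ R (.circ h i p (.smul c q)) (.smul c (.circ h i p q))
  | act_add {n : ℕ} (σ : Equiv.Perm (Fin n)) (p q : Term k E n) :
      Rel ρ R (.act σ (.add p q)) (.add (.act σ p) (.act σ q))
  | act_smul {n : ℕ} (σ : Equiv.Perm (Fin n)) (c : k) (p : Term k E n) :
      Rel ρ R (.act σ (.smul c p)) (.smul c (.act σ p))
  -- operad axioms
  | act_one {n : ℕ} (p : Term k E n) : Rel ρ R (.act 1 p) p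
  | act_mul {n : ℕ} (σ τ : Equiv.Perm (Fin n)) (p : Term k E n) :
      Rel ρ R (.act (σ * τ) p) (.act τ (.act σ p))
  | one_circ {n : ℕ} (h : n + 1 = 1 + n) (q : Term k E n) : Rel ρ R (.circ h 0 .one q) q
  | circ_one {m : ℕ} (i : Fin m) (p : Term k E m) :
      Rel ρ R (.circ (rfl : m + 1 = m + 1) i p .one) p
  | circ_seq {l m n a b c : ℕ} (h₁ : a + 1 = l + m) (h₂ : b + 1 = a + n) (h₃ : c + 1 = m + n)
      (h₄ : b + 1 = l + c) (i : Fin l) (j : Fin m) (t : Fin a) (ht : t.val = i.val + j.val)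
      (p : Term k E l) (q : Term k E m) (s : Term k E n) :
      Rel ρ R (.circ h₂ t (.circ h₁ i p q) s) (.circ h₄ i p (.circ h₃ j q s))
  | circ_par {l m n a b c : ℕ} (h₁ : a + 1 = l + m) (h₂ : b + 1 = a + n) (h₃ : c + 1 = l + n)
      (h₄ : b + 1 = c + m) (i j : Fin l) (hij : i < j) (t : Fin a) (ht : t.val + 1 = j.val + m)
      (t' : Fin c) (ht' : t'.val = i.val)
      (p : Term k E l) (q : Term k E m) (s : Term k E n) :
      Rel ρ R (.circ h₂ t (.circ h₁ i p q) s) (.circ h₄ t' (.circ h₃ j p s) q)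
  | circ_act {m n r : ℕ} (h : r + 1 = m + n) (i : Fin m) (σ : Equiv.Perm (Fin m))
      (τ : Equiv.Perm (Fin n)) (p : Term k E m) (q : Term k E n) :
      Rel ρ R (.circ h i (.act σ p) (.act τ q)) (.act (permCirc h i σ τ) (.circ h (σ i) p q))
  -- generators
  | gen_add (e e' : E) : Rel ρ R (.gen (e + e')) (.add (.gen e) (.gen e'))
  | gen_smul (c : k) (e : E) : Rel ρ R (.gen (c • e)) (.smul c (.gen e))
  | gen_act (σ : Equiv.Perm (Fin 2)) (e : E) : Rel ρ R (.gen (ρ σ e)) (.act σ (.gen e))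
  | tri_add (r r' : Fin 3 → E ⊗[k] E) : Rel ρ R (.tri (r + r')) (.add (.tri r) (.tri r'))
  | tri_single (v : Fin 3) (e e' : E) :
      Rel ρ R (.tri (Pi.single v (e ⊗ₜ e')))
        (.act (finRotate 3 ^ v.val) (.circ (by norm_num) (0 : Fin 2) (.gen e) (.gen e')))
  -- relations
  | rel (r : Fin 3 → E ⊗[k] E) (hr : r ∈ R) : Rel ρ R (.tri r) .zero

variable (ρ : Equiv.Perm (Fin 2) → E →ₗ[k] E) (R : Submodule k (Fin 3 → E ⊗[k] E))

/-- The arity `n` part of the presented operad. -/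
def PresObj (n : ℕ) : Type u := Quot (Rel ρ R (n := n))

instance (n : ℕ) : Zero (PresObj ρ R n) := ⟨Quot.mk _ .zero⟩

instance (n : ℕ) : Add (PresObj ρ R n) :=
  ⟨Quot.map₂ Term.add (fun p _ _ h => Rel.add_right p h) (fun _ _ q h => Rel.add_left q h)⟩

instance (n : ℕ) : SMul k (PresObj ρ R n) :=
  ⟨fun c => Quot.map (Term.smul c) (fun _ _ h => Rel.smul_congr c h)⟩

instance (n : ℕ) : Neg (PresObj ρ R n) := ⟨fun x => (-1 : k) • x⟩

theorem pres_add_comm {n : ℕ} (x y : PresObj ρ R n) : x + y = y + x := by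
  induction x using Quot.ind
  induction y using Quot.ind
  exact Quot.sound (Rel.add_comm _ _)

theorem pres_zero_add {n : ℕ} (x : PresObj ρ R n) : 0 + x = x := by
  induction x using Quot.ind
  exact Quot.sound (Rel.zero_add _)

instance (n : ℕ) : AddCommGroup (PresObj ρ R n) where
  add_assoc x y z := by
    induction x using Quot.ind
    induction y using Quot.ind
    induction z using Quot.ind
    exact Quot.sound (Rel.add_assoc _ _ _)
  zero_add := pres_zero_add ρ R
  add_zero x := by rw [pres_add_comm, pres_zero_add]
  add_comm := pres_add_comm ρ R
  neg_add_cancel x := by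
    induction x using Quot.ind
    exact Quot.sound (Rel.neg_add _)
  nsmul := nsmulRec
  zsmul := zsmulRec

theorem pres_smul_add {n : ℕ} (c : k) (x y : PresObj ρ R n) : c • (x + y) = c • x + c • y := by
  induction x using Quot.ind
  induction y using Quot.ind
  exact Quot.sound (Rel.smul_add _ _ _)

theorem pres_add_smul {n : ℕ} (c d : k) (x : PresObj ρ R n) : (c + d) • x = c • x + d • x := by
  induction x using Quot.ind
  exact Quot.sound (Rel.add_smul _ _ _)

instance (n : ℕ) : Module k (PresObj ρ R n) where
  one_smul x := by
    induction x using Quot.ind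
    exact Quot.sound (Rel.one_smul _)
  mul_smul c d x := by
    induction x using Quot.ind
    exact Quot.sound (Rel.mul_smul _ _ _)
  smul_add := pres_smul_add ρ R
  add_smul := pres_add_smul ρ R
  smul_zero c := by
    have h := pres_smul_add ρ R c (0 : PresObj ρ R n) 0
    rw [add_zero] at h
    exact left_eq_add.mp h
  zero_smul x := by
    have h := pres_add_smul ρ R (0 : k) 0 x
    rw [add_zero] at h
    exact left_eq_add.mp h

/-- The operad `Γ(E)/(R)` generated by the right `Σ₂`-module `E` (with action `ρ`), placed in arity
two, modulo the ideal generated by the relations `R` in the arity three part of the free operad. -/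
def Pres : Operad k where
  obj := PresObj ρ R
  one := Quot.mk _ .one
  circ {m n r} h i := LinearMap.mk₂ k
    (Quot.map₂ (Term.circ h i) (fun p _ _ hq => Rel.circ_right h i p hq)
      (fun _ _ q hp => Rel.circ_left h i q hp) :
        PresObj ρ R m → PresObj ρ R n → PresObj ρ R r)
    (fun x y z => by
      induction x using Quot.ind
      induction y using Quot.ind
      induction z using Quot.ind
      exact Quot.sound (Rel.circ_add_left h i _ _ _))
    (fun c x z => by
      induction x using Quot.ind
      induction z using Quot.ind
      exact Quot.sound (Rel.circ_smul_left h i _ _ _))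
    (fun x y z => by
      induction x using Quot.ind
      induction y using Quot.ind
      induction z using Quot.ind
      exact Quot.sound (Rel.circ_add_right h i _ _ _))
    (fun c x z => by
      induction x using Quot.ind
      induction z using Quot.ind
      exact Quot.sound (Rel.circ_smul_right h i _ _ _))
  act {n} σ :=
    { toFun := (Quot.map (Term.act σ) (fun _ _ hp => Rel.act_congr σ hp) :
        PresObj ρ R n → PresObj ρ R n)
      map_add' := fun x y => by
        induction x using Quot.ind
        induction y using Quot.ind
        exact Quot.sound (Rel.act_add σ _ _)
      map_smul' := fun c x => by
        induction x using Quot.ind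
        exact Quot.sound (Rel.act_smul σ _ _) }
  act_one x := by
    induction x using Quot.ind
    exact Quot.sound (Rel.act_one _)
  act_mul σ τ x := by
    induction x using Quot.ind
    exact Quot.sound (Rel.act_mul σ τ _)
  one_circ h x := by
    induction x using Quot.ind
    exact Quot.sound (Rel.one_circ h _)
  circ_one i x := by
    induction x using Quot.ind
    exact Quot.sound (Rel.circ_one i _)
  circ_seq h₁ h₂ h₃ h₄ i j t ht x y z := by
    induction x using Quot.ind
    induction y using Quot.ind
    induction z using Quot.ind
    exact Quot.sound (Rel.circ_seq h₁ h₂ h₃ h₄ i j t ht _ _ _)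
  circ_par h₁ h₂ h₃ h₄ i j hij t ht t' ht' x y z := by
    induction x using Quot.ind
    induction y using Quot.ind
    induction z using Quot.ind
    exact Quot.sound (Rel.circ_par h₁ h₂ h₃ h₄ i j hij t ht t' ht' _ _ _)
  circ_act h i σ τ x y := by
    induction x using Quot.ind
    induction y using Quot.ind
    exact Quot.sound (Rel.circ_act h i σ τ _ _)

/-- The inclusion of the generators. -/
def presGen : E →ₗ[k] (Pres ρ R).obj 2 where
  toFun e := Quot.mk _ (.gen e)
  map_add' e e' := Quot.sound (Rel.gen_add e e')
  map_smul' c e := Quot.sound (Rel.gen_smul c e)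

end Presentation

/-! ### Quadratic operads and quadratic duals -/

section Quadratic

variable (P : Operad k)

/-- The evaluation map to `P(3)` from the arity three part `E ⊗ E ⊕ E ⊗ E ⊕ E ⊗ E` of the free
operad on `E = P(2)`. -/
def evalThree : (Fin 3 → P.obj 2 ⊗[k] P.obj 2) →ₗ[k] P.obj 3 :=
  ∑ v : Fin 3, P.act (finRotate 3 ^ v.val) ∘ₗ
    TensorProduct.lift (P.circ (by norm_num) (0 : Fin 2)) ∘ₗ LinearMap.proj v

/-- The space of quadratic relations between the binary operations of `P`. -/
def relations : Submodule k (Fin 3 → P.obj 2 ⊗[k] P.obj 2) := LinearMap.ker (evalThree P)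

/-- Evaluation in `P` of formal expressions in elements of `P(2)`. -/
def interp : ∀ {n : ℕ}, Term k (P.obj 2) n → P.obj n
  | _, .gen e => e
  | _, .tri r => evalThree P r
  | _, .one => P.one
  | _, .circ h i p q => P.circ h i (interp p) (interp q)
  | _, .act σ p => P.act σ (interp p)
  | _, .zero => 0
  | _, .add p q => interp p + interp q
  | _, .smul c p => c • interp p

theorem interp_rel {n : ℕ} {p q : Term k (P.obj 2) n}
    (h : Rel (fun σ => P.act σ) (relations P) p q) : interp P p = interp P q := by
  induction h with
  | circ_left h i q _ ih => simp only [interp, ih]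
  | circ_right h i p _ ih => simp only [interp, ih]
  | act_congr σ _ ih => simp only [interp, ih]
  | add_left q _ ih => simp only [interp, ih]
  | add_right q _ ih => simp only [interp, ih]
  | smul_congr c _ ih => simp only [interp, ih]
  | add_comm p q => exact _root_.add_comm _ _
  | add_assoc p q s => exact _root_.add_assoc _ _ _
  | zero_add p => exact _root_.zero_add _
  | neg_add p => simp [interp]
  | smul_add c p q => exact _root_.smul_add _ _ _
  | add_smul c d p => exact _root_.add_smul _ _ _
  | mul_smul c d p => exact SemigroupAction.mul_smul _ _ _
  | one_smul p => exact _root_.one_smul _ _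
  | circ_add_left h i p p' q => simp [interp]
  | circ_smul_left h i c p q => simp [interp]
  | circ_add_right h i p q q' => simp [interp]
  | circ_smul_right h i c p q => simp [interp]
  | act_add σ p q => simp [interp]
  | act_smul σ c p => simp [interp]
  | act_one p => exact P.act_one _
  | act_mul σ τ p => exact P.act_mul _ _ _
  | one_circ h q => exact P.one_circ h _
  | circ_one i p => exact P.circ_one i _
  | circ_seq h₁ h₂ h₃ h₄ i j t ht p q s => exact P.circ_seq h₁ h₂ h₃ h₄ i j t ht _ _ _
  | circ_par h₁ h₂ h₃ h₄ i j hij t ht t' ht' p q s =>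
    exact P.circ_par h₁ h₂ h₃ h₄ i j hij t ht t' ht' _ _ _
  | circ_act h i σ τ p q => exact P.circ_act h i σ τ _ _
  | gen_add e e' => rfl
  | gen_smul c e => rfl
  | gen_act σ e => rfl
  | tri_add r r' => exact map_add _ _ _
  | tri_single v e e' =>
    simp only [interp, evalThree, LinearMap.sum_apply, LinearMap.comp_apply,
      LinearMap.proj_apply]
    rw [Finset.sum_eq_single v]
    · simp
    · intro w _ hw
      simp [Pi.single_eq_of_ne hw]
    · simp
  | rel r hr => exact hr

/-- `P` is a quadratic operad: it is generated by the space `P(2)` of its binary operations, and its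
relations are generated by those in arity three, i.e. the canonical morphism `Γ(P(2))/(R) → P` is an
isomorphism, `R` being the space of quadratic relations that hold in `P`. -/
def IsQuadratic : Prop :=
  ∀ n : ℕ, Function.Bijective
    (Quot.lift (interp P) (fun _ _ h => interp_rel P h) :
      (Pres (fun σ => P.act σ) (relations P)).obj n → P.obj n)

/-- The right action of `Σ₂` on `E^∨ = P(2)^# ⊗ sgn₂`. -/
def dualAct (σ : Equiv.Perm (Fin 2)) :
    Module.Dual k (P.obj 2) →ₗ[k] Module.Dual k (P.obj 2) :=
  ((Equiv.Perm.sign σ : ℤ) : k) • (P.act σ⁻¹).dualMap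

/-- The annihilator `R^⊥`, in the arity three part of the free operad on `E^∨`, of the space of
quadratic relations of `P`. -/
def dualRelations :
    Submodule k (Fin 3 → Module.Dual k (P.obj 2) ⊗[k] Module.Dual k (P.obj 2)) where
  carrier := {s | ∀ r ∈ relations P,
    ∑ v : Fin 3, TensorProduct.dualDistrib k (P.obj 2) (P.obj 2) (s v) (r v) = 0}
  add_mem' {s s'} hs hs' r hr := by
    simp only [Pi.add_apply, map_add, LinearMap.add_apply, Finset.sum_add_distrib, hs r hr,
      hs' r hr, add_zero]
  zero_mem' r _ := by simp
  smul_mem' c s hs r hr := by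
    simp only [Pi.smul_apply, map_smul, LinearMap.smul_apply, ← Finset.smul_sum, hs r hr,
      smul_zero]

/-- The quadratic dual operad `P^! = Γ(E^∨)/(R^⊥)`. -/
def qdual : Operad k := Pres (dualAct P) (dualRelations P)

/-- The operad `𝔰(P ⊗ P^!)`. -/
@[reducible] def sPP : OperadData k := (P.hadamard (qdual P).toOperadData).susp

/-- The canonical element `χ ∈ 𝔰(P ⊗ P^!)(2)`, which corresponds to the identity of `P(2)`. -/
def chi [FiniteDimensional k (P.obj 2)] : (sPP P).obj 2 :=
  TensorProduct.map LinearMap.id (presGen (dualAct P) (dualRelations P))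
    (coevaluation k (P.obj 2) 1)

end Quadratic

/-! ### The operadic cochain complex -/

section Cochains

variable {P : Operad k} (A : PAlg P)

/-- The operad `𝔰(End_A ⊗ P^!)`. -/
@[reducible] def sEP : OperadData k :=
  ((EndOp (k := k) A.carrier).hadamard (qdual P).toOperadData).susp

/-- The morphism `𝔰(α ⊗ id) : 𝔰(P ⊗ P^!) → 𝔰(End_A ⊗ P^!)`. -/
def sAlpha (n : ℕ) : (sPP P).obj n →ₗ[k] (sEP A).obj n :=
  TensorProduct.map (A.str.map n) LinearMap.id

/-- The space of cochains `C^m_P(A;A) = [𝔰(Lin(A^{⊗(m+1)}, A) ⊗ P^!(m+1))]^{Σ_{m+1}}`. -/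
def Cochain (m : ℕ) : Type u := (sEP A).invariants (m + 1)

instance (m : ℕ) : AddCommGroup (Cochain A m) :=
  inferInstanceAs (AddCommGroup ((sEP A).invariants (m + 1)))

instance (m : ℕ) : Module k (Cochain A m) :=
  inferInstanceAs (Module k ((sEP A).invariants (m + 1)))

/-- The inclusion of the cochains into `𝔰(Lin(A^{⊗(m+1)}, A) ⊗ P^!(m+1))`. -/
def incl (m : ℕ) : Cochain A m →ₗ[k] (sEP A).obj (m + 1) := ((sEP A).invariants (m + 1)).subtype

/-- The averaging map onto the cochains. -/
def averC (m : ℕ) : (sEP A).obj (m + 1) →ₗ[k] Cochain A m := (sEP A).aver (m + 1)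

/-- The pre-Lie product `f ∘ g = ∑ᵢ f ∘ᵢ g` in `𝔰(End_A ⊗ P^!)`. -/
def preLie {m n r : ℕ} (h : r + 1 = m + n) :
    (sEP A).obj m →ₗ[k] (sEP A).obj n →ₗ[k] (sEP A).obj r :=
  ∑ i : Fin m, (sEP A).circ h i

/-- The differential `d_P f = [χ_A, f] = χ_A ∘ f - (-1)^m f ∘ χ_A` for `f ∈ C^m_P(A;A)`, where `χ_A`
is the image of the canonical element under `𝔰(α ⊗ id)`. The bracket lives on coinvariants, which
are identified with invariants by averaging. -/
def cochainD [FiniteDimensional k (P.obj 2)] (m : ℕ) : Cochain A m →ₗ[k] Cochain A (m + 1) :=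
  averC A (m + 1) ∘ₗ
    (preLie A (by omega) (sAlpha A 2 (chi P)) -
      ((-1 : k) ^ m) • (preLie A (by omega)).flip (sAlpha A 2 (chi P))) ∘ₗ
    incl A m

/-- The graded vector space `C^*_P(A;A) = ⨁ₘ C^m_P(A;A)`. -/
def CTot : Type u := ⨁ m : ℕ, Cochain A m

instance : AddCommGroup (CTot A) := inferInstanceAs (AddCommGroup (⨁ m : ℕ, Cochain A m))

instance : Module k (CTot A) := inferInstanceAs (Module k (⨁ m : ℕ, Cochain A m))

/-- The inclusion `C^m_P(A;A) → C^*_P(A;A)`. -/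
def ofDeg (m : ℕ) : Cochain A m →ₗ[k] CTot A := DirectSum.lof k ℕ (fun m => Cochain A m) m

/-- The differential `d_P` on `C^*_P(A;A)`. -/
def totalD [FiniteDimensional k (P.obj 2)] : CTot A →ₗ[k] CTot A :=
  DirectSum.toModule k ℕ (CTot A) fun m => ofDeg A (m + 1) ∘ₗ cochainD A m

/-- The grading involution `f ↦ (-1)^{|f|} f` of `C^*_P(A;A)`. -/
def eps : CTot A →ₗ[k] CTot A :=
  DirectSum.toModule k ℕ (CTot A) fun m => ((-1 : k) ^ m) • ofDeg A m

theorem totalD_ofDeg [FiniteDimensional k (P.obj 2)] (m : ℕ) (f : Cochain A m) :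
    totalD A (ofDeg A m f) = ofDeg A (m + 1) (cochainD A m f) :=
  DirectSum.toModule_lof k m f

theorem eps_ofDeg (m : ℕ) (f : Cochain A m) : eps A (ofDeg A m f) = ((-1 : k) ^ m) • ofDeg A m f :=
  DirectSum.toModule_lof k m f

theorem eps_totalD [FiniteDimensional k (P.obj 2)] (x : CTot A) :
    totalD A (eps A x) = -eps A (totalD A x) := by
  suffices h : totalD A ∘ₗ eps A = -(eps A ∘ₗ totalD A) from LinearMap.congr_fun h x
  refine DirectSum.linearMap_ext k fun m => LinearMap.ext fun f => ?_
  change totalD A (eps A (ofDeg A m f)) = -eps A (totalD A (ofDeg A m f))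
  simp [totalD_ofDeg, eps_ofDeg, pow_succ]

/-- The operadic cohomology `H^*_P(A;A)`, the cohomology of `(C^*_P(A;A), d_P)`. -/
abbrev HP [FiniteDimensional k (P.obj 2)] : Type u :=
  LinearMap.ker (totalD A) ⧸ (LinearMap.range (totalD A)).submoduleOf (LinearMap.ker (totalD A))

/-- The cohomology class of a cocycle. -/
def HP.mk [FiniteDimensional k (P.obj 2)] : LinearMap.ker (totalD A) →ₗ[k] HP A :=
  Submodule.mkQ _

/-- The grading involution `x ↦ (-1)^{|x|} x` of `H^*_P(A;A)`. -/
def epsH [FiniteDimensional k (P.obj 2)] : HP A →ₗ[k] HP A :=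
  Submodule.mapQ _ _
    ((eps A).restrict (p := LinearMap.ker (totalD A)) (q := LinearMap.ker (totalD A))
      (fun x hx => by
        rw [LinearMap.mem_ker] at hx ⊢
        rw [eps_totalD, hx, map_zero, neg_zero]))
    (by
      rintro ⟨x, hx⟩ ⟨y, hy⟩
      refine ⟨-eps A y, ?_⟩
      change totalD A (-eps A y) = eps A x
      rw [map_neg, eps_totalD, neg_neg, hy]
      rfl)

end Cochains

/-! ### Multilinear operations on graded vector spaces, with the Koszul sign rule -/

section Graded

variable (V : Type u) [AddCommGroup V] [Module k V]

/-- The `n`-linear operations on `V`. -/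
abbrev Ops (n : ℕ) : Type u := MultilinearMap k (fun _ : Fin n => V) V

variable {V} (ε : V →ₗ[k] V)

/-- The partial composition `U ∘ᵢ W` of operations on a graded vector space with grading involution
`ε`, where `W` has degree `e`:
`(U ∘ᵢ W)(f₁, …) = (-1)^{e(|f₁| + ⋯ + |fᵢ₋₁|)} U(f₁, …, fᵢ₋₁, W(fᵢ, …), …)`. -/
def gradedCirc (e : ℕ) {m n r : ℕ} (h : r + 1 = m + n) (i : Fin m) (U : Ops (k := k) V m)
    (W : Ops (k := k) V n) : Ops (k := k) V r :=
  (EndOp V).circ h i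
    (U.compLinearMap (fun j => if j < i then ε ^ e else LinearMap.id)) W

/-- The projection onto the part of parity `b`. -/
def parityPart (b : Fin 2) : V →ₗ[k] V := (2⁻¹ : k) • (LinearMap.id + ((-1 : k) ^ b.val) • ε)

variable (k) in
/-- The Koszul sign of the permutation `f₁ ⊗ ⋯ ⊗ fₙ ↦ ± f_{σ⁻¹(1)} ⊗ ⋯ ⊗ f_{σ⁻¹(n)}` of homogeneous
elements with parities `b`. -/
def koszulSign {n : ℕ} (σ : Equiv.Perm (Fin n)) (b : Fin n → Fin 2) : k :=
  ∏ p : Fin n × Fin n, if p.1 < p.2 ∧ σ p.2 < σ p.1 then (-1) ^ ((b p.1).val * (b p.2).val) else 1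

/-- The right action of the symmetric group on operations on a graded vector space:
`(Uσ)(f₁, …, fₙ) = ± U(f_{σ⁻¹(1)}, …, f_{σ⁻¹(n)})` with the Koszul sign. -/
def gradedAct {n : ℕ} (σ : Equiv.Perm (Fin n)) (U : Ops (k := k) V n) : Ops (k := k) V n :=
  ∑ b : Fin n → Fin 2,
    koszulSign k σ b • ((EndOp V).act σ U).compLinearMap (fun i => parityPart ε (b i))

end Graded

/-! ### Natural operations -/

section Natural

/-- Rooted trees with black vertices decorated by elements of `P` of arity at least two, with white
vertices `wᵢ` of arity `a i`, and with legs labelled by `Fin l`. The inputs of every vertex are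
linearly ordered. -/
inductive NTree (P : Operad k) {n : ℕ} (a : Fin n → ℕ) (l : ℕ) : Type u
  | leg : Fin l → NTree P a l
  | white : (i : Fin n) → (Fin (a i) → NTree P a l) → NTree P a l
  | black : {r : ℕ} → 2 ≤ r → P.obj r → (Fin r → NTree P a l) → NTree P a l

namespace NTree

variable {P : Operad k} {n : ℕ} {a : Fin n → ℕ} {l : ℕ}

/-- The number of legs with label `j`. -/
def legCount (j : Fin l) : NTree P a l → ℕ
  | leg j' => if j' = j then 1 else 0
  | white _ c => ∑ s, legCount j (c s)
  | black _ _ c => ∑ s, legCount j (c s)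

/-- The number of occurrences of the white vertex `wᵢ`. -/
def whiteCount (i : Fin n) : NTree P a l → ℕ
  | leg _ => 0
  | white i' c => (if i' = i then 1 else 0) + ∑ s, whiteCount i (c s)
  | black _ _ c => ∑ s, whiteCount i (c s)

/-- Every label of a leg and every white vertex occurs exactly once. -/
def IsProper (T : NTree P a l) : Prop :=
  (∀ j, T.legCount j = 1) ∧ ∀ i, T.whiteCount i = 1

/-- The value at `x` of the composition in `End_A` along the tree, in which the white vertex `wᵢ` is
decorated by `φ i` and the decorations of the black vertices act through the structure map of `A`. -/
def eval (A : PAlg P) (φ : ∀ i, Ops (k := k) A.carrier (a i)) (x : Fin l → A.carrier) :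
    NTree P a l → A.carrier
  | leg j => x j
  | white i c => φ i (fun s => eval A φ x (c s))
  | black (r := r) _ p c => A.str.map r p (fun s => eval A φ x (c s))

end NTree

variable (P : Operad k)

/-- Families, indexed by all `P`-algebras `A`, of `n`-linear operations on `C^*_P(A;A)`. -/
abbrev OpFamily (n : ℕ) : Type (u + 1) := ∀ A : PAlg P, Ops (k := k) (CTot A) n

/-- Families, indexed by all `P`-algebras `A`, of multilinear operations
`C^{p₁}_P(A;A) ⊗ ⋯ ⊗ C^{pₙ}_P(A;A) → C^m_P(A;A)`. -/
abbrev HomFamily {n : ℕ} (p : Fin n → ℕ) (m : ℕ) : Type (u + 1) :=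
  ∀ A : PAlg P, MultilinearMap k (fun i => Cochain A (p i)) (Cochain A m)

/-- `u` is the natural operation `U_{(T,Φ)}`: on a tensor product of decomposable elements
`φᵢ ⊗ qᵢ` of `Lin(A^{⊗(pᵢ+1)}, A) ⊗ 𝔰P^!(pᵢ+1)` one puts `Ũ = T(φ₁, …, φₙ) ⊗ Φ(q₁, …, qₙ)`, extends
`Ũ` multilinearly, and averages its values over the symmetric group. -/
def IsTreeOp {P : Operad k} {n : ℕ} {p : Fin n → ℕ} {m : ℕ}
    (T : NTree P (fun i => p i + 1) (m + 1))
    (Φ : MultilinearMap k (fun i => (qdual P).obj (p i + 1)) ((qdual P).obj (m + 1)))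
    (u : HomFamily P p m) : Prop :=
  ∀ A : PAlg P,
    ∃ (TA : (∀ i, Ops (k := k) A.carrier (p i + 1)) → Ops (k := k) A.carrier (m + 1))
      (U : MultilinearMap k (fun i => (sEP A).obj (p i + 1)) ((sEP A).obj (m + 1))),
      (∀ φ x, TA φ x = T.eval A φ x) ∧
      (∀ φ q, U (fun i => φ i ⊗ₜ[k] q i) = TA φ ⊗ₜ[k] Φ q) ∧
      ∀ f : ∀ i, Cochain A (p i), u A f = averC A m (U fun i => incl A (p i) (f i))

/-- The span of the natural operations `U_{(T,Φ)}` of multidegree `(p₁, …, pₙ; m)`. -/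
def treeSpan {n : ℕ} (p : Fin n → ℕ) (m : ℕ) : Submodule k (HomFamily P p m) :=
  Submodule.span k {u | ∃ T Φ, T.IsProper ∧ IsTreeOp T Φ u}

variable {P} in
/-- The multilinear operation on `C^*_P(A;A)` with given components on `C^{p₁} ⊗ ⋯ ⊗ C^{pₙ}`. -/
def ofComponents (A : PAlg P) (n : ℕ) :
    ((p : Fin n → ℕ) → MultilinearMap k (fun i => Cochain A (p i)) (CTot A)) →ₗ[k]
      Ops (k := k) (CTot A) n :=
  (MultilinearMap.fromDirectSumEquiv (R := k) (κ := fun _ : Fin n => ℕ)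
    (M := fun (_ : Fin n) (m : ℕ) => Cochain A m) (M' := CTot A)).toLinearMap

/-- An operation of degree `d` on `C^*_P(A;A)`, assembled from its components
`C^{p₁} ⊗ ⋯ ⊗ C^{pₙ} → C^{p₁ + ⋯ + pₙ + d}`. -/
def assemble (n d : ℕ) :
    ((p : Fin n → ℕ) → HomFamily P p (∑ i, p i + d)) →ₗ[k] OpFamily P n :=
  LinearMap.pi fun A =>
    ofComponents A n ∘ₗ LinearMap.pi fun p =>
      (ofDeg A (∑ i, p i + d)).compMultilinearMapₗ k ∘ₗ
        (LinearMap.proj A : HomFamily P p (∑ i, p i + d) →ₗ[k] _) ∘ₗ LinearMap.proj p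

/-- `B^d_P(n)`, the space of natural `n`-linear operations of degree `d`. -/
def natOps (n d : ℕ) : Submodule k (OpFamily P n) :=
  (Submodule.pi Set.univ fun p : Fin n → ℕ => treeSpan P p (∑ i, p i + d)).map (assemble P n d)

/-- The unit of `B_P`. -/
def natOne : OpFamily P 1 := fun A => (EndOp (k := k) (CTot A)).one

variable {P} in
/-- The partial composition in `B_P`; the second operation has degree `e`. -/
def natCirc (e : ℕ) {m n r : ℕ} (h : r + 1 = m + n) (i : Fin m) (U : OpFamily P m)
    (W : OpFamily P n) : OpFamily P r :=
  fun A => gradedCirc (eps A) e h i (U A) (W A)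

variable {P} in
/-- The action of the symmetric group on `B_P`. -/
def natAct {n : ℕ} (σ : Equiv.Perm (Fin n)) (U : OpFamily P n) : OpFamily P n :=
  fun A => gradedAct (eps A) σ (U A)

section Differential

variable [FiniteDimensional k (P.obj 2)]

/-- The differential of operations of degree `d`:
`δ_P(U)(f₁, …, fₙ) = d_P U(f₁, …, fₙ) - (-1)^d ∑ᵢ (-1)^{|f₁| + ⋯ + |fᵢ₋₁|} U(f₁, …, d_P fᵢ, …, fₙ)`. -/
def delta (n d : ℕ) : OpFamily P n →ₗ[k] OpFamily P n :=
  LinearMap.pi fun A =>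
    ((totalD A).compMultilinearMapₗ k -
      ((-1 : k) ^ d) • ∑ i : Fin n, MultilinearMap.compLinearMapₗ (fun j : Fin n =>
        if j < i then eps A else if j = i then totalD A else LinearMap.id)) ∘ₗ
    LinearMap.proj A

/-- The `δ_P`-cocycles in `B^d_P(n)`. -/
def cocycles (n d : ℕ) : Submodule k (OpFamily P n) :=
  natOps P n d ⊓ LinearMap.ker (delta P n d)

/-- The `δ_P`-coboundaries in `B^d_P(n)`; recall that `B_P` vanishes in negative degrees. -/
def coboundaries (n : ℕ) : ℕ → Submodule k (OpFamily P n)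
  | 0 => ⊥
  | d + 1 => (natOps P n d).map (delta P n d)

/-- `H^d(B_P(n), δ_P)`. -/
abbrev HB (n d : ℕ) : Type (u + 1) :=
  cocycles P n d ⧸ (coboundaries P n d).submoduleOf (cocycles P n d)

/-- The cohomology class of a cocycle. -/
def HB.mk (n d : ℕ) : cocycles P n d →ₗ[k] HB P n d := Submodule.mkQ _

/-- The operad structure on `H^*(B_P, δ_P)` induced by the one of `B_P`. -/
structure HBOperad where
  one : HB P 1 0
  circ : ∀ {m n r d d' e : ℕ} (_ : r + 1 = m + n) (_ : e = d + d') (_ : Fin m),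
    HB P m d →ₗ[k] HB P n d' →ₗ[k] HB P r e
  act : ∀ {n d : ℕ} (_ : Equiv.Perm (Fin n)), HB P n d →ₗ[k] HB P n d
  one_eq : ∃ hc : natOne P ∈ cocycles P 1 0, one = HB.mk P 1 0 ⟨natOne P, hc⟩
  circ_mk : ∀ {m n r d d' e : ℕ} (h : r + 1 = m + n) (he : e = d + d') (i : Fin m)
    (U : cocycles P m d) (W : cocycles P n d'),
    ∃ hc : natCirc d' h i U.1 W.1 ∈ cocycles P r e,
      circ h he i (HB.mk P m d U) (HB.mk P n d' W) = HB.mk P r e ⟨natCirc d' h i U.1 W.1, hc⟩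
  act_mk : ∀ {n d : ℕ} (σ : Equiv.Perm (Fin n)) (U : cocycles P n d),
    ∃ hc : natAct σ U.1 ∈ cocycles P n d,
      act σ (HB.mk P n d U) = HB.mk P n d ⟨natAct σ U.1, hc⟩

end Differential

/-! ### The cup products -/

/-- The component of the operation `cup(t)`, `t ∈ 𝔰(P ⊗ P^!)(N+1)`, on `C^{p₁} ⊗ ⋯`:
`cup(t)(f₁, …) = Aver(t(f₁, …))`, where `t` acts through `𝔰(α ⊗ id)` and the composition of the
operad `𝔰(End_A ⊗ P^!)`. -/
def cupComp (N : ℕ) (p : Fin (N + 1) → ℕ) (A : PAlg P) :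
    (sPP P).obj (N + 1) →ₗ[k]
      MultilinearMap k (fun i => Cochain A (p i)) (Cochain A (∑ i, p i + N)) :=
  (averC A (∑ i, p i + N)).compMultilinearMapₗ k ∘ₗ
    MultilinearMap.compLinearMapₗ (fun i => incl A (p i)) ∘ₗ
    (sEP A).gamma (fun i => p i + 1)
      (by simp only [Finset.sum_add_distrib, Finset.sum_const, Finset.card_univ,
            Fintype.card_fin, smul_eq_mul, mul_one]; omega) ∘ₗ
    sAlpha A (N + 1)

/-- The map `cup : 𝔰(P ⊗ P^!)(N+1) → B^N_P(N+1)`. (Quadratic operads vanish in arity zero.) -/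
def cup (N : ℕ) : (sPP P).obj (N + 1) →ₗ[k] OpFamily P (N + 1) :=
  assemble P (N + 1) N ∘ₗ LinearMap.pi fun p => LinearMap.pi fun A => cupComp P N p A

variable [FiniteDimensional k (P.obj 2)]

/-- `Z_P(N+1)`, the space of those elements of `𝔰(P ⊗ P^!)(N+1)` that are `δ_P`-closed in `B_P`. -/
def ZP (N : ℕ) : Submodule k ((sPP P).obj (N + 1)) :=
  LinearMap.ker (delta P (N + 1) N ∘ₗ cup P N)

/-- `Z_P` is a suboperad of `𝔰(P ⊗ P^!)`. -/
structure ZPIsSuboperad : Prop where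
  one_mem : (sPP P).one ∈ ZP P 0
  circ_mem : ∀ {m n r : ℕ} (h : r + 1 + 1 = (m + 1) + (n + 1)) (i : Fin (m + 1)),
    ∀ t ∈ ZP P m, ∀ s ∈ ZP P n, (sPP P).circ h i t s ∈ ZP P r
  act_mem : ∀ {n : ℕ} (σ : Equiv.Perm (Fin (n + 1))), ∀ t ∈ ZP P n, (sPP P).act σ t ∈ ZP P n

variable {P}

/-- The maps `c : Z_P(N+1) → H^N(B_P(N+1), δ_P)` form a morphism of operads. -/
structure IsOperadMap (hZ : ZPIsSuboperad P) (H : HBOperad P)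
    (c : ∀ N, ZP P N →ₗ[k] HB P (N + 1) N) : Prop where
  map_one : c 0 ⟨(sPP P).one, hZ.one_mem⟩ = H.one
  map_circ : ∀ {m n r : ℕ} (h : r + 1 + 1 = (m + 1) + (n + 1)) (i : Fin (m + 1))
    (t : ZP P m) (s : ZP P n),
    c r ⟨(sPP P).circ h i t.1 s.1, hZ.circ_mem h i t.1 t.2 s.1 s.2⟩ =
      H.circ h (by omega) i (c m t) (c n s)
  map_act : ∀ {n : ℕ} (σ : Equiv.Perm (Fin (n + 1))) (t : ZP P n),
    c n ⟨(sPP P).act σ t.1, hZ.act_mem σ t.1 t.2⟩ = H.act σ (c n t)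

/-- The maps `a` make `H^*_P(A;A)` an algebra over the operad `H^*(B_P, δ_P)`. -/
structure IsHBAlgebra (H : HBOperad P) (A : PAlg P)
    (a : ∀ n d, HB P n d →ₗ[k] Ops (k := k) (HP A) n) : Prop where
  map_one : a 1 0 H.one = (EndOp (HP A)).one
  map_circ : ∀ {m n r d d' e : ℕ} (h : r + 1 = m + n) (he : e = d + d') (i : Fin m)
    (U : HB P m d) (W : HB P n d'),
    a r e (H.circ h he i U W) = gradedCirc (epsH A) d' h i (a m d U) (a n d' W)
  map_act : ∀ {n d : ℕ} (σ : Equiv.Perm (Fin n)) (U : HB P n d),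
    a n d (H.act σ U) = gradedAct (epsH A) σ (a n d U)

/-- The maps `a` make `H^*_P(A;A)` an algebra over the operad `Z_P`, whose elements of arity `N+1`
have degree `N`. -/
structure IsZPAlgebra (hZ : ZPIsSuboperad P) (A : PAlg P)
    (a : ∀ N, ZP P N →ₗ[k] Ops (k := k) (HP A) (N + 1)) : Prop where
  map_one : a 0 ⟨(sPP P).one, hZ.one_mem⟩ = (EndOp (HP A)).one
  map_circ : ∀ {m n r : ℕ} (h : r + 1 + 1 = (m + 1) + (n + 1)) (i : Fin (m + 1))
    (t : ZP P m) (s : ZP P n),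
    a r ⟨(sPP P).circ h i t.1 s.1, hZ.circ_mem h i t.1 t.2 s.1 s.2⟩ =
      gradedCirc (epsH A) n h i (a m t) (a n s)
  map_act : ∀ {n : ℕ} (σ : Equiv.Perm (Fin (n + 1))) (t : ZP P n),
    a n ⟨(sPP P).act σ t.1, hZ.act_mem σ t.1 t.2⟩ = gradedAct (epsH A) σ (a n t)

end Natural

end OperadicCohomology

end

open OperadicCohomology

/-!
A cup product is the composition in the operad `𝔰(End_A ⊗ P^!)` followed by averaging, so the
axioms of this operad (`sEP_laws`) determine how cup products compose. Of `P^!` only the operad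
structure matters, and all statements about cohomology come from the Leibniz rule for `δ_P`: the
quotients by the coboundaries are formed inside the cocycles, so that no appeal to `d_P ∘ d_P = 0`
is made.

The map `cup` is compatible with the operad structures before passing to cohomology: `cup(1) = 1`,
`cup(t ∘ᵢ s) = cup(t) ∘ᵢ cup(s)` and `cup(t σ) = cup(t) σ` hold exactly (`cup_one`, `cup_circ`,
`cup_act`). For `∘ᵢ` this is the associativity of the full composition of a suspended operad
(`Elt.plugAll_circAt`), whose sign is the Koszul sign for moving an operation past the first
arguments. The average in the middle may be dropped, since a permutation of the inputs of one of
the composed elements becomes a permutation of the inputs of the whole, which the outer average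
ignores (`averElt_plugAll_averC`). For a permutation `σ` it suffices to treat adjacent
transpositions; there parallel compositions are exchanged, which produces the Koszul sign
(`Elt.orbFix_plugAll_swap`). All compositions are carried out on elements of unspecified arity
(`Elt`), so that no casts between arities occur.

The space of natural operations is closed under the operad structure: composing `U_{(T,Φ)}` with
`U_{(S,Ψ)}` amounts to substituting `S`, averaged over the permutations of its legs, into a white
vertex of `T` (`homComp_mem_of_isTreeOp`, `natCirc_mem`, `natAct_mem`). The cup product with
`x ⊗ y` is given by the tree with the root `x` and one white corolla on each of its inputs
(`cup_mem`). In arity one a black vertex is not allowed, but there `x` is a multiple of the unit,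
because a quadratic operad is generated by binary operations (`IsQuadratic.arity_one`); this is
the only place where quadraticity is used.

Since `d_P` anticommutes with the grading involution, `δ_P` is an equivariant derivation
(`opDiff_gradedCirc`, `opDiff_gradedAct`). Hence cocycles are closed under the operad structure
and coboundaries form an ideal in them, which gives the operad `H^*(B_P, δ_P)`, and the preimage
`Z_P` of the cocycles under `cup` is a suboperad. A `δ_P`-cocycle maps cocycles of `A` to
cocycles, and to a coboundary as soon as one of the arguments is a coboundary
(`mem_range_of_opDiff_eq_zero`), while a `δ_P`-coboundary maps cocycles to coboundaries
(`apply_mem_range`). So the action on cochains descends to cohomology, and a `Z_P`-algebra is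
obtained by pulling back along `cup`.
-/

noncomputable section

namespace OperadicCohomology

variable {k : Type u} [Field k]

/-! ### Block permutations and their signs -/

theorem slot_symm_inl_val {m n r : ℕ} (h : r + 1 = m + n) (i : Fin m) (x : {x : Fin m // x ≠ i}) :
    ((slot h i).symm (Sum.inl x)).val = if x.1.val < i.val then x.1.val else x.1.val + n - 1 := by
  change Fin.val (if hx : x.1.val < i.val then _ else _) = _
  split_ifs <;> rfl

theorem slot_symm_inr_val {m n r : ℕ} (h : r + 1 = m + n) (i : Fin m) (y : Fin n) :
    ((slot h i).symm (Sum.inr y)).val = i.val + y.val := rfl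

theorem slot_symm_inl_congr {m n r : ℕ} (h : r + 1 = m + n) {i i' : Fin m} (e : i = i')
    {x x' : Fin m} (ex : x = x') (hx : x ≠ i) (hx' : x' ≠ i') :
    (slot h i).symm (Sum.inl ⟨x, hx⟩) = (slot h i').symm (Sum.inl ⟨x', hx'⟩) := by
  subst e ex; rfl

theorem slot_symm_inr_congr {m n r : ℕ} (h : r + 1 = m + n) {i i' : Fin m} (e : i = i')
    (y : Fin n) :
    (slot h i).symm (Sum.inr y) = (slot h i').symm (Sum.inr y) := by
  subst e; rfl

theorem permCirc_inl {m n r : ℕ} (h : r + 1 = m + n) (i : Fin m) (σ : Equiv.Perm (Fin m))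
    (τ : Equiv.Perm (Fin n)) (x : Fin m) (hx : x ≠ i) :
    permCirc h i σ τ ((slot h i).symm (Sum.inl ⟨x, hx⟩)) =
      (slot h (σ i)).symm (Sum.inl ⟨σ x, fun e => hx (σ.injective e)⟩) := by
  simp [permCirc]

theorem permCirc_inr {m n r : ℕ} (h : r + 1 = m + n) (i : Fin m) (σ : Equiv.Perm (Fin m))
    (τ : Equiv.Perm (Fin n)) (y : Fin n) :
    permCirc h i σ τ ((slot h i).symm (Sum.inr y)) = (slot h (σ i)).symm (Sum.inr (τ y)) := by
  simp [permCirc]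

/-- The inputs of a partial composition are those of the outer and those of the inner operation. -/
@[elab_as_elim]
theorem slot_cases {m n r : ℕ} (h : r + 1 = m + n) (i : Fin m) {p : Fin r → Prop}
    (hl : ∀ x hx, p ((slot h i).symm (Sum.inl ⟨x, hx⟩)))
    (hr : ∀ y, p ((slot h i).symm (Sum.inr y))) (z : Fin r) : p z := by
  obtain ⟨s, rfl⟩ := (slot h i).symm.surjective z
  rcases s with ⟨x, hx⟩ | y
  exacts [hl x hx, hr y]

theorem permCirc_mul {m n r : ℕ} (h : r + 1 = m + n) (i : Fin m) (σ σ' : Equiv.Perm (Fin m))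
    (τ τ' : Equiv.Perm (Fin n)) :
    permCirc h i (σ * σ') (τ * τ') = permCirc h (σ' i) σ τ * permCirc h i σ' τ' := by
  ext z : 1
  refine slot_cases h i (fun x hx => ?_) (fun y => ?_) z
  · rw [Equiv.Perm.mul_apply, permCirc_inl, permCirc_inl, permCirc_inl]; rfl
  · rw [Equiv.Perm.mul_apply, permCirc_inr, permCirc_inr, permCirc_inr]; rfl

theorem permCirc_one {m n r : ℕ} (h : r + 1 = m + n) (i : Fin m) :
    permCirc h i (1 : Equiv.Perm (Fin m)) (1 : Equiv.Perm (Fin n)) = 1 := by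
  ext z : 1
  refine slot_cases h i (fun x hx => ?_) (fun y => ?_) z
  · rw [permCirc_inl]; rfl
  · rw [permCirc_inr]; rfl

theorem sign_permCirc_of_fixed {m n r : ℕ} (h : r + 1 = m + n) (i : Fin m)
    (σ : Equiv.Perm (Fin m)) (τ : Equiv.Perm (Fin n)) (hσ : σ i = i) :
    Equiv.Perm.sign (permCirc h i σ τ) = Equiv.Perm.sign σ * Equiv.Perm.sign τ := by
  have key : permCirc h i σ τ = (slot h i).symm.permCongr
      (Equiv.Perm.sumCongr (σ.subtypePerm (p := fun x => x ≠ i)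
        (fun x => by rw [not_iff_not]; constructor
                     · intro e; exact σ.injective (by rw [e, hσ])
                     · rintro rfl; exact hσ)) τ) := by
    ext z : 1
    refine slot_cases h i (fun x hx => ?_) (fun y => ?_) z
    · rw [permCirc_inl]
      simp only [Equiv.permCongr_apply, Equiv.symm_symm, Equiv.apply_symm_apply]
      exact slot_symm_inl_congr h hσ rfl _ _
    · rw [permCirc_inr]
      simp only [Equiv.permCongr_apply, Equiv.symm_symm, Equiv.apply_symm_apply]
      exact slot_symm_inr_congr h hσ _
  rw [key, Equiv.Perm.sign_permCongr, Equiv.Perm.sign_sumCongr, Equiv.Perm.sign_subtypePerm]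
  intro x hx e
  exact hx (by rw [e, hσ])

/-- Exchanging an input with a block of `n` inputs on its right is a cycle of length `n + 1`. -/
theorem sign_permCirc_swap {m n r : ℕ} (h : r + 1 = m + n) (i j : Fin m) (hij : i.val + 1 = j.val) :
    Equiv.Perm.sign (permCirc h i (Equiv.swap i j) (1 : Equiv.Perm (Fin n))) = (-1) ^ n := by
  have hj := j.isLt
  have hi' : i.val < r := by omega
  have hj' : i.val + n < r := by omega
  have : NeZero r := ⟨by omega⟩
  have key : permCirc h i (Equiv.swap i j) (1 : Equiv.Perm (Fin n)) =
      Fin.cycleIcc ⟨i.val, hi'⟩ ⟨i.val + n, hj'⟩ := by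
    ext z : 1
    refine slot_cases h i (fun x hx => ?_) (fun y => ?_) z
    · rw [permCirc_inl]
      by_cases hxj : x = j
      · subst hxj
        have e1 : (slot h i).symm (Sum.inl ⟨x, hx⟩) = ⟨i.val + n, hj'⟩ := by
          rw [Fin.ext_iff, slot_symm_inl_val]; simp only; split_ifs <;> omega
        rw [e1, Fin.cycleIcc_of_last (by simp [Fin.le_def]), Fin.ext_iff, slot_symm_inl_val]
        simp only [Equiv.swap_apply_right, Equiv.swap_apply_left]
        rw [if_pos (by omega)]
      · have hxi : x.val ≠ i.val := fun e => hx (Fin.ext e)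
        have hxj' : x.val ≠ j.val := fun e => hxj (Fin.ext e)
        by_cases hlt : x.val < i.val
        · rw [Fin.cycleIcc_of_lt]
          · rw [Fin.ext_iff, slot_symm_inl_val, slot_symm_inl_val]
            simp only [Equiv.swap_apply_left, Equiv.swap_apply_of_ne_of_ne hx hxj]
            split_ifs <;> omega
          · rw [Fin.lt_def, slot_symm_inl_val]; simp only; split_ifs; omega
        · rw [Fin.cycleIcc_of_gt]
          · rw [Fin.ext_iff, slot_symm_inl_val, slot_symm_inl_val]
            simp only [Equiv.swap_apply_left, Equiv.swap_apply_of_ne_of_ne hx hxj]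
            split_ifs <;> omega
          · rw [Fin.lt_def, slot_symm_inl_val]; simp only; split_ifs; omega
    · have hy := y.isLt
      rw [permCirc_inr, Fin.cycleIcc_of_ge_of_lt]
      · rw [Fin.ext_iff, slot_symm_inr_val, Fin.val_add, slot_symm_inr_val, Fin.val_one']
        simp only [Equiv.swap_apply_left, Equiv.Perm.coe_one, id]
        rw [Nat.add_mod_mod, Nat.mod_eq_of_lt (by omega)]
        omega
      · rw [Fin.le_def, slot_symm_inr_val]; simp
      · rw [Fin.lt_def, slot_symm_inr_val]; simp
  rw [key, Fin.sign_cycleIcc_of_le (by simp [Fin.le_def])]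
  simp

/-- The sign of a block permutation. Its dependence on the place `i` is what makes the signs of the
operadic suspension equivariant. -/
theorem sign_permCirc {m n r : ℕ} (h : r + 1 = m + n) (i : Fin m)
    (σ : Equiv.Perm (Fin m)) (τ : Equiv.Perm (Fin n)) :
    Equiv.Perm.sign (permCirc h i σ τ) =
      Equiv.Perm.sign σ * Equiv.Perm.sign τ * (-1) ^ ((n + 1) * (i.val + (σ i).val)) := by
  suffices H : ∀ i, Equiv.Perm.sign (permCirc h i σ (1 : Equiv.Perm (Fin n))) =
      Equiv.Perm.sign σ * (-1) ^ ((n + 1) * (i.val + (σ i).val)) by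
    have := permCirc_mul h i σ 1 (1 : Equiv.Perm (Fin n)) τ
    rw [mul_one, one_mul] at this
    rw [this, Equiv.Perm.sign_mul, Equiv.Perm.one_apply, H, sign_permCirc_of_fixed h i 1 τ rfl,
      Equiv.Perm.sign_one, one_mul]
    exact mul_right_comm _ _ _
  obtain _ | m := m
  · exact fun i => i.elim0
  have hmem : σ ∈ Submonoid.closure (Set.range fun i : Fin m => Equiv.swap i.castSucc i.succ) := by
    rw [Equiv.Perm.mclosure_swap_castSucc_succ]; trivial
  induction hmem using Submonoid.closure_induction with
  | one => intro i; rw [permCirc_one]; simp [← two_mul, mul_left_comm _ 2]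
  | mul a b _ _ ha hb =>
    intro i
    have := permCirc_mul h i a b (1 : Equiv.Perm (Fin n)) 1
    rw [mul_one] at this
    rw [this, Equiv.Perm.sign_mul, ha, hb, Equiv.Perm.sign_mul, Equiv.Perm.mul_apply]
    rw [mul_mul_mul_comm, ← pow_add]
    congr 1
    rw [← mul_add, show (b i).val + (a (b i)).val + (i.val + (b i).val) =
      i.val + (a (b i)).val + 2 * (b i).val by ring, mul_add, pow_add,
      mul_left_comm _ 2, pow_mul _ 2, neg_one_sq, one_pow, mul_one]
  | mem s hs =>
    obtain ⟨t, rfl⟩ := hs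
    have hadj : t.castSucc.val + 1 = t.succ.val := by simp
    have hne : t.castSucc ≠ t.succ := by simp [Fin.ext_iff]
    have hsgn : ∀ a b : ℕ, a + 1 = b →
        (-1 : ℤˣ) * (-1) ^ ((n + 1) * (a + b)) = (-1) ^ n := by
      rintro a _ rfl
      rw [show (n + 1) * (a + (a + 1)) = 2 * ((n + 1) * a) + (n + 1) by ring, pow_add, pow_mul,
        neg_one_sq, one_pow, one_mul, pow_succ', ← mul_assoc]
      simp
    intro i
    by_cases h1 : i = t.castSucc
    · subst h1
      rw [sign_permCirc_swap h _ _ hadj, Equiv.Perm.sign_swap hne, Equiv.swap_apply_left,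
        hsgn _ _ hadj]
    by_cases h2 : i = t.succ
    · subst h2
      -- the inverse of the previous case
      have := permCirc_mul h t.castSucc (Equiv.swap t.castSucc t.succ)
        (Equiv.swap t.castSucc t.succ) (1 : Equiv.Perm (Fin n)) 1
      rw [Equiv.swap_mul_self, mul_one, permCirc_one, Equiv.swap_apply_left] at this
      change Equiv.Perm.sign (permCirc h t.succ (Equiv.swap t.castSucc t.succ) 1) =
        Equiv.Perm.sign (Equiv.swap t.castSucc t.succ) *
          (-1) ^ ((n + 1) * (t.succ.val + (Equiv.swap t.castSucc t.succ t.succ).val))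
      have h3 := congrArg Equiv.Perm.sign this
      rw [Equiv.Perm.sign_one, Equiv.Perm.sign_mul, sign_permCirc_swap h _ _ hadj] at h3
      rw [Equiv.Perm.sign_swap hne, Equiv.swap_apply_right, Nat.add_comm t.succ.val, hsgn _ _ hadj,
        eq_mul_inv_of_mul_eq h3.symm]
      simp
    · have hfix : Equiv.swap t.castSucc t.succ i = i := Equiv.swap_apply_of_ne_of_ne h1 h2
      rw [sign_permCirc_of_fixed h i _ _ hfix, hfix]
      simp [← two_mul, mul_left_comm _ 2]

/-- A block permutation moves only the positions it should: if `σ` fixes all positions from `s` on,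
then `σ ∘ₛ 1` fixes all positions behind the inserted block. -/
theorem permCirc_fixes {m n r : ℕ} (h : r + 1 = m + n) (i : Fin m) (σ : Equiv.Perm (Fin m))
    (hσ : ∀ x : Fin m, i.val ≤ x.val → σ x = x) (z : Fin r) (hz : i.val + n ≤ z.val) :
    permCirc h i σ (1 : Equiv.Perm (Fin n)) z = z := by
  revert hz
  refine slot_cases h i (fun x hx => ?_) (fun y => ?_) z
  · intro hz
    rw [slot_symm_inl_val] at hz
    have hx' : x.val ≠ i.val := fun e => hx (Fin.ext e)
    have hix : i.val ≤ x.val := by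
      by_contra hlt
      rw [if_pos (by simpa using hlt)] at hz
      simp only at hz
      omega
    rw [permCirc_inl]
    exact slot_symm_inl_congr h (hσ i le_rfl) (hσ x hix) _ _
  · intro hz
    have := y.isLt
    rw [slot_symm_inr_val] at hz
    omega

/-- A permutation of the inserted block fixes all positions behind the block. -/
theorem permCirc_one_fixes {m n r : ℕ} (h : r + 1 = m + n) (i : Fin m) (τ : Equiv.Perm (Fin n))
    (z : Fin r) (hz : i.val + n ≤ z.val) :
    permCirc h i (1 : Equiv.Perm (Fin m)) τ z = z := by
  revert hz
  refine slot_cases h i (fun x hx => ?_) (fun y => ?_) z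
  · intro hz
    rw [permCirc_inl]
    rfl
  · intro hz
    have := y.isLt
    rw [slot_symm_inr_val] at hz
    omega

/-! ### The axioms of operads and of suspended operads -/

/-- The axioms of an operad whose elements of arity `n` have degree `n - 1` and satisfy the Koszul
rule with the sign `-1` replaced by `ζ`. For `ζ = 1` these are the axioms of an ordinary operad, for
`ζ = -1` those of an operadic suspension. -/
structure OperadLaws (ζ : k) (O : OperadData k) : Prop where
  one_circ : ∀ {n : ℕ} (h : n + 1 = 1 + n) (q : O.obj n), O.circ h 0 O.one q = q
  circ_seq : ∀ {l m n a b c : ℕ} (h₁ : a + 1 = l + m) (h₂ : b + 1 = a + n) (h₃ : c + 1 = m + n)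
    (h₄ : b + 1 = l + c) (i : Fin l) (j : Fin m) (t : Fin a) (_ : t.val = i.val + j.val)
    (p : O.obj l) (q : O.obj m) (s : O.obj n),
    O.circ h₂ t (O.circ h₁ i p q) s = O.circ h₄ i p (O.circ h₃ j q s)
  circ_par : ∀ {l m n a b c : ℕ} (h₁ : a + 1 = l + m) (h₂ : b + 1 = a + n) (h₃ : c + 1 = l + n)
    (h₄ : b + 1 = c + m) (i j : Fin l) (_ : i < j) (t : Fin a) (_ : t.val + 1 = j.val + m)
    (t' : Fin c) (_ : t'.val = i.val) (p : O.obj l) (q : O.obj m) (s : O.obj n),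
    O.circ h₂ t (O.circ h₁ i p q) s =
      ζ ^ ((m + 1) * (n + 1)) • O.circ h₄ t' (O.circ h₃ j p s) q
  circ_act : ∀ {m n r : ℕ} (h : r + 1 = m + n) (i : Fin m) (σ : Equiv.Perm (Fin m))
    (τ : Equiv.Perm (Fin n)) (p : O.obj m) (q : O.obj n),
    O.circ h i (O.act σ p) (O.act τ q) = O.act (permCirc h i σ τ) (O.circ h (σ i) p q)

theorem Operad.laws (P : Operad k) : OperadLaws (1 : k) P.toOperadData where
  one_circ := P.one_circ
  circ_seq := P.circ_seq
  circ_par h₁ h₂ h₃ h₄ i j hij t ht t' ht' p q s := by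
    rw [one_pow, one_smul]; exact P.circ_par h₁ h₂ h₃ h₄ i j hij t ht t' ht' p q s
  circ_act := P.circ_act

theorem OperadLaws.hadamard {O Q : OperadData k} (hO : OperadLaws (1 : k) O)
    (hQ : OperadLaws (1 : k) Q) : OperadLaws (1 : k) (O.hadamard Q) where
  one_circ h q := by
    induction q using TensorProduct.induction_on with
    | zero => simp
    | add x y hx hy => rw [map_add, hx, hy]
    | tmul x y => exact congrArg₂ (fun a b => a ⊗ₜ[k] b) (hO.one_circ h x) (hQ.one_circ h y)
  circ_seq h₁ h₂ h₃ h₄ i j t ht p q s := by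
    induction p using TensorProduct.induction_on with
    | zero => simp
    | add x y hx hy => simp only [map_add, LinearMap.add_apply, hx, hy]
    | tmul p p' =>
    induction q using TensorProduct.induction_on with
    | zero => simp
    | add x y hx hy => simp only [map_add, LinearMap.add_apply, hx, hy]
    | tmul q q' =>
    induction s using TensorProduct.induction_on with
    | zero => simp
    | add x y hx hy => simp only [map_add, hx, hy]
    | tmul s s' =>
      exact congrArg₂ (fun a b => a ⊗ₜ[k] b) (hO.circ_seq h₁ h₂ h₃ h₄ i j t ht p q s)
        (hQ.circ_seq h₁ h₂ h₃ h₄ i j t ht p' q' s')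
  circ_par h₁ h₂ h₃ h₄ i j hij t ht t' ht' p q s := by
    rw [one_pow, one_smul]
    induction p using TensorProduct.induction_on with
    | zero => simp
    | add x y hx hy => simp only [map_add, LinearMap.add_apply, hx, hy]
    | tmul p p' =>
    induction q using TensorProduct.induction_on with
    | zero => simp
    | add x y hx hy => simp only [map_add, LinearMap.add_apply, hx, hy]
    | tmul q q' =>
    induction s using TensorProduct.induction_on with
    | zero => simp
    | add x y hx hy => simp only [map_add, LinearMap.add_apply, hx, hy]
    | tmul s s' =>
      have e1 := hO.circ_par h₁ h₂ h₃ h₄ i j hij t ht t' ht' p q s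
      have e2 := hQ.circ_par h₁ h₂ h₃ h₄ i j hij t ht t' ht' p' q' s'
      rw [one_pow, one_smul] at e1 e2
      exact congrArg₂ (fun a b => a ⊗ₜ[k] b) e1 e2
  circ_act h i σ τ p q := by
    induction p using TensorProduct.induction_on with
    | zero => simp
    | add x y hx hy => simp only [map_add, LinearMap.add_apply, hx, hy]
    | tmul p p' =>
    induction q using TensorProduct.induction_on with
    | zero => simp
    | add x y hx hy => simp only [map_add, hx, hy]
    | tmul q q' =>
      exact congrArg₂ (fun a b => a ⊗ₜ[k] b) (hO.circ_act h i σ τ p q) (hQ.circ_act h i σ τ p' q')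

theorem neg_one_pow_eq_of_even_sub {a b : ℕ} (h : Even (a + b)) : (-1 : k) ^ a = (-1) ^ b := by
  rcases Nat.even_or_odd a with ha | ha
  · rw [ha.neg_one_pow, ((Nat.even_add.mp h).mp ha).neg_one_pow]
  · rw [ha.neg_one_pow, Odd.neg_one_pow]
    rw [← Nat.not_even_iff_odd] at ha ⊢
    exact fun hb => ha ((Nat.even_add.mp h).mpr hb)

theorem OperadLaws.susp {O : OperadData k} (hO : OperadLaws (1 : k) O) :
    OperadLaws (-1 : k) O.susp where
  one_circ h q := by
    simp only [Fin.val_zero, mul_zero, pow_zero, one_smul]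
    exact hO.one_circ h q
  circ_seq {l m n a b c} h₁ h₂ h₃ h₄ i j t ht p q s := by
    simp only [LinearMap.smul_apply, map_smul, smul_smul]
    rw [hO.circ_seq h₁ h₂ h₃ h₄ i j t ht, ht]
    congr 1
    rw [← pow_add, ← pow_add]
    apply neg_one_pow_eq_of_even_sub
    rw [show (m + 1) * i.val + (n + 1) * (i.val + j.val) + ((n + 1) * j.val + (c + 1) * i.val) =
      (n + 1 + (m + 1) + (c + 1)) * i.val + 2 * ((n + 1) * j.val) by ring, h₃]
    exact ⟨(n + 1 + m) * i.val + (n + 1) * j.val, by ring⟩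
  circ_par {l m n a b c} h₁ h₂ h₃ h₄ i j hij t ht t' ht' p q s := by
    simp only [LinearMap.smul_apply, map_smul, smul_smul]
    rw [hO.circ_par h₁ h₂ h₃ h₄ i j hij t ht t' ht', one_pow, one_smul, ht']
    congr 1
    simp only [← pow_add]
    apply neg_one_pow_eq_of_even_sub
    -- shift the position to avoid subtraction
    have e : (n + 1) * t.val + (n + 1) = (n + 1) * (j.val + m) := by rw [← ht]; ring
    have key : (n + 1) * t.val + (m + 1) * i.val +
        ((m + 1) * (n + 1) + (m + 1) * i.val + (n + 1) * j.val) + 2 * (n + 1) =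
        2 * ((n + 1) * (j.val + m) + (n + 1) + (m + 1) * i.val) := by
      calc _ = ((n + 1) * t.val + (n + 1)) + (n + 1) + 2 * ((m + 1) * i.val) +
            (m + 1) * (n + 1) + (n + 1) * j.val := by ring
        _ = _ := by rw [e]; ring
    refine (Nat.even_add.mp (key ▸ even_two_mul _)).mpr (even_two_mul _) |> fun h => ?_
    convert h using 1
    ring
  circ_act {m n r} h i σ τ p q := by
    simp only [LinearMap.smul_apply, map_smul, smul_smul]
    rw [hO.circ_act, sign_permCirc]
    congr 1
    push_cast
    rw [show (-1 : k) ^ ((n + 1) * (i.val + (σ i).val)) =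
      (-1) ^ ((n + 1) * i.val) * (-1) ^ ((n + 1) * (σ i).val) by rw [mul_add, pow_add]]
    have hs : (-1 : k) ^ ((n + 1) * (σ i).val) * (-1) ^ ((n + 1) * (σ i).val) = 1 := by
      rw [← mul_pow]; simp
    linear_combination (-((Equiv.Perm.sign σ : ℤ) : k) * ((Equiv.Perm.sign τ : ℤ) : k) *
      (-1) ^ ((n + 1) * i.val)) * hs

section EndOp

variable {V : Type u} [AddCommGroup V] [Module k V]

theorem endOp_circ_apply {m n r : ℕ} (h : r + 1 = m + n) (i : Fin m)
    (φ : MultilinearMap k (fun _ : Fin m => V) V) (ψ : MultilinearMap k (fun _ : Fin n => V) V)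
    (x : Fin r → V) : (EndOp (k := k) V).circ h i φ ψ x = φ (outerInput h i ψ x) := rfl

theorem endOp_act_apply {n : ℕ} (σ : Equiv.Perm (Fin n))
    (φ : MultilinearMap k (fun _ : Fin n => V) V) (x : Fin n → V) :
    (EndOp (k := k) V).act σ φ x = φ (fun j => x (σ⁻¹ j)) := rfl

theorem endOp_one_apply (x : Fin 1 → V) : (EndOp (k := k) V).one x = x 0 := rfl

theorem perm_inv_apply_self {α : Type*} (σ : Equiv.Perm α) (x : α) : σ⁻¹ (σ x) = x :=
  σ.symm_apply_apply x

theorem outerInput_self {m n r : ℕ} (h : r + 1 = m + n) (i : Fin m)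
    (ψ : MultilinearMap k (fun _ : Fin n => V) V) (x : Fin r → V) :
    outerInput h i ψ x i = ψ (fun y => x ((slot h i).symm (Sum.inr y))) := by
  simp [outerInput]

theorem outerInput_ne {m n r : ℕ} (h : r + 1 = m + n) (i : Fin m)
    (ψ : MultilinearMap k (fun _ : Fin n => V) V) (x : Fin r → V) {j : Fin m} (hj : j ≠ i) :
    outerInput h i ψ x j = x ((slot h i).symm (Sum.inl ⟨j, hj⟩)) := by
  simp [outerInput, hj]

theorem outerInput_lt {m n r : ℕ} (h : r + 1 = m + n) (i : Fin m)
    (ψ : MultilinearMap k (fun _ : Fin n => V) V) (x : Fin r → V) {j : Fin m} (hj : j.val < i.val)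
    (z : Fin r) (hz : z.val = j.val) : outerInput h i ψ x j = x z := by
  rw [outerInput_ne h i ψ x (by rintro rfl; omega)]
  congr 1
  rw [Fin.ext_iff, slot_symm_inl_val, if_pos hj, hz]

theorem outerInput_gt {m n r : ℕ} (h : r + 1 = m + n) (i : Fin m)
    (ψ : MultilinearMap k (fun _ : Fin n => V) V) (x : Fin r → V) {j : Fin m} (hj : i.val < j.val)
    (z : Fin r) (hz : z.val + 1 = j.val + n) : outerInput h i ψ x j = x z := by
  rw [outerInput_ne h i ψ x (by rintro rfl; omega)]
  congr 1
  rw [Fin.ext_iff, slot_symm_inl_val, if_neg (by simp; omega)]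
  simp only
  omega

theorem endOp_laws : OperadLaws (1 : k) (EndOp (k := k) V) where
  one_circ h q := by
    ext x
    rw [endOp_circ_apply, endOp_one_apply, outerInput_self]
    congr 1
    funext y
    congr 1
    rw [Fin.ext_iff, slot_symm_inr_val]
    simp
  circ_seq {l m n a b c} h₁ h₂ h₃ h₄ i j t ht p q s := by
    ext x
    rw [endOp_circ_apply, endOp_circ_apply, endOp_circ_apply]
    congr 1
    funext y
    rcases lt_trichotomy y.val i.val with hy | hy | hy
    · have := i.isLt
      rw [outerInput_lt h₁ i q _ hy ⟨y.val, by omega⟩ rfl,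
        outerInput_lt h₂ t s x (by simp; omega) ⟨y.val, by omega⟩ rfl,
        outerInput_lt h₄ i _ x hy ⟨y.val, by omega⟩ rfl]
    · obtain rfl := Fin.ext hy
      rw [outerInput_self, outerInput_self, endOp_circ_apply]
      congr 1
      funext w
      rcases lt_trichotomy w.val j.val with hw | hw | hw
      · rw [outerInput_lt h₂ t s x (by rw [slot_symm_inr_val]; omega)
          ⟨y.val + w.val, by omega⟩ (by rw [slot_symm_inr_val]),
          outerInput_lt h₃ j s _ hw ⟨w.val, by omega⟩ rfl]
        congr 1
      · obtain rfl := Fin.ext hw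
        have e : (slot h₁ y).symm (Sum.inr w) = t := by
          rw [Fin.ext_iff, slot_symm_inr_val, ht]
        rw [e, outerInput_self, outerInput_self]
        congr 1
        funext v
        congr 1
        simp only [Fin.ext_iff, slot_symm_inr_val]
        omega
      · rw [outerInput_gt h₂ t s x (by rw [slot_symm_inr_val]; omega)
          ⟨y.val + w.val + n - 1, by omega⟩ (by rw [slot_symm_inr_val]; simp only; omega),
          outerInput_gt h₃ j s _ hw ⟨w.val + n - 1, by omega⟩ (by simp only; omega)]
        congr 1
        simp only [Fin.ext_iff, slot_symm_inr_val]
        omega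
    · have := j.isLt
      rw [outerInput_gt h₁ i q _ hy ⟨y.val + m - 1, by omega⟩ (by simp only; omega),
        outerInput_gt h₂ t s x (by simp only; omega) ⟨y.val + m - 1 + n - 1, by omega⟩
          (by simp only; omega),
        outerInput_gt h₄ i _ x hy ⟨y.val + m - 1 + n - 1, by omega⟩ (by simp only; omega)]
  circ_par {l m n a b c} h₁ h₂ h₃ h₄ i j hij t ht t' ht' p q s := by
    rw [one_pow, one_smul]
    have hij' : i.val < j.val := hij
    have hjl := j.isLt
    ext x
    rw [endOp_circ_apply, endOp_circ_apply, endOp_circ_apply, endOp_circ_apply]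
    congr 1
    funext y
    have hyl := y.isLt
    rcases lt_trichotomy y.val i.val with hy | hy | hy
    · rw [outerInput_lt h₁ i q _ hy ⟨y.val, by omega⟩ rfl,
        outerInput_lt h₂ t s x (by simp; omega) ⟨y.val, by omega⟩ rfl,
        outerInput_lt h₃ j s _ (by omega) ⟨y.val, by omega⟩ rfl,
        outerInput_lt h₄ t' q x (by simp; omega) ⟨y.val, by omega⟩ rfl]
    · obtain rfl := Fin.ext hy
      have e : t' = ⟨y.val, by omega⟩ := Fin.ext ht'
      rw [outerInput_self, outerInput_lt h₃ j s _ hij' t' ht', outerInput_self]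
      congr 1
      funext w
      have := w.isLt
      rw [outerInput_lt h₂ t s x (by rw [slot_symm_inr_val]; omega)
          ⟨y.val + w.val, by omega⟩ (by rw [slot_symm_inr_val])]
      congr 1
      simp only [Fin.ext_iff, slot_symm_inr_val]
      omega
    · rcases lt_trichotomy y.val j.val with hw | hw | hw
      · rw [outerInput_gt h₁ i q _ hy ⟨y.val + m - 1, by omega⟩ (by simp only; omega),
          outerInput_lt h₂ t s x (by simp; omega) ⟨y.val + m - 1, by omega⟩ rfl,
          outerInput_lt h₃ j s _ hw ⟨y.val, by omega⟩ rfl,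
          outerInput_gt h₄ t' q x (by simp only; omega) ⟨y.val + m - 1, by omega⟩
            (by simp only; omega)]
      · obtain rfl := Fin.ext hw
        rw [outerInput_gt h₁ i q _ hy t (by omega), outerInput_self, outerInput_self]
        congr 1
        funext v
        have := v.isLt
        rw [outerInput_gt h₄ t' q x (by rw [slot_symm_inr_val]; omega)
          ⟨y.val + v.val + m - 1, by omega⟩ (by rw [slot_symm_inr_val]; simp only; omega)]
        congr 1
        simp only [Fin.ext_iff, slot_symm_inr_val]
        omega
      · rw [outerInput_gt h₁ i q _ hy ⟨y.val + m - 1, by omega⟩ (by simp only; omega),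
          outerInput_gt h₂ t s x (by simp only; omega) ⟨y.val + m - 1 + n - 1, by omega⟩
            (by simp only; omega),
          outerInput_gt h₃ j s _ hw ⟨y.val + n - 1, by omega⟩ (by simp only; omega),
          outerInput_gt h₄ t' q x (by simp only; omega) ⟨y.val + m - 1 + n - 1, by omega⟩
            (by simp only; omega)]
  circ_act {m n r} h i σ τ p q := by
    ext x
    rw [endOp_circ_apply, endOp_act_apply, endOp_act_apply, endOp_circ_apply]
    congr 1
    funext j
    obtain ⟨j, rfl⟩ := σ.surjective j
    rw [perm_inv_apply_self]
    by_cases hj : j = i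
    · subst hj
      rw [outerInput_self, outerInput_self, endOp_act_apply]
      congr 1
      funext y
      obtain ⟨y, rfl⟩ := τ.surjective y
      rw [perm_inv_apply_self, ← permCirc_inr h j σ τ, perm_inv_apply_self]
    · rw [outerInput_ne h i _ x hj, outerInput_ne h _ _ _ (fun e => hj (σ.injective e)),
        ← permCirc_inl h i σ τ j hj, perm_inv_apply_self]

end EndOp

theorem sEP_laws {P : Operad k} (A : PAlg P) : OperadLaws (-1 : k) (sEP A) :=
  (endOp_laws.hadamard (qdual P).laws).susp

/-! ### Elements of unspecified arity and successive composition -/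

/-- An element of an operad together with its arity. -/
def Elt (O : OperadData k) : Type u := Σ n, O.obj n

namespace Elt

variable {O : OperadData k}

/-- The element `x ∈ O(n)`, regarded as an element of unspecified arity. -/
def mk {n : ℕ} (x : O.obj n) : Elt O := ⟨n, x⟩

/-- The number of inputs. -/
def arity (x : Elt O) : ℕ := x.1

instance : SMul k (Elt O) := ⟨fun c x => mk (c • x.2)⟩

@[simp] theorem arity_mk {n : ℕ} (x : O.obj n) : (mk x).arity = n := rfl

@[simp] theorem arity_smul (c : k) (x : Elt O) : (c • x).arity = x.arity := rfl

theorem smul_mk {n : ℕ} (c : k) (x : O.obj n) : c • mk x = mk (c • x) := rfl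

theorem mul_smul (c d : k) (x : Elt O) : (c * d) • x = c • d • x :=
  congrArg (Sigma.mk x.1) (SemigroupAction.mul_smul c d x.2)

theorem one_smul (x : Elt O) : (1 : k) • x = x :=
  congrArg (Sigma.mk x.1) (_root_.one_smul k x.2)

theorem mk_surj (x : Elt O) : ∃ (n : ℕ) (p : O.obj n), x = mk p := ⟨x.1, x.2, rfl⟩

/-- The partial composition `x ∘ₛ y` at a position given by a natural number; it is `x` when `x` has
no input with the number `s`. -/
def circAt (x : Elt O) (s : ℕ) (y : Elt O) : Elt O :=
  if hs : s < x.1 then ⟨x.1 + y.1 - 1, O.circ (by omega) ⟨s, hs⟩ x.2 y.2⟩ else x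

theorem circAt_mk {m n r : ℕ} (h : r + 1 = m + n) (i : Fin m) (p : O.obj m) (q : O.obj n) :
    circAt (mk p) i.val (mk q) = mk (O.circ h i p q) := by
  obtain rfl : r = m + n - 1 := by omega
  exact dif_pos i.isLt

theorem circAt_mk' {m n r : ℕ} (h : r + 1 = m + n) {s : ℕ} (hs : s < m) (p : O.obj m)
    (q : O.obj n) : circAt (mk p) s (mk q) = mk (O.circ h ⟨s, hs⟩ p q) :=
  circAt_mk h ⟨s, hs⟩ p q

theorem circAt_of_le {x : Elt O} {s : ℕ} (h : x.arity ≤ s) (y : Elt O) : circAt x s y = x :=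
  dif_neg (not_lt.mpr h)

theorem arity_circAt {x : Elt O} {s : ℕ} (h : s < x.arity) (y : Elt O) :
    (circAt x s y).arity + 1 = x.arity + y.arity := by
  obtain ⟨m, p, rfl⟩ := mk_surj x
  obtain ⟨n, q, rfl⟩ := mk_surj y
  simp only [arity_mk] at h
  rw [circAt_mk' (r := m + n - 1) (by omega) h]
  simp only [arity_mk]
  omega

theorem smul_circAt (c : k) (x : Elt O) (s : ℕ) (y : Elt O) :
    circAt (c • x) s y = c • circAt x s y := by
  obtain ⟨m, p, rfl⟩ := mk_surj x
  obtain ⟨n, q, rfl⟩ := mk_surj y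
  by_cases hs : s < m
  · rw [smul_mk, circAt_mk' (r := m + n - 1) (by omega) hs,
      circAt_mk' (r := m + n - 1) (by omega) hs, smul_mk, map_smul, LinearMap.smul_apply]
  · rw [circAt_of_le (by simpa using hs), circAt_of_le (by simpa using hs)]

theorem circAt_seq {ζ : k} (hO : OperadLaws ζ O) {x y : Elt O} {i j : ℕ} (hi : i < x.arity)
    (hj : j < y.arity) (z : Elt O) :
    circAt (circAt x i y) (i + j) z = circAt x i (circAt y j z) := by
  obtain ⟨l, p, rfl⟩ := mk_surj x
  obtain ⟨m, q, rfl⟩ := mk_surj y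
  obtain ⟨n, s, rfl⟩ := mk_surj z
  simp only [arity_mk] at hi hj
  rw [circAt_mk' (r := l + m - 1) (by omega) hi,
    circAt_mk' (r := l + m - 1 + n - 1) (by omega) (by omega),
    circAt_mk' (r := m + n - 1) (by omega) hj,
    circAt_mk' (r := l + m - 1 + n - 1) (by omega) hi]
  congr 1
  exact hO.circ_seq _ _ _ _ _ _ _ rfl _ _ _

theorem circAt_par (hO : OperadLaws (-1 : k) O) {x : Elt O} {i u : ℕ}
    (hi : i + 1 + u < x.arity) (y z : Elt O) :
    circAt (circAt x (i + 1 + u) z) i y =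
      (-1 : k) ^ ((y.arity + 1) * (z.arity + 1)) •
        circAt (circAt x i y) (i + y.arity + u) z := by
  obtain ⟨l, p, rfl⟩ := mk_surj x
  obtain ⟨m, q, rfl⟩ := mk_surj y
  obtain ⟨n, s, rfl⟩ := mk_surj z
  simp only [arity_mk] at hi ⊢
  rw [circAt_mk' (r := l + n - 1) (by omega) hi,
    circAt_mk' (r := l + m - 1 + n - 1) (by omega) (by omega),
    circAt_mk' (r := l + m - 1) (by omega) (by omega),
    circAt_mk' (r := l + m - 1 + n - 1) (by omega) (by omega), smul_mk,
    hO.circ_par (l := l) (m := m) (n := n) (a := l + m - 1) (b := l + m - 1 + n - 1)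
      (c := l + n - 1) (by omega) (by omega) (by omega) (by omega) ⟨i, by omega⟩ ⟨i + 1 + u, hi⟩
      (by rw [Fin.lt_def]; simp only; omega) ⟨i + m + u, by omega⟩ (by simp only; omega)
      ⟨i, by omega⟩ rfl, smul_smul, ← mul_pow]
  simp

/-- Plug `f₀, f₁, …` successively into the inputs of `x` that have the numbers `s, s + 1, …`. -/
def plugAll (s : ℕ) (x : Elt O) : List (Elt O) → Elt O
  | [] => x
  | f :: F => plugAll (s + f.arity) (circAt x s f) F

/-- The total number of inputs of a list of elements. -/
def total (F : List (Elt O)) : ℕ := (F.map arity).sum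

@[simp] theorem total_nil : total ([] : List (Elt O)) = 0 := rfl

@[simp] theorem total_cons (f : Elt O) (F : List (Elt O)) : total (f :: F) = f.arity + total F := by
  simp [total]

theorem plugAll_append (F G : List (Elt O)) (s : ℕ) (x : Elt O) :
    plugAll s x (F ++ G) = plugAll (s + total F) (plugAll s x F) G := by
  induction F generalizing s x with
  | nil => rfl
  | cons f F ih => simp only [List.cons_append, plugAll, ih, total_cons, add_assoc]

theorem arity_plugAll (F : List (Elt O)) (s : ℕ) (x : Elt O) (h : s + F.length ≤ x.arity) :
    (plugAll s x F).arity + F.length = x.arity + total F := by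
  induction F generalizing s x with
  | nil => rfl
  | cons f F ih =>
    simp only [List.length_cons, plugAll, total_cons] at h ⊢
    have h1 := arity_circAt (x := x) (s := s) (by omega) f
    have h2 := ih (s + f.arity) (circAt x s f) (by omega)
    omega

theorem plugAll_smul (c : k) (F : List (Elt O)) (s : ℕ) (x : Elt O) :
    plugAll s (c • x) F = c • plugAll s x F := by
  induction F generalizing s x with
  | nil => rfl
  | cons f F ih => simp only [plugAll, smul_circAt, ih]

/-- Plugging into inputs on the left of the one which receives `q` commutes with plugging in `q`, up
to the Koszul sign. -/
theorem plugAll_circAt_left (hO : OperadLaws (-1 : k) O) (q : Elt O) (F : List (Elt O)) (s : ℕ)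
    (x : Elt O) (h : s + F.length < x.arity) :
    plugAll s (circAt x (s + F.length) q) F =
      (-1 : k) ^ ((q.arity + 1) * (total F + F.length)) •
        circAt (plugAll s x F) (s + total F) q := by
  induction F generalizing s x with
  | nil => simp [plugAll, one_smul]
  | cons f F ih =>
    simp only [List.length_cons, plugAll, total_cons] at h ⊢
    have h1 := arity_circAt (x := x) (s := s) (by omega) f
    rw [show s + (F.length + 1) = s + 1 + F.length by omega, circAt_par hO (by omega),
      plugAll_smul, ih _ _ (by omega), ← mul_smul, ← pow_add, add_assoc s]
    congr 2
    ring

/-- Plugging into the inputs of `y` commutes with plugging `y` into `x`. -/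
theorem plugAll_circAt_inner {ζ : k} (hO : OperadLaws ζ O) (G : List (Elt O)) (s u : ℕ)
    (x y : Elt O) (hs : s < x.arity) (h : u + G.length ≤ y.arity) :
    plugAll (s + u) (circAt x s y) G = circAt x s (plugAll u y G) := by
  induction G generalizing u y with
  | nil => rfl
  | cons g G ih =>
    simp only [List.length_cons, plugAll] at h ⊢
    have h1 := arity_circAt (x := y) (s := u) (by omega) g
    rw [circAt_seq hO hs (by omega), add_assoc, ih _ _ (by omega)]

/-- Associativity of the full composition. -/
theorem plugAll_circAt (hO : OperadLaws (-1 : k) O) (x y : Elt O) (F₁ G F₂ : List (Elt O))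
    (hx : x.arity = F₁.length + 1 + F₂.length) (hy : y.arity = G.length) :
    plugAll 0 (circAt x F₁.length y) (F₁ ++ (G ++ F₂)) =
      (-1 : k) ^ ((y.arity + 1) * (total F₁ + F₁.length)) •
        plugAll 0 x (F₁ ++ plugAll 0 y G :: F₂) := by
  have hF := arity_plugAll F₁ 0 x (by omega)
  have hG := arity_plugAll G 0 y (by omega)
  have e1 := plugAll_circAt_left hO y F₁ 0 x (by omega)
  have e2 := plugAll_circAt_inner hO G (total F₁) 0 (plugAll 0 x F₁) y (by omega) (by omega)
  rw [zero_add] at e1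
  rw [add_zero] at e2
  rw [plugAll_append, e1, plugAll_smul, plugAll_append, plugAll_append, plugAll]
  simp only [zero_add] at e2 ⊢
  rw [e2, show (plugAll 0 y G).arity = total G by omega]

/-- The full composition of an operad is the successive composition. -/
theorem mk_gammaAux (O : OperadData k) (n s N r : ℕ) (a : Fin n → ℕ) (hN : N = s + n)
    (hr : r = s + ∑ i, a i) (t : O.obj N) (f : ∀ i, O.obj (a i)) :
    mk (O.gammaAux n s N r a hN hr t f) = plugAll s (mk t) (List.ofFn fun i => mk (f i)) := by
  induction n generalizing s N with
  | zero =>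
    have e : N = r := by simp at hr; omega
    subst e
    rfl
  | succ n ih =>
    have : O.gammaAux (n + 1) s N r a hN hr t f =
      O.gammaAux n (s + a 0) (s + a 0 + n) r (fun i => a i.succ) rfl
        (by rw [hr, Fin.sum_univ_succ]; omega)
        (O.circ (by omega) ⟨s, by omega⟩ t (f 0)) (fun i => f i.succ) := rfl
    rw [this, ih, List.ofFn_succ, plugAll, circAt_mk' (r := s + a 0 + n) (by omega) (by omega)]
    rfl

theorem mk_gamma (O : OperadData k) {n r : ℕ} (a : Fin n → ℕ) (hr : r = ∑ i, a i) (t : O.obj n)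
    (f : ∀ i, O.obj (a i)) :
    mk (O.gamma a hr t f) = plugAll 0 (mk t) (List.ofFn fun i => mk (f i)) :=
  mk_gammaAux O n 0 n r a _ _ t f

/-! ### Equivariance of the successive composition -/

/-- `x = y σ` for a permutation `σ` which fixes the inputs from the number `s` on. -/
def OrbFix (s : ℕ) (x y : Elt O) : Prop :=
  ∃ (n : ℕ) (p : O.obj n) (σ : Equiv.Perm (Fin n)), (∀ z : Fin n, s ≤ z.val → σ z = z) ∧
    x = mk (O.act σ p) ∧ y = mk p

theorem OrbFix.circAt {ζ : k} (hO : OperadLaws ζ O) {s : ℕ} {x y : Elt O} (h : OrbFix s x y)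
    (f : Elt O) : OrbFix (s + f.arity) (x.circAt s f) (y.circAt s f) := by
  obtain ⟨m, p, σ, hσ, rfl, rfl⟩ := h
  obtain ⟨n, q, rfl⟩ := mk_surj f
  by_cases hs : s < m
  · rw [circAt_mk' (r := m + n - 1) (by omega) hs, circAt_mk' (r := m + n - 1) (by omega) hs]
    have hr : m + n - 1 + 1 = m + n := by omega
    refine ⟨_, _, permCirc hr ⟨s, hs⟩ σ 1, permCirc_fixes hr ⟨s, hs⟩ σ hσ, ?_, rfl⟩
    have := hO.circ_act (r := m + n - 1) (by omega) ⟨s, hs⟩ σ 1 p q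
    rw [O.act_one, hσ ⟨s, hs⟩ le_rfl] at this
    rw [this]
  · rw [circAt_of_le (by simpa using hs), circAt_of_le (by simpa using hs)]
    exact ⟨m, p, σ, fun z hz => hσ z (by omega), rfl, rfl⟩

theorem OrbFix.plugAll {ζ : k} (hO : OperadLaws ζ O) {s : ℕ} {x y : Elt O} (h : OrbFix s x y)
    (F : List (Elt O)) : ∃ s', OrbFix s' (plugAll s x F) (plugAll s y F) := by
  induction F generalizing s x y with
  | nil => exact ⟨s, h⟩
  | cons f F ih => exact ih (h.circAt hO f)

theorem orbFix_circAt_act {ζ : k} (hO : OperadLaws ζ O) (x : Elt O) {s n : ℕ} (hs : s < x.arity)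
    (τ : Equiv.Perm (Fin n)) (q : O.obj n) :
    OrbFix (s + n) (circAt x s (mk (O.act τ q))) (circAt x s (mk q)) := by
  obtain ⟨m, p, rfl⟩ := mk_surj x
  simp only [arity_mk] at hs
  rw [circAt_mk' (r := m + n - 1) (by omega) hs, circAt_mk' (r := m + n - 1) (by omega) hs]
  refine ⟨_, _, permCirc (by omega) ⟨s, hs⟩ 1 τ, permCirc_one_fixes _ ⟨s, hs⟩ τ, ?_, rfl⟩
  have := hO.circ_act (r := m + n - 1) (by omega) ⟨s, hs⟩ 1 τ p q
  rw [O.act_one] at this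
  rw [this]
  rfl

/-- Permuting the inputs of one of the elements which are plugged in permutes the inputs of the
composition. -/
theorem orbFix_plugAll_act {ζ : k} (hO : OperadLaws ζ O) (x : Elt O) (F₁ F₂ : List (Elt O))
    (hx : F₁.length < x.arity) {n : ℕ} (τ : Equiv.Perm (Fin n)) (q : O.obj n) :
    ∃ s, OrbFix s (plugAll 0 x (F₁ ++ mk (O.act τ q) :: F₂))
      (plugAll 0 x (F₁ ++ mk q :: F₂)) := by
  have hF := arity_plugAll F₁ 0 x (by omega)
  rw [plugAll_append, plugAll_append]
  exact (orbFix_circAt_act hO _ (by omega) τ q).plugAll hO F₂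

/-- `x = y σ`, where `σ` exchanges the adjacent inputs with the numbers `j` and `j + 1`. -/
def SwapRel (j : ℕ) (x y : Elt O) : Prop :=
  ∃ (n : ℕ) (p : O.obj n) (σ : Equiv.Perm (Fin n)), j + 1 < n ∧
    (∀ z : Fin n, (σ z).val = if z.val = j then j + 1 else if z.val = j + 1 then j else z.val) ∧
    x = mk (O.act σ p) ∧ y = mk p

theorem swapRel_swap {n : ℕ} (i j : Fin n) (hij : i.val + 1 = j.val) (p : O.obj n) :
    SwapRel i.val (mk (O.act (Equiv.swap i j) p)) (mk p) := by
  refine ⟨n, p, _, by omega, fun z => ?_, rfl, rfl⟩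
  rw [Equiv.swap_apply_def]
  simp only [Fin.ext_iff]
  split_ifs <;> omega

theorem SwapRel.circAt {ζ : k} (hO : OperadLaws ζ O) {s u : ℕ} {x y : Elt O}
    (h : SwapRel (s + 1 + u) x y) (f : Elt O) :
    SwapRel (s + f.arity + u) (x.circAt s f) (y.circAt s f) := by
  obtain ⟨m, p, σ, hm, hσ, rfl, rfl⟩ := h
  obtain ⟨n, q, rfl⟩ := mk_surj f
  have hs : s < m := by omega
  have hr : m + n - 1 + 1 = m + n := by omega
  have hfix : σ ⟨s, hs⟩ = ⟨s, hs⟩ := by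
    rw [Fin.ext_iff, hσ, if_neg (by simp only; omega), if_neg (by simp only; omega)]
  rw [circAt_mk' hr hs, circAt_mk' hr hs]
  refine ⟨_, _, permCirc hr ⟨s, hs⟩ σ 1, by simp only [arity_mk]; omega, fun z => ?_, ?_, rfl⟩
  · change _ = if z.val = s + n + u then s + n + u + 1
      else if z.val = s + n + u + 1 then s + n + u else z.val
    refine slot_cases hr ⟨s, hs⟩ (fun x hx => ?_) (fun y => ?_) z
    · have hx' : x.val ≠ s := fun e => hx (Fin.ext e)
      rw [permCirc_inl, slot_symm_inl_val, slot_symm_inl_val]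
      simp only [hfix, hσ x]
      split_ifs <;> omega
    · have hy := y.isLt
      rw [permCirc_inr, slot_symm_inr_val, slot_symm_inr_val,
        if_neg (by simp only; omega), if_neg (by simp only; omega), hfix]
      rfl
  · have := hO.circ_act hr ⟨s, hs⟩ σ 1 p q
    rw [O.act_one, hfix] at this
    rw [this]

theorem SwapRel.plugAll {ζ : k} (hO : OperadLaws ζ O) (F : List (Elt O)) {s : ℕ} {x y : Elt O}
    (h : SwapRel (s + F.length) x y) :
    SwapRel (s + total F) (plugAll s x F) (plugAll s y F) := by
  induction F generalizing s x y with
  | nil => exact h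
  | cons f F ih =>
    simp only [List.length_cons, total_cons] at h ⊢
    rw [show s + (F.length + 1) = s + 1 + F.length by omega] at h
    rw [← add_assoc]
    exact ih (h.circAt hO f)

theorem SwapRel.circAt_circAt (hO : OperadLaws (-1 : k) O) {j : ℕ} {x y : Elt O}
    (h : SwapRel j x y) (f g : Elt O) :
    OrbFix (j + f.arity + g.arity) ((x.circAt j f).circAt (j + f.arity) g)
      ((-1 : k) ^ ((f.arity + 1) * (g.arity + 1)) •
        (y.circAt j g).circAt (j + g.arity) f) := by
  obtain ⟨m, p, σ, hm, hσ, rfl, rfl⟩ := h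
  have e := circAt_par hO (x := mk p) (i := j) (u := 0) hm g f
  rw [Nat.mul_comm (f.arity + 1)]
  simp only [add_zero] at e
  rw [← e]
  obtain ⟨a, f, rfl⟩ := mk_surj f
  obtain ⟨b, g, rfl⟩ := mk_surj g
  simp only [arity_mk]
  have hj : j < m := by omega
  have hr : m + a - 1 + 1 = m + a := by omega
  have hr' : m + a - 1 + b - 1 + 1 = m + a - 1 + b := by omega
  have hσj : σ ⟨j, hj⟩ = ⟨j + 1, hm⟩ := by simp [Fin.ext_iff, hσ]
  have hσj' : σ ⟨j + 1, hm⟩ = ⟨j, hj⟩ := by simp [Fin.ext_iff, hσ]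
  have c1 := hO.circ_act hr ⟨j, hj⟩ σ 1 p f
  rw [O.act_one, hσj] at c1
  set σ' := permCirc hr ⟨j, hj⟩ σ (1 : Equiv.Perm (Fin a)) with hσ'
  have hlt : j + a < m + a - 1 := by omega
  have hσ'j : σ' ⟨j + a, hlt⟩ = ⟨j, by omega⟩ := by
    have : (⟨j + a, hlt⟩ : Fin (m + a - 1)) = (slot hr ⟨j, hj⟩).symm
        (Sum.inl ⟨⟨j + 1, hm⟩, by simp [Fin.ext_iff]⟩) := by
      rw [Fin.ext_iff, slot_symm_inl_val]
      simp only
      split_ifs <;> omega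
    rw [this, hσ', permCirc_inl, Fin.ext_iff, slot_symm_inl_val]
    simp only [hσj, hσj']
    split_ifs <;> omega
  have hσ'fix : ∀ z : Fin (m + a - 1), j + a < z.val → σ' z = z := by
    intro z
    refine slot_cases hr ⟨j, hj⟩ (fun x hx => ?_) (fun y => ?_) z
    · intro hz
      have hx' : x.val ≠ j := fun e => hx (Fin.ext e)
      rw [slot_symm_inl_val] at hz
      simp only at hz
      rw [hσ', permCirc_inl, Fin.ext_iff, slot_symm_inl_val, slot_symm_inl_val]
      simp only [hσj, hσ x]
      split_ifs at hz ⊢ <;> omega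
    · intro hz
      rw [slot_symm_inr_val] at hz
      have := y.isLt
      simp only at hz
      omega
  have c2 := hO.circ_act hr' ⟨j + a, hlt⟩ σ' 1 (O.circ hr ⟨j + 1, hm⟩ p f) g
  rw [O.act_one, hσ'j] at c2
  rw [circAt_mk' hr hj, circAt_mk' hr hm, c1, circAt_mk' hr' hlt,
    circAt_mk' hr' (show j < m + a - 1 by omega), c2]
  refine ⟨_, _, permCirc hr' ⟨j + a, hlt⟩ σ' 1, fun z => ?_, rfl, rfl⟩
  refine slot_cases hr' ⟨j + a, hlt⟩ (fun x hx => ?_) (fun y => ?_) z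
  · intro hz
    have hx' : x.val ≠ j + a := fun e => hx (Fin.ext e)
    rw [slot_symm_inl_val] at hz
    simp only at hz
    have hxa : j + a < x.val := by
      split_ifs at hz <;> omega
    rw [permCirc_inl, Fin.ext_iff, slot_symm_inl_val, slot_symm_inl_val]
    simp only [hσ'j, hσ'fix x hxa]
    split_ifs <;> omega
  · intro hz
    rw [slot_symm_inr_val] at hz
    have := y.isLt
    simp only at hz
    omega

/-- Exchanging two adjacent inputs of an element of degree `n - 1` exchanges the elements which are
plugged into them, up to the Koszul sign and a permutation of the inputs of the composition. -/
theorem orbFix_plugAll_swap (hO : OperadLaws (-1 : k) O) {n : ℕ} (i j : Fin n)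
    (hij : i.val + 1 = j.val) (p : O.obj n) (F₁ F₂ : List (Elt O)) (hF : F₁.length = i.val)
    (f g : Elt O) :
    ∃ s, OrbFix s (plugAll 0 (mk (O.act (Equiv.swap i j) p)) (F₁ ++ f :: g :: F₂))
      ((-1 : k) ^ ((f.arity + 1) * (g.arity + 1)) •
        plugAll 0 (mk p) (F₁ ++ g :: f :: F₂)) := by
  have h0 := swapRel_swap i j hij p
  rw [← hF, ← zero_add F₁.length] at h0
  have h1 := ((h0.plugAll hO F₁).circAt_circAt hO f g).plugAll hO F₂
  rw [plugAll_smul] at h1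
  rw [plugAll_append, plugAll_append]
  simp only [Elt.plugAll]
  rwa [show 0 + total F₁ + g.arity + f.arity = 0 + total F₁ + f.arity + g.arity by omega]

end Elt

/-! ### Koszul signs -/

section Koszul

variable {n : ℕ}

theorem neg_one_pow_mul_self (a : ℕ) : (-1 : k) ^ a * (-1) ^ a = 1 := by
  rw [← mul_pow]; simp

/-- A product over unordered pairs may be reindexed by a permutation. -/
theorem prod_pairs_perm (F : Fin n → Fin n → k) (hF : ∀ i j, F i j = F j i)
    (τ : Equiv.Perm (Fin n)) :
    ∏ p : Fin n × Fin n, (if p.1 < p.2 then F (τ p.1) (τ p.2) else 1) =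
      ∏ p : Fin n × Fin n, if p.1 < p.2 then F p.1 p.2 else 1 := by
  rw [← Finset.prod_filter, ← Finset.prod_filter]
  refine Finset.prod_bij'
    (fun p _ => if τ p.1 < τ p.2 then (τ p.1, τ p.2) else (τ p.2, τ p.1))
    (fun p _ => if τ⁻¹ p.1 < τ⁻¹ p.2 then (τ⁻¹ p.1, τ⁻¹ p.2) else (τ⁻¹ p.2, τ⁻¹ p.1))
    ?_ ?_ ?_ ?_ ?_
  · rintro ⟨a, b⟩ hp
    simp only [Finset.mem_filter, Finset.mem_univ, true_and] at hp ⊢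
    have : τ a ≠ τ b := fun e => hp.ne (τ.injective e)
    split_ifs with h
    · exact h
    · exact lt_of_le_of_ne (not_lt.mp h) this.symm
  · rintro ⟨a, b⟩ hp
    simp only [Finset.mem_filter, Finset.mem_univ, true_and] at hp ⊢
    have : τ⁻¹ a ≠ τ⁻¹ b := fun e => hp.ne (τ⁻¹.injective e)
    split_ifs with h
    · exact h
    · exact lt_of_le_of_ne (not_lt.mp h) this.symm
  · rintro ⟨a, b⟩ hp
    simp only [Finset.mem_filter, Finset.mem_univ, true_and] at hp ⊢
    split_ifs with h h' h' <;> simp_all [not_lt_of_gt]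
  · rintro ⟨a, b⟩ hp
    simp only [Finset.mem_filter, Finset.mem_univ, true_and] at hp ⊢
    split_ifs with h h' h' <;> simp_all [not_lt_of_gt]
  · rintro ⟨a, b⟩ hp
    simp only
    split_ifs
    · rfl
    · exact hF _ _

theorem koszulSign_eq (σ : Equiv.Perm (Fin n)) (b : Fin n → Fin 2) :
    koszulSign k σ b = ∏ p : Fin n × Fin n, if p.1 < p.2 then
      (if (p.1 < p.2 ↔ σ p.1 < σ p.2) then 1 else (-1) ^ ((b p.1).val * (b p.2).val)) else 1 := by
  refine Finset.prod_congr rfl fun p _ => ?_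
  by_cases h : p.1 < p.2
  · have hne : σ p.1 ≠ σ p.2 := fun e => h.ne (σ.injective e)
    by_cases h' : σ p.1 < σ p.2
    · simp [h, h', not_lt_of_gt h']
    · simp [h, h', lt_of_le_of_ne (not_lt.mp h') hne.symm]
  · simp [h]

theorem koszulSign_mul (σ τ : Equiv.Perm (Fin n)) (b : Fin n → Fin 2) :
    koszulSign k (σ * τ) b =
      koszulSign k τ b * koszulSign k σ (fun i => b (τ⁻¹ i)) := by
  have key := prod_pairs_perm (k := k) (fun i j => if (i < j ↔ σ i < σ j) then 1 else
      (-1) ^ ((b (τ⁻¹ i)).val * (b (τ⁻¹ j)).val)) (fun i j => by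
        rw [mul_comm]
        by_cases hij : i = j
        · subst hij; rfl
        · have hne : σ i ≠ σ j := fun e => hij (σ.injective e)
          refine if_congr ?_ rfl rfl
          rcases lt_or_gt_of_ne hij with h | h <;> rcases lt_or_gt_of_ne hne with h' | h' <;>
            simp [h, h', not_lt_of_gt]) τ
  rw [koszulSign_eq σ, ← key, koszulSign_eq, koszulSign_eq, ← Finset.prod_mul_distrib]
  refine Finset.prod_congr rfl fun p _ => ?_
  by_cases h : p.1 < p.2
  · simp only [h, if_true, perm_inv_apply_self, Equiv.Perm.mul_apply, true_iff]
    have hs := neg_one_pow_mul_self (k := k) ((b p.1).val * (b p.2).val)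
    by_cases h1 : τ p.1 < τ p.2 <;> by_cases h2 : σ (τ p.1) < σ (τ p.2) <;> simp [h1, h2, hs]
  · simp [h]

theorem koszulSign_one (b : Fin n → Fin 2) : koszulSign k 1 b = 1 := by
  refine Finset.prod_eq_one fun p _ => if_neg ?_
  rintro ⟨h1, h2⟩
  exact lt_asymm h1 h2

theorem koszulSign_swap (i j : Fin n) (hij : i.val + 1 = j.val) (b : Fin n → Fin 2) :
    koszulSign k (Equiv.swap i j) b = (-1) ^ ((b i).val * (b j).val) := by
  rw [koszulSign, Finset.prod_eq_single (i, j)]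
  · have : i < j := by rw [Fin.lt_def]; omega
    simp [this]
  · rintro ⟨a, c⟩ _ hne
    rw [if_neg]
    rintro ⟨h1, h2⟩
    simp only [Equiv.swap_apply_def, Fin.lt_def, Fin.ext_iff] at h1 h2
    simp only [ne_eq, Prod.mk.injEq, Fin.ext_iff, not_and] at hne
    split_ifs at h2 <;> omega
  · simp

/-- How the Koszul sign changes when the parity of one element is changed. -/
theorem koszulSign_update (σ : Equiv.Perm (Fin n)) (b : Fin n → Fin 2) (z : Fin n) :
    koszulSign k σ (Function.update b z (b z + 1)) *
        ∏ l, (if l < z then (-1 : k) ^ (b l).val else 1) =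
      koszulSign k σ b * ∏ l, if σ l < σ z then (-1 : k) ^ (b l).val else 1 := by
  have h2 : ∀ c : Fin 2, (c + 1).val + c.val = 1 := by decide
  -- the factors of the pairs which contain `z`
  have e1 : ∏ l, (if z < l ∧ σ l < σ z then (-1 : k) ^ (b l).val else 1) =
      ∏ p : Fin n × Fin n, if p.1 = z then
        (if z < p.2 ∧ σ p.2 < σ z then (-1 : k) ^ (b p.2).val else 1) else 1 := by
    rw [Fintype.prod_prod_type_right]
    simp
  have e2 : ∏ l, (if l < z ∧ σ z < σ l then (-1 : k) ^ (b l).val else 1) =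
      ∏ p : Fin n × Fin n, if p.2 = z then
        (if p.1 < z ∧ σ z < σ p.1 then (-1 : k) ^ (b p.1).val else 1) else 1 := by
    rw [Fintype.prod_prod_type]
    simp
  have e3 : koszulSign k σ (Function.update b z (b z + 1)) = koszulSign k σ b *
      ((∏ l, (if z < l ∧ σ l < σ z then (-1 : k) ^ (b l).val else 1)) *
        ∏ l, (if l < z ∧ σ z < σ l then (-1 : k) ^ (b l).val else 1)) := by
    rw [e1, e2, koszulSign, koszulSign, ← Finset.prod_mul_distrib, ← Finset.prod_mul_distrib]
    refine Finset.prod_congr rfl fun p _ => ?_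
    obtain ⟨a, c⟩ := p
    simp only
    by_cases hp : a < c ∧ σ c < σ a
    · obtain ⟨hac, hσ⟩ := hp
      by_cases ha : a = z
      · subst ha
        have hc : c ≠ a := hac.ne'
        simp only [hac, hσ, and_self, if_true, Function.update_self, Function.update_of_ne hc,
          if_neg hc, mul_one]
        rw [← pow_add]
        apply neg_one_pow_eq_of_even_sub
        have := h2 (b a)
        refine ⟨(b c).val, ?_⟩
        calc _ = ((b a + 1).val + (b a).val) * (b c).val + (b c).val := by ring
          _ = _ := by rw [this, one_mul]
      · by_cases hc : c = z
        · subst hc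
          simp only [hac, hσ, and_self, if_true, Function.update_self, Function.update_of_ne ha,
            if_neg ha, one_mul]
          rw [← pow_add]
          apply neg_one_pow_eq_of_even_sub
          have := h2 (b c)
          refine ⟨(b a).val, ?_⟩
          calc _ = ((b c + 1).val + (b c).val) * (b a).val + (b a).val := by ring
            _ = _ := by rw [this, one_mul]
        · simp [hac, hσ, ha, hc]
    · rw [if_neg hp, if_neg hp, one_mul]
      have q1 : (if a = z then (if z < c ∧ σ c < σ z then (-1 : k) ^ (b c).val else 1) else 1)
          = 1 := by
        split_ifs with h h'
        · subst h; exact absurd h' hp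
        · rfl
        · rfl
      have q2 : (if c = z then (if a < z ∧ σ z < σ a then (-1 : k) ^ (b a).val else 1) else 1)
          = 1 := by
        split_ifs with h h'
        · subst h; exact absurd h' hp
        · rfl
        · rfl
      rw [q1, q2, one_mul]
  rw [e3, mul_assoc]
  congr 1
  rw [← Finset.prod_mul_distrib, ← Finset.prod_mul_distrib]
  refine Finset.prod_congr rfl fun l _ => ?_
  have hs := neg_one_pow_mul_self (k := k) (b l).val
  rcases lt_trichotomy l z with h | h | h
  · have hne : σ l ≠ σ z := fun e => h.ne (σ.injective e)
    rcases lt_or_gt_of_ne hne with h' | h' <;> simp [h, h', not_lt_of_gt, hs]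
  · subst h; simp
  · have hne : σ l ≠ σ z := fun e => h.ne' (σ.injective e)
    rcases lt_or_gt_of_ne hne with h' | h' <;> simp [h, h', not_lt_of_gt]

end Koszul

/-! ### The graded endomorphism operad -/

section GradedOps

variable {V : Type u} [AddCommGroup V] [Module k V] (ε : V →ₗ[k] V)

theorem eps_parityPart (hε : ∀ x, ε (ε x) = x) (b : Fin 2) (x : V) :
    ε (parityPart ε b x) = (-1 : k) ^ b.val • parityPart ε b x := by
  simp only [parityPart, LinearMap.smul_apply, LinearMap.add_apply, LinearMap.id_apply, map_smul,
    map_add, hε]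
  fin_cases b <;> simp [add_comm, smul_neg]

section Act

variable [CharZero k]

theorem two_smul_half (x : V) : (2⁻¹ : k) • x + (2⁻¹ : k) • x = x := by
  rw [← add_smul, ← two_mul, mul_inv_cancel₀ two_ne_zero, one_smul]

theorem sum_parityPart (x : V) : ∑ b : Fin 2, parityPart ε b x = x := by
  simp only [Fin.sum_univ_two, parityPart, LinearMap.smul_apply, LinearMap.add_apply,
    LinearMap.id_apply, Fin.val_zero, Fin.val_one, pow_zero, pow_one, one_smul, neg_smul]
  module

theorem parityPart_of_parity {b : Fin 2} {x : V} (hx : ε x = (-1 : k) ^ b.val • x) (c : Fin 2) :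
    parityPart ε c x = if c = b then x else 0 := by
  simp only [parityPart, LinearMap.smul_apply, LinearMap.add_apply, LinearMap.id_apply, hx,
    smul_smul, ← pow_add]
  fin_cases b <;> fin_cases c <;> simp [two_smul_half]

/-- A multilinear operation is determined by its values on elements of a definite parity. -/
theorem ops_ext_parity (hε : ∀ x, ε (ε x) = x) {n : ℕ} {U W : Ops (k := k) V n}
    (h : ∀ (b : Fin n → Fin 2) (x : Fin n → V), (∀ i, ε (x i) = (-1 : k) ^ (b i).val • x i) →
      U x = W x) : U = W := by
  ext x
  have e : x = fun i => ∑ b : Fin 2, parityPart ε b (x i) :=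
    funext fun i => (sum_parityPart ε _).symm
  rw [e, MultilinearMap.map_sum, MultilinearMap.map_sum]
  exact Finset.sum_congr rfl fun b _ => h b _ fun i => eps_parityPart ε hε _ _

theorem gradedAct_apply {n : ℕ} (σ : Equiv.Perm (Fin n)) (U : Ops (k := k) V n) (b : Fin n → Fin 2)
    (x : Fin n → V) (hx : ∀ i, ε (x i) = (-1 : k) ^ (b i).val • x i) :
    gradedAct ε σ U x = koszulSign k σ b • U (fun i => x (σ⁻¹ i)) := by
  simp only [gradedAct, sum_apply, smul_apply,
    MultilinearMap.compLinearMap_apply, parityPart_of_parity ε (hx _)]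
  rw [Finset.sum_eq_single b]
  · simp only [if_true]; rfl
  · intro c _ hc
    obtain ⟨i, hi⟩ := Function.ne_iff.mp hc
    rw [MultilinearMap.map_coord_zero _ i (if_neg hi), smul_zero]
  · simp

theorem gradedAct_mul (hε : ∀ x, ε (ε x) = x) {n : ℕ} (σ τ : Equiv.Perm (Fin n))
    (U : Ops (k := k) V n) : gradedAct ε (σ * τ) U = gradedAct ε τ (gradedAct ε σ U) := by
  refine ops_ext_parity ε hε fun b x hx => ?_
  rw [gradedAct_apply ε _ _ b x hx, gradedAct_apply ε _ _ b x hx,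
    gradedAct_apply ε _ _ (fun i => b (τ⁻¹ i)) _ (fun i => hx _), koszulSign_mul, smul_smul]
  rfl

theorem gradedAct_one (hε : ∀ x, ε (ε x) = x) {n : ℕ} (U : Ops (k := k) V n) :
    gradedAct ε 1 U = U := by
  refine ops_ext_parity ε hε fun b x hx => ?_
  rw [gradedAct_apply ε _ _ b x hx, koszulSign_one, one_smul]
  rfl

end Act

/-! ### The differential of operations on a complex -/

section Diff

variable (D : V →ₗ[k] V)

/-- The arguments `(ε x₁, …, ε xᵢ₋₁, D xᵢ, xᵢ₊₁, …)`. -/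
def diffArg {n : ℕ} (i : Fin n) (x : Fin n → V) (j : Fin n) : V :=
  if j < i then ε (x j) else if j = i then D (x j) else x j

/-- The differential of an operation of degree `e` on a vector space with the grading involution `ε`
and the differential `D`. -/
def opDiff {n : ℕ} (e : ℕ) (U : Ops (k := k) V n) : Ops (k := k) V n :=
  D.compMultilinearMap U - ((-1 : k) ^ e) • ∑ i : Fin n, U.compLinearMap (fun j : Fin n =>
    if j < i then ε else if j = i then D else LinearMap.id)

theorem opDiff_apply {n : ℕ} (e : ℕ) (U : Ops (k := k) V n) (x : Fin n → V) :
    opDiff ε D e U x = D (U x) - (-1 : k) ^ e • ∑ i, U (diffArg ε D i x) := by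
  simp only [opDiff, sub_apply, LinearMap.compMultilinearMap_apply,
    smul_apply, sum_apply, MultilinearMap.compLinearMap_apply]
  congr 3
  funext i
  congr 1
  funext j
  simp only [diffArg]
  split_ifs <;> rfl

/-- Two arguments which are proportional at one place and agree elsewhere. -/
theorem map_eq_smul {n : ℕ} (U : Ops (k := k) V n) (c : k) (j : Fin n) {v w : Fin n → V}
    (hj : v j = c • w j) (h : ∀ l, l ≠ j → v l = w l) : U v = c • U w := by
  have : v = Function.update w j (c • w j) := by
    funext l
    by_cases hl : l = j
    · subst hl; simp [hj]
    · rw [Function.update_of_ne hl, h l hl]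
  rw [this, MultilinearMap.map_update_smul, Function.update_eq_self]

/-- The arguments of `U` in `(U ∘ᵢ W)(x)`, where `w` is the value of the operation `W` of degree
`e`. -/
def circArg (e : ℕ) {m n r : ℕ} (h : r + 1 = m + n) (i : Fin m) (w : V) (x : Fin r → V)
    (j : Fin m) : V :=
  if hj : j = i then w else
    if j < i then (ε ^ e) (x ((slot h i).symm (Sum.inl ⟨j, hj⟩)))
    else x ((slot h i).symm (Sum.inl ⟨j, hj⟩))

theorem gradedCirc_apply (e : ℕ) {m n r : ℕ} (h : r + 1 = m + n) (i : Fin m)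
    (U : Ops (k := k) V m) (W : Ops (k := k) V n) (x : Fin r → V) :
    gradedCirc ε e h i U W x =
      U (circArg ε e h i (W fun y => x ((slot h i).symm (Sum.inr y))) x) := by
  rw [gradedCirc, endOp_circ_apply, MultilinearMap.compLinearMap_apply]
  congr 1
  funext j
  by_cases hj : j = i
  · subst hj; simp [circArg, outerInput_self]
  · rw [outerInput_ne h i W x hj]
    simp only [circArg, dif_neg hj]
    split_ifs <;> rfl

theorem circArg_self (e : ℕ) {m n r : ℕ} (h : r + 1 = m + n) (i : Fin m) (w : V) (x : Fin r → V) :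
    circArg ε e h i w x i = w := by
  simp [circArg]

theorem circArg_eq_update (e : ℕ) {m n r : ℕ} (h : r + 1 = m + n) (i : Fin m) (w : V)
    (x : Fin r → V) : circArg ε e h i w x = Function.update (circArg ε e h i 0 x) i w := by
  funext j
  by_cases hj : j = i
  · subst hj; simp [circArg]
  · simp [circArg, hj]

theorem slot_inl_lt_inr {m n r : ℕ} (h : r + 1 = m + n) (i : Fin m) {j : Fin m} (hj : j ≠ i)
    (y : Fin n) : (slot h i).symm (Sum.inl ⟨j, hj⟩) < (slot h i).symm (Sum.inr y) ↔ j < i := by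
  have hj' : j.val ≠ i.val := fun e => hj (Fin.ext e)
  have := y.isLt
  rw [Fin.lt_def, Fin.lt_def, slot_symm_inl_val, slot_symm_inr_val]
  simp only
  split_ifs <;> omega

theorem slot_inr_lt_inl {m n r : ℕ} (h : r + 1 = m + n) (i : Fin m) {j : Fin m} (hj : j ≠ i)
    (y : Fin n) : (slot h i).symm (Sum.inr y) < (slot h i).symm (Sum.inl ⟨j, hj⟩) ↔ i < j := by
  have hj' : j.val ≠ i.val := fun e => hj (Fin.ext e)
  have := y.isLt
  rw [Fin.lt_def, Fin.lt_def, slot_symm_inl_val, slot_symm_inr_val]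
  simp only
  split_ifs <;> omega

theorem slot_inl_lt_inl {m n r : ℕ} (h : r + 1 = m + n) (i : Fin m) {j l : Fin m} (hj : j ≠ i)
    (hl : l ≠ i) :
    (slot h i).symm (Sum.inl ⟨l, hl⟩) < (slot h i).symm (Sum.inl ⟨j, hj⟩) ↔ l < j := by
  have hj' : j.val ≠ i.val := fun e => hj (Fin.ext e)
  have hl' : l.val ≠ i.val := fun e => hl (Fin.ext e)
  rw [Fin.lt_def, Fin.lt_def, slot_symm_inl_val, slot_symm_inl_val]
  simp only
  split_ifs <;> omega

theorem slot_inr_lt_inr {m n r : ℕ} (h : r + 1 = m + n) (i : Fin m) (y y' : Fin n) :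
    (slot h i).symm (Sum.inr y) < (slot h i).symm (Sum.inr y') ↔ y < y' := by
  rw [Fin.lt_def, Fin.lt_def, slot_symm_inr_val, slot_symm_inr_val]
  omega

variable {ε D}

theorem anticomm_pow (hD : ∀ x, D (ε x) = -ε (D x)) (e : ℕ) (x : V) :
    (ε ^ e) (D x) = (-1 : k) ^ e • D ((ε ^ e) x) := by
  induction e generalizing x with
  | zero => simp
  | succ e ih =>
    rw [pow_succ, Module.End.mul_apply, Module.End.mul_apply, ← neg_neg (ε (D x)), ← hD, map_neg,
      ih, pow_succ, mul_neg_one, neg_smul]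

/-- The differential of operations is a derivation of the operad of graded operations. -/
theorem opDiff_gradedCirc (hD : ∀ x, D (ε x) = -ε (D x)) (d e : ℕ) {m n r : ℕ} (h : r + 1 = m + n)
    (i : Fin m) (U : Ops (k := k) V m) (W : Ops (k := k) V n)
    (hW : ∀ x, ε (W x) = (-1 : k) ^ e • W (fun j => ε (x j))) :
    opDiff ε D (d + e) (gradedCirc ε e h i U W) =
      gradedCirc ε e h i (opDiff ε D d U) W +
        (-1 : k) ^ d • gradedCirc ε (e + 1) h i U (opDiff ε D e W) := by
  ext x
  set xi : Fin n → V := fun y => x ((slot h i).symm (Sum.inr y)) with hxi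
  have hW' : ∀ x, W (fun j => ε (x j)) = (-1 : k) ^ e • ε (W x) := fun x => by
    rw [hW, smul_smul, neg_one_pow_mul_self, one_smul]
  set v := circArg ε e h i (W xi) x with hv
  -- the differential hits an argument of `U`
  have t1 : ∀ (j : Fin m) (hj : j ≠ i),
      gradedCirc ε e h i U W (diffArg ε D ((slot h i).symm (Sum.inl ⟨j, hj⟩)) x) =
        (-1 : k) ^ e • U (diffArg ε D j v) := by
    intro j hj
    rw [gradedCirc_apply]
    rcases lt_or_gt_of_ne hj with hlt | hgt
    · refine map_eq_smul U _ j ?_ fun l hl => ?_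
      · simp only [circArg, dif_neg hj, if_pos hlt, diffArg, lt_irrefl, if_false, if_true, hv]
        rw [anticomm_pow hD]
      · by_cases hli : l = i
        · subst hli
          rw [circArg_self]
          simp only [diffArg, not_lt_of_gt hlt, hl, if_false, hv, circArg_self]
          congr 1
          funext y
          rw [if_neg, if_neg]
          · simp
          · rw [slot_inr_lt_inl]; exact not_lt_of_gt hlt
        · simp only [circArg, dif_neg hli, diffArg, slot_inl_lt_inl, hv,
            EmbeddingLike.apply_eq_iff_eq, Sum.inl.injEq, Subtype.mk.injEq, hl, if_false]
          split_ifs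
          · rw [← Module.End.mul_apply, ← Module.End.mul_apply, ← pow_succ, ← pow_succ']
          · rfl
          · omega
          · rfl
    · refine map_eq_smul U _ i ?_ fun l hl => ?_
      · rw [circArg_self]
        simp only [diffArg, hgt, if_true, hv, circArg_self]
        rw [← hW']
        congr 1
        funext y
        rw [if_pos]
        rw [slot_inr_lt_inl]; exact hgt
      · by_cases hlj : l = j
        · subst hlj
          simp only [circArg, dif_neg hl, diffArg, lt_irrefl, if_false, if_true,
            not_lt_of_gt hgt, hv]
        · simp only [circArg, dif_neg hl, diffArg, slot_inl_lt_inl, hv,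
            EmbeddingLike.apply_eq_iff_eq, Sum.inl.injEq, Subtype.mk.injEq, hlj, if_false]
          split_ifs
          · rw [← Module.End.mul_apply, ← Module.End.mul_apply, ← pow_succ, ← pow_succ']
          · omega
          · rfl
          · rfl
  -- the differential hits an argument of `W`
  have t2 : ∀ y : Fin n,
      gradedCirc ε e h i U W (diffArg ε D ((slot h i).symm (Sum.inr y)) x) =
        U (circArg ε (e + 1) h i (W (diffArg ε D y xi)) x) := by
    intro y
    rw [gradedCirc_apply]
    congr 1
    funext l
    by_cases hl : l = i
    · subst hl
      rw [circArg_self, circArg_self]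
      congr 1
      funext y'
      simp only [diffArg, slot_inr_lt_inr, EmbeddingLike.apply_eq_iff_eq, Sum.inr.injEq, hxi]
    · simp only [circArg, dif_neg hl, diffArg, slot_inl_lt_inr, EmbeddingLike.apply_eq_iff_eq,
        reduceCtorEq, if_false]
      split_ifs
      · rw [← Module.End.mul_apply, ← pow_succ]
      · rfl
  -- the differential of the value of `W`
  have t3 : diffArg ε D i v = circArg ε (e + 1) h i (D (W xi)) x := by
    funext l
    by_cases hl : l = i
    · subst hl
      simp only [diffArg, lt_irrefl, if_false, if_true, hv, circArg_self]
    · simp only [diffArg, if_neg hl, hv, circArg, dif_neg hl]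
      split_ifs
      · rw [← Module.End.mul_apply, ← pow_succ']
      · rfl
  have hsum : ∀ F : Fin r → V, ∑ z, F z = (∑ j : {j : Fin m // j ≠ i},
      F ((slot h i).symm (Sum.inl j))) + ∑ y, F ((slot h i).symm (Sum.inr y)) := fun F => by
    rw [← Equiv.sum_comp (slot h i).symm F, Fintype.sum_sum_type]
  have hsum' : ∀ F : Fin m → V, ∑ j, F j = F i + ∑ j : {j : Fin m // j ≠ i}, F j := fun F =>
    Fintype.sum_eq_add_sum_subtype_ne F i
  have hlin : ∀ w w' : V, ∀ c : k, U (circArg ε (e + 1) h i (w - c • w') x) =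
      U (circArg ε (e + 1) h i w x) - c • U (circArg ε (e + 1) h i w' x) := fun w w' c => by
    rw [circArg_eq_update, MultilinearMap.map_update_sub, MultilinearMap.map_update_smul,
      ← circArg_eq_update, ← circArg_eq_update]
  have hlin' : ∀ w : Fin n → V, U (circArg ε (e + 1) h i (∑ y, w y) x) =
      ∑ y, U (circArg ε (e + 1) h i (w y) x) := fun w => by
    rw [circArg_eq_update, MultilinearMap.map_update_sum]
    exact Finset.sum_congr rfl fun y _ => by rw [← circArg_eq_update]
  rw [opDiff_apply, gradedCirc_apply, add_apply, gradedCirc_apply,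
    smul_apply, gradedCirc_apply, opDiff_apply, opDiff_apply, ← hxi, ← hv, hsum,
    hsum', hlin, hlin', t3]
  simp only [fun j : {j : Fin m // j ≠ i} => t1 j.1 j.2, t2, ← Finset.smul_sum]
  have hs := neg_one_pow_mul_self (k := k) e
  simp only [smul_add, smul_sub, smul_smul, pow_add]
  rw [show (-1 : k) ^ d * (-1) ^ e * (-1) ^ e = (-1) ^ d by rw [mul_assoc, hs, mul_one]]
  abel

/-- The differential of operations is equivariant. -/
theorem opDiff_gradedAct [CharZero k] (hε : ∀ x, ε (ε x) = x) (hD : ∀ x, D (ε x) = -ε (D x))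
    (e : ℕ) {n : ℕ} (σ : Equiv.Perm (Fin n)) (U : Ops (k := k) V n) :
    opDiff ε D e (gradedAct ε σ U) = gradedAct ε σ (opDiff ε D e U) := by
  refine ops_ext_parity ε hε fun b x hx => ?_
  have hDx : ∀ z, ε (D (x z)) = (-1 : k) ^ (b z + 1).val • D (x z) := fun z => by
    rw [← neg_neg (ε (D (x z))), ← hD, hx, map_smul]
    generalize b z = c
    fin_cases c <;> simp
  have hterm : ∀ z, gradedAct ε σ U (diffArg ε D z x) =
      koszulSign k σ b • U (diffArg ε D (σ z) (fun i => x (σ⁻¹ i))) := fun z => by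
    set y : Fin n → V := Function.update x z (D (x z)) with hy
    have hyz : y z = D (x z) := Function.update_self _ _ _
    have hyl : ∀ l, l ≠ z → y l = x l := fun l hl => Function.update_of_ne hl _ _
    rw [gradedAct_apply ε σ U (Function.update b z (b z + 1))]
    · have a1 : (fun i => diffArg ε D z x (σ⁻¹ i)) =
          fun i => (if σ⁻¹ i < z then (-1 : k) ^ (b (σ⁻¹ i)).val else 1) • y (σ⁻¹ i) := by
        funext i
        simp only [diffArg]
        split_ifs with h1 h2
        · rw [hx, hyl _ h1.ne]
        · rw [h2, hyz, one_smul]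
        · rw [hyl _ h2, one_smul]
      have a2 : diffArg ε D (σ z) (fun i => x (σ⁻¹ i)) =
          fun i => (if i < σ z then (-1 : k) ^ (b (σ⁻¹ i)).val else 1) • y (σ⁻¹ i) := by
        funext i
        obtain ⟨l, rfl⟩ := σ.surjective i
        simp only [diffArg, perm_inv_apply_self, EmbeddingLike.apply_eq_iff_eq]
        split_ifs with h1 h2
        · rw [hx, hyl _ (fun e => h1.ne (by rw [e]))]
        · rw [h2, hyz, one_smul]
        · rw [hyl _ h2, one_smul]
      rw [a1, a2, MultilinearMap.map_smul_univ, MultilinearMap.map_smul_univ, smul_smul, smul_smul]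
      congr 1
      rw [← Equiv.prod_comp σ, ← Equiv.prod_comp σ fun i => if i < σ z then _ else _]
      simp only [perm_inv_apply_self]
      exact koszulSign_update σ b z
    · intro l
      by_cases hl : l = z
      · subst hl
        simp only [diffArg, lt_irrefl, if_false, if_true, Function.update_self]
        exact hDx l
      · simp only [diffArg, hl, if_false, Function.update_of_ne hl]
        split_ifs
        · rw [hx, map_smul, hx]
        · rw [hx]
  rw [opDiff_apply, gradedAct_apply ε _ _ b x hx, gradedAct_apply ε _ _ b x hx, opDiff_apply]
  simp only [hterm]
  rw [← Finset.smul_sum, Equiv.sum_comp σ fun i => U (diffArg ε D i fun i => x (σ⁻¹ i)), map_smul,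
    smul_sub, smul_smul, smul_smul, mul_comm]

end Diff

end GradedOps

/-! ### Averaging -/

theorem aver_act (O : OperadData k) {n : ℕ} (σ : Equiv.Perm (Fin n)) (x : O.obj n) :
    O.aver n (O.act σ x) = O.aver n x := by
  refine Subtype.ext ?_
  change ((Nat.factorial n : k)⁻¹ • ∑ τ : Equiv.Perm (Fin n), O.act τ) (O.act σ x) =
    ((Nat.factorial n : k)⁻¹ • ∑ τ : Equiv.Perm (Fin n), O.act τ) x
  simp only [LinearMap.smul_apply, LinearMap.sum_apply, ← O.act_mul]
  congr 1
  exact Fintype.sum_equiv (Equiv.mulLeft σ) _ _ (fun _ => rfl)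

theorem coe_aver (O : OperadData k) {n : ℕ} (x : O.obj n) :
    (O.aver n x : O.obj n) = (Nat.factorial n : k)⁻¹ • ∑ τ : Equiv.Perm (Fin n), O.act τ x := by
  change ((Nat.factorial n : k)⁻¹ • ∑ τ : Equiv.Perm (Fin n), O.act τ) x = _
  simp only [LinearMap.smul_apply, LinearMap.sum_apply]

theorem aver_coe [CharZero k] (O : OperadData k) {n : ℕ} (x : O.invariants n) :
    O.aver n (x : O.obj n) = x := by
  refine Subtype.ext ?_
  rw [coe_aver, Finset.sum_congr rfl fun τ _ => x.2 τ, Finset.sum_const, Finset.card_univ,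
    Fintype.card_perm, Fintype.card_fin, ← Nat.cast_smul_eq_nsmul k, smul_smul,
    inv_mul_cancel₀ (Nat.cast_ne_zero.mpr (Nat.factorial_ne_zero n)), one_smul]

variable {P : Operad k} (A : PAlg P)

theorem averC_act {m : ℕ} (σ : Equiv.Perm (Fin (m + 1))) (x : (sEP A).obj (m + 1)) :
    averC A m ((sEP A).act σ x) = averC A m x := aver_act _ σ x

theorem incl_averC {m : ℕ} (x : (sEP A).obj (m + 1)) : incl A m (averC A m x) =
    (Nat.factorial (m + 1) : k)⁻¹ • ∑ τ : Equiv.Perm (Fin (m + 1)), (sEP A).act τ x :=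
  coe_aver _ x

theorem averC_incl [CharZero k] {m : ℕ} (f : Cochain A m) : averC A m (incl A m f) = f :=
  aver_coe _ _

theorem eps_eps (x : CTot A) : eps A (eps A x) = x := by
  suffices h : eps A ∘ₗ eps A = LinearMap.id from LinearMap.congr_fun h x
  refine DirectSum.linearMap_ext k fun m => LinearMap.ext fun f => ?_
  change eps A (eps A (ofDeg A m f)) = ofDeg A m f
  rw [eps_ofDeg, map_smul, eps_ofDeg, smul_smul, neg_one_pow_mul_self, one_smul]

theorem eps_pow_ofDeg (e m : ℕ) (f : Cochain A m) :
    (eps A ^ e) (ofDeg A m f) = (-1 : k) ^ (e * m) • ofDeg A m f := by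
  induction e with
  | zero => simp
  | succ e ih =>
    rw [pow_succ', Module.End.mul_apply, ih, map_smul, eps_ofDeg, smul_smul, ← pow_add, add_mul,
      one_mul]

/-- A multilinear operation on `C^*_P(A;A)` is determined by its values on homogeneous elements. -/
theorem ops_ext_ofDeg {n : ℕ} {U W : Ops (k := k) (CTot A) n}
    (h : ∀ (p : Fin n → ℕ) (f : ∀ i, Cochain A (p i)),
      U (fun i => ofDeg A (p i) (f i)) = W (fun i => ofDeg A (p i) (f i))) : U = W :=
  MultilinearMap.directSum_ext (R := k) (κ := fun _ : Fin n => ℕ)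
    (M := fun (_ : Fin n) (m : ℕ) => Cochain A m) (f := U) (g := W) fun p =>
      MultilinearMap.ext fun f => h p f

theorem assemble_ofDeg {n d : ℕ} (u : (p : Fin n → ℕ) → HomFamily P p (∑ i, p i + d))
    (p : Fin n → ℕ) (f : ∀ i, Cochain A (p i)) :
    assemble P n d u A (fun i => ofDeg A (p i) (f i)) = ofDeg A (∑ i, p i + d) (u p A f) :=
  MultilinearMap.fromDirectSumEquiv_lof (R := k) (κ := fun _ : Fin n => ℕ)
    (M := fun (_ : Fin n) (m : ℕ) => Cochain A m) _ p f

/-! ### Cup products as successive compositions -/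

section CupComp

variable {P : Operad k} (A : PAlg P)

/-- The homogeneous cochain that is obtained by averaging an element of `𝔰(End_A ⊗ P^!)`. -/
def averElt : Elt (sEP A) → CTot A
  | ⟨0, _⟩ => 0
  | ⟨m + 1, x⟩ => ofDeg A m (averC A m x)

theorem averElt_mk {m : ℕ} (x : (sEP A).obj (m + 1)) :
    averElt A (Elt.mk x) = ofDeg A m (averC A m x) := rfl

theorem averElt_linear (N : ℕ) :
    ∃ L : (sEP A).obj N →ₗ[k] CTot A, ∀ x, averElt A (Elt.mk x) = L x := by
  cases N with
  | zero => exact ⟨0, fun _ => rfl⟩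
  | succ m => exact ⟨ofDeg A m ∘ₗ averC A m, fun _ => rfl⟩

theorem averElt_smul (c : k) (x : Elt (sEP A)) : averElt A (c • x) = c • averElt A x := by
  obtain ⟨n, p, rfl⟩ := x.mk_surj
  obtain ⟨L, hL⟩ := averElt_linear A n
  rw [Elt.smul_mk, hL, hL, map_smul]

theorem averElt_orbFix {s : ℕ} {x y : Elt (sEP A)} (h : Elt.OrbFix s x y) :
    averElt A x = averElt A y := by
  obtain ⟨n, p, σ, -, rfl, rfl⟩ := h
  cases n with
  | zero => rfl
  | succ m => rw [averElt_mk, averElt_mk, averC_act]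

theorem averElt_plugAll_linear (F : List (Elt (sEP A))) (s N : ℕ) :
    ∃ L : (sEP A).obj N →ₗ[k] CTot A, ∀ x, averElt A (Elt.plugAll s (Elt.mk x) F) = L x := by
  induction F generalizing s N with
  | nil => exact averElt_linear A N
  | cons f F ih =>
    obtain ⟨n, q, rfl⟩ := f.mk_surj
    by_cases hs : s < N
    · obtain ⟨L, hL⟩ := ih (s + n) (N + n - 1)
      refine ⟨L ∘ₗ ((sEP A).circ (by omega) ⟨s, hs⟩).flip q, fun x => ?_⟩
      rw [Elt.plugAll, Elt.circAt_mk' (r := N + n - 1) (by omega) hs]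
      exact hL _
    · obtain ⟨L, hL⟩ := ih (s + n) N
      refine ⟨L, fun x => ?_⟩
      rw [Elt.plugAll, Elt.circAt_of_le (by simpa using hs)]
      exact hL _

theorem averElt_plugAll_insert_linear (x : Elt (sEP A)) (F₁ F₂ : List (Elt (sEP A)))
    (hx : F₁.length < x.arity) (n : ℕ) : ∃ L : (sEP A).obj n →ₗ[k] CTot A,
      ∀ y, averElt A (Elt.plugAll 0 x (F₁ ++ Elt.mk y :: F₂)) = L y := by
  have hF := Elt.arity_plugAll F₁ 0 x (by omega)
  obtain ⟨N, p, hp⟩ := (Elt.plugAll 0 x F₁).mk_surj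
  rw [hp, Elt.arity_mk] at hF
  have hs : 0 + Elt.total F₁ < N := by omega
  obtain ⟨L, hL⟩ := averElt_plugAll_linear A F₂ (0 + Elt.total F₁ + n) (N + n - 1)
  refine ⟨L ∘ₗ (sEP A).circ (by omega) ⟨_, hs⟩ p, fun y => ?_⟩
  rw [Elt.plugAll_append, hp, Elt.plugAll, Elt.circAt_mk' (r := N + n - 1) (by omega) hs]
  exact hL _

/-- An element may be averaged before it is plugged into another one, provided that the result is
averaged. -/
theorem averElt_plugAll_averC [CharZero k] (x : Elt (sEP A)) (F₁ F₂ : List (Elt (sEP A)))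
    (hx : F₁.length < x.arity) {m : ℕ} (y : (sEP A).obj (m + 1)) :
    averElt A (Elt.plugAll 0 x (F₁ ++ Elt.mk (incl A m (averC A m y)) :: F₂)) =
      averElt A (Elt.plugAll 0 x (F₁ ++ Elt.mk y :: F₂)) := by
  obtain ⟨L, hL⟩ := averElt_plugAll_insert_linear A x F₁ F₂ hx (m + 1)
  have hact : ∀ τ, L ((sEP A).act τ y) = L y := fun τ => by
    rw [← hL, ← hL]
    obtain ⟨s, hs⟩ := Elt.orbFix_plugAll_act (sEP_laws A) x F₁ F₂ hx τ y
    exact averElt_orbFix A hs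
  rw [hL, hL, incl_averC, map_smul, map_sum, Finset.sum_congr rfl fun τ _ => hact τ,
    Finset.sum_const, Finset.card_univ, Fintype.card_perm, Fintype.card_fin,
    ← Nat.cast_smul_eq_nsmul k, smul_smul,
    inv_mul_cancel₀ (Nat.cast_ne_zero.mpr (Nat.factorial_ne_zero _)), one_smul]

/-- `x` is a homogeneous cochain, and `v` is `x` as an element of the total space of cochains. -/
def IsCochainElt (x : Elt (sEP A)) (v : CTot A) : Prop :=
  ∃ (m : ℕ) (f : Cochain A m), x = Elt.mk (incl A m f) ∧ v = ofDeg A m f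

variable {A}

theorem cup_ofDeg {N : ℕ} (t : (sPP P).obj (N + 1)) (p : Fin (N + 1) → ℕ)
    (f : ∀ i, Cochain A (p i)) :
    cup P N t A (fun i => ofDeg A (p i) (f i)) =
      averElt A (Elt.plugAll 0 (Elt.mk (sAlpha A (N + 1) t))
        (List.ofFn fun i => Elt.mk (incl A (p i) (f i)))) := by
  rw [cup, LinearMap.comp_apply, assemble_ofDeg, ← Elt.mk_gamma (sEP A) (fun i => p i + 1)
    (r := ∑ i, p i + N + 1) (by simp only [Finset.sum_add_distrib, Finset.sum_const,
      Finset.card_univ, Fintype.card_fin, smul_eq_mul, mul_one]; omega)]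
  rfl

theorem cup_apply {N : ℕ} (t : (sPP P).obj (N + 1)) (x : Fin (N + 1) → Elt (sEP A))
    (v : Fin (N + 1) → CTot A) (h : ∀ i, IsCochainElt A (x i) (v i)) :
    cup P N t A v =
      averElt A (Elt.plugAll 0 (Elt.mk (sAlpha A (N + 1) t)) (List.ofFn x)) := by
  choose p f hx hv using h
  obtain rfl : x = fun i => Elt.mk (incl A (p i) (f i)) := funext hx
  obtain rfl : v = fun i => ofDeg A (p i) (f i) := funext hv
  exact cup_ofDeg t p f

/-- The list of the arguments of the outer operation in a partial composition. -/
theorem ofFn_outer {α : Type*} {m n r : ℕ} (h : r + 1 = m + n) (i : Fin m) (F : Fin r → α) (q : α) :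
    List.ofFn (fun j => if hj : j = i then q else F ((slot h i).symm (Sum.inl ⟨j, hj⟩))) =
      (List.ofFn F).take i.val ++ q :: (List.ofFn F).drop (i.val + n) := by
  have hi := i.isLt
  refine List.ext_getElem (by simp; omega) fun j h1 h2 => ?_
  simp only [List.length_ofFn] at h1
  rw [List.getElem_append]
  simp only [List.getElem_ofFn, List.length_take, List.length_ofFn, List.getElem_take,
    List.getElem_cons, List.getElem_drop, Fin.ext_iff]
  split_ifs with c1 c2 c3 c4 c5
  · omega
  · rfl
  · omega
  · congr 1
    rw [Fin.ext_iff, slot_symm_inl_val]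
    simp only
    split_ifs <;> omega
  · omega
  · congr 1
    rw [Fin.ext_iff, slot_symm_inl_val]
    simp only
    split_ifs <;> omega

/-- The list of the arguments of a partial composition, with those of the inner operation set
apart. -/
theorem ofFn_inner {α : Type*} {m n r : ℕ} (h : r + 1 = m + n) (i : Fin m) (F : Fin r → α) :
    List.ofFn F = (List.ofFn F).take i.val ++
      (List.ofFn (fun y : Fin n => F ((slot h i).symm (Sum.inr y))) ++
        (List.ofFn F).drop (i.val + n)) := by
  have hi := i.isLt
  refine List.ext_getElem (by simp; omega) fun j h1 h2 => ?_
  simp only [List.length_ofFn] at h1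
  simp only [List.getElem_append, List.getElem_ofFn, List.length_take, List.length_ofFn,
    List.getElem_take, List.getElem_drop]
  split_ifs with c1 c2
  · rfl
  · congr 1
    rw [Fin.ext_iff, slot_symm_inr_val]
    simp only
    omega
  · congr 1
    rw [Fin.ext_iff]
    simp only
    omega

theorem sAlpha_circ {m n r : ℕ} (h : r + 1 = m + n) (i : Fin m) (t : (sPP P).obj m)
    (s : (sPP P).obj n) :
    sAlpha A r ((sPP P).circ h i t s) = (sEP A).circ h i (sAlpha A m t) (sAlpha A n s) := by
  simp only [LinearMap.smul_apply, map_smul]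
  congr 1
  induction t using TensorProduct.induction_on with
  | zero => simp
  | add x y hx hy => simp only [map_add, LinearMap.add_apply, hx, hy]
  | tmul p p' =>
  induction s using TensorProduct.induction_on with
  | zero => simp
  | add x y hx hy => simp only [map_add, hx, hy]
  | tmul q q' =>
    exact congrArg (fun z => z ⊗ₜ[k] (qdual P).circ h i p' q') (A.str.map_circ h i p q)

theorem sAlpha_act {n : ℕ} (σ : Equiv.Perm (Fin n)) (t : (sPP P).obj n) :
    sAlpha A n ((sPP P).act σ t) = (sEP A).act σ (sAlpha A n t) := by
  simp only [LinearMap.smul_apply, map_smul]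
  congr 1
  induction t using TensorProduct.induction_on with
  | zero => simp
  | add x y hx hy => simp only [map_add, hx, hy]
  | tmul p p' =>
    exact congrArg (fun z => z ⊗ₜ[k] (qdual P).act σ p') (A.str.map_act σ p)

theorem sAlpha_one : sAlpha A 1 (sPP P).one = (sEP A).one :=
  congrArg (fun z => z ⊗ₜ[k] (qdual P).one) A.str.map_one

/-- The exponent of the Koszul sign of an operation that moves past the first elements of a list. -/
theorem sum_lt_eq_total {O : OperadData k} {m : ℕ} (x : Fin m → Elt O) (i : Fin m) :
    (∑ j, if j < i then (x j).arity + 1 else 0) =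
      Elt.total ((List.ofFn x).take i.val) + ((List.ofFn x).take i.val).length := by
  have h1 := List.sum_take_ofFn (fun j => (x j).arity) i.val
  have h2 := List.sum_take_ofFn (fun _ : Fin m => 1) i.val
  have e1 : Elt.total ((List.ofFn x).take i.val) =
      ((List.ofFn fun j => (x j).arity).take i.val).sum := by
    rw [Elt.total, List.map_take, List.map_ofFn]; rfl
  have e2 : ((List.ofFn x).take i.val).length =
      ((List.ofFn fun _ : Fin m => 1).take i.val).sum := by
    simp [List.ofFn_const, List.take_replicate]
  rw [e1, e2, h1, h2, ← Finset.sum_add_distrib, Finset.sum_filter]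
  rfl

/-- Cup products are compatible with the units. -/
theorem cup_one [CharZero k] : cup P 0 (sPP P).one = natOne P := by
  funext A
  refine ops_ext_ofDeg A fun p f => ?_
  rw [cup_ofDeg, sAlpha_one, natOne, endOp_one_apply]
  rw [List.ofFn_succ, List.ofFn_zero, Elt.plugAll, Elt.plugAll,
    Elt.circAt_mk' (r := p 0 + 1) (by omega) one_pos]
  have := (sEP_laws A).one_circ (by omega) (incl A (p 0) (f 0))
  rw [averElt_mk]
  erw [this]
  rw [averC_incl]

theorem natAct_mul [CharZero k] {n : ℕ} (σ τ : Equiv.Perm (Fin n)) (U : OpFamily P n) :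
    natAct (σ * τ) U = natAct τ (natAct σ U) :=
  funext fun A => gradedAct_mul (eps A) (eps_eps A) σ τ (U A)

theorem natAct_one [CharZero k] {n : ℕ} (U : OpFamily P n) : natAct 1 U = U :=
  funext fun A => gradedAct_one (eps A) (eps_eps A) (U A)

theorem eps_ofDeg_parity (m : ℕ) (f : Cochain A m) :
    eps A (ofDeg A m f) = (-1 : k) ^ (Fin.ofNat 2 m).val • ofDeg A m f := by
  rw [eps_ofDeg, Fin.val_ofNat, neg_one_pow_eq_pow_mod_two]

/-- Cup products are equivariant: on adjacent transpositions this is the symmetry of parallel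
compositions in a suspended operad. -/
theorem cup_act [CharZero k] {N : ℕ} (σ : Equiv.Perm (Fin (N + 1))) (t : (sPP P).obj (N + 1)) :
    cup P N ((sPP P).act σ t) = natAct σ (cup P N t) := by
  have hmem : σ ∈ Submonoid.closure (Set.range fun i : Fin N => Equiv.swap i.castSucc i.succ) := by
    rw [Equiv.Perm.mclosure_swap_castSucc_succ]; trivial
  induction hmem using Submonoid.closure_induction generalizing t with
  | one => rw [(sPP P).act_one, natAct_one]
  | mul a b _ _ ha hb => rw [(sPP P).act_mul, natAct_mul, hb, ha]
  | mem s hs =>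
    obtain ⟨l, rfl⟩ := hs
    funext A
    refine ops_ext_ofDeg A fun p f => ?_
    have hadj : l.castSucc.val + 1 = l.succ.val := by simp
    set i := l.castSucc
    set j := l.succ
    have hj := j.isLt
    set x : Fin (N + 1) → Elt (sEP A) := fun i => Elt.mk (incl A (p i) (f i)) with hx
    set v : Fin (N + 1) → CTot A := fun i => ofDeg A (p i) (f i) with hv
    have hxv : ∀ i, IsCochainElt A (x i) (v i) := fun i => ⟨p i, f i, rfl, rfl⟩
    have e : ∀ y : Fin (N + 1) → Elt (sEP A), List.ofFn y =
        (List.ofFn y).take i.val ++ y i :: y j :: (List.ofFn y).drop (i.val + 2) := fun y => by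
      have h1 : i.val < (List.ofFn y).length := by rw [List.length_ofFn]; omega
      have h2 : i.val + 1 < (List.ofFn y).length := by rw [List.length_ofFn]; omega
      conv_lhs => rw [← List.take_append_drop i.val (List.ofFn y), List.drop_eq_getElem_cons h1,
        List.drop_eq_getElem_cons h2]
      have hij : ∀ h, (⟨i.val + 1, h⟩ : Fin (N + 1)) = j := fun h => Fin.ext hadj
      simp only [List.getElem_ofFn, Fin.eta, hij]
    have hinv : ∀ a, (Equiv.swap i j)⁻¹ a = Equiv.swap i j a := fun a => by
      rw [Equiv.swap_inv]
    rw [natAct, gradedAct_apply (eps A) _ _ (fun i => Fin.ofNat 2 (p i)) v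
      (fun i => eps_ofDeg_parity _ _), cup_apply _ x v hxv,
      cup_apply t (fun a => x ((Equiv.swap i j)⁻¹ a)) _ (fun a => hxv _), e x,
      e fun a => x ((Equiv.swap i j)⁻¹ a), sAlpha_act]
    obtain ⟨s, hs⟩ := Elt.orbFix_plugAll_swap (sEP_laws A) i j hadj (sAlpha A (N + 1) t)
      ((List.ofFn x).take i.val) ((List.ofFn x).drop (i.val + 2)) (by simp) (x i) (x j)
    rw [averElt_orbFix A hs, averElt_smul, koszulSign_swap i j hadj]
    simp only [hinv, Equiv.swap_apply_left, Equiv.swap_apply_right]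
    have c1 : (List.ofFn fun a => x (Equiv.swap i j a)).take i.val = (List.ofFn x).take i.val := by
      refine List.ext_getElem (by simp) fun a h1 h2 => ?_
      simp only [List.length_take, List.length_ofFn] at h1
      simp only [List.getElem_take, List.getElem_ofFn]
      rw [Equiv.swap_apply_of_ne_of_ne] <;> simp only [ne_eq, Fin.ext_iff] <;> omega
    have c2 : (List.ofFn fun a => x (Equiv.swap i j a)).drop (i.val + 2) =
        (List.ofFn x).drop (i.val + 2) := by
      refine List.ext_getElem (by simp) fun a h1 h2 => ?_
      simp only [List.length_drop, List.length_ofFn] at h1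
      simp only [List.getElem_drop, List.getElem_ofFn]
      rw [Equiv.swap_apply_of_ne_of_ne] <;> simp only [ne_eq, Fin.ext_iff] <;> omega
    rw [c1, c2]
    congr 1
    apply neg_one_pow_eq_of_even_sub
    simp only [hx, Elt.arity_mk, Fin.val_ofNat]
    rw [Nat.even_iff, Nat.add_mod, Nat.mul_mod (p i + 1 + 1),
      show (p i + 1 + 1) % 2 = p i % 2 by omega, show (p j + 1 + 1) % 2 = p j % 2 by omega]
    omega

/-- Cup products are compatible with partial compositions, by the associativity of the composition
of `𝔰(End_A ⊗ P^!)`. -/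
theorem cup_circ [CharZero k] {m n r : ℕ} (h : r + 1 + 1 = (m + 1) + (n + 1)) (i : Fin (m + 1))
    (t : (sPP P).obj (m + 1)) (s : (sPP P).obj (n + 1)) :
    cup P r ((sPP P).circ h i t s) = natCirc n h i (cup P m t) (cup P n s) := by
  funext A
  refine ops_ext_ofDeg A fun p f => ?_
  have hi := i.isLt
  set x : Fin (r + 1) → Elt (sEP A) := fun i => Elt.mk (incl A (p i) (f i)) with hx
  set v : Fin (r + 1) → CTot A := fun i => ofDeg A (p i) (f i) with hv
  have hxv : ∀ i, IsCochainElt A (x i) (v i) := fun i => ⟨p i, f i, rfl, rfl⟩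
  set G := List.ofFn (fun y : Fin (n + 1) => x ((slot h i).symm (Sum.inr y))) with hG
  set F₁ := (List.ofFn x).take i.val with hF₁
  set F₂ := (List.ofFn x).drop (i.val + (n + 1)) with hF₂
  have hl₁ : F₁.length = i.val := by simp [hF₁]; omega
  have hl₂ : F₁.length + 1 + F₂.length = m + 1 := by simp [hF₁, hF₂]; omega
  -- the composition of `s` with its arguments
  set w := cup P n s A (fun y => v ((slot h i).symm (Sum.inr y))) with hw
  have hw1 : w = averElt A (Elt.plugAll 0 (Elt.mk (sAlpha A (n + 1) s)) G) :=
    cup_apply s _ _ fun y => hxv _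
  obtain ⟨M, q, hq⟩ : ∃ (M : ℕ) (q : (sEP A).obj (M + 1)),
      Elt.plugAll 0 (Elt.mk (sAlpha A (n + 1) s)) G = Elt.mk q := by
    have h1 := Elt.arity_plugAll G 0 (Elt.mk (sAlpha A (n + 1) s)) (by simp [hG])
    have h2 : G.length ≤ Elt.total G := by
      rw [Elt.total, hG, List.map_ofFn, List.sum_ofFn, List.length_ofFn]
      calc n + 1 = ∑ _ : Fin (n + 1), 1 := by simp
        _ ≤ _ := Finset.sum_le_sum fun y _ => by simp [hx]
    obtain ⟨N, q, hq⟩ := (Elt.plugAll 0 (Elt.mk (sAlpha A (n + 1) s)) G).mk_surj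
    rw [hq] at h1
    simp only [Elt.arity_mk] at h1
    obtain _ | N := N
    · omega
    · exact ⟨N, q, hq⟩
  rw [hq, averElt_mk] at hw1
  -- the arguments of `t`, without the Koszul signs
  set y : Fin (m + 1) → Elt (sEP A) := fun j => if hj : j = i then
    Elt.mk (incl A M (averC A M q)) else x ((slot h i).symm (Sum.inl ⟨j, hj⟩)) with hy
  set u : Fin (m + 1) → CTot A := fun j => if hj : j = i then w else
    v ((slot h i).symm (Sum.inl ⟨j, hj⟩)) with hu
  have hyu : ∀ j, IsCochainElt A (y j) (u j) := fun j => by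
    by_cases hj : j = i
    · subst hj
      simp only [hy, hu, dif_pos]
      exact ⟨M, averC A M q, rfl, hw1⟩
    · simp only [hy, hu, dif_neg hj]
      exact hxv _
  have hyF : List.ofFn y = F₁ ++ Elt.mk (incl A M (averC A M q)) :: F₂ := ofFn_outer h i x _
  have harg : circArg (eps A) n h i w v =
      fun j => ((-1 : k) ^ (n * if j < i then (y j).arity + 1 else 0)) • u j := by
    funext j
    by_cases hj : j = i
    · subst hj; simp [circArg, hu]
    · simp only [circArg, hy, hu, dif_neg hj]
      split_ifs
      · rw [hv, hx]
        simp only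
        rw [eps_pow_ofDeg]
        congr 1
        apply neg_one_pow_eq_of_even_sub
        rw [Elt.arity_mk]
        exact ⟨n * (p ((slot h i).symm (Sum.inl ⟨j, hj⟩)) + 1), by ring⟩
      · simp
  have hsign : (∑ j, if j < i then (y j).arity + 1 else 0) = Elt.total F₁ + F₁.length := by
    rw [sum_lt_eq_total, hyF, List.take_append_of_le_length (by omega),
      List.take_of_length_le (by omega)]
  rw [natCirc, gradedCirc_apply, ← hw, harg, MultilinearMap.map_smul_univ, cup_apply t y u hyu, hyF,
    averElt_plugAll_averC A _ _ _ (by simp; omega), ← hq, Finset.prod_pow_eq_pow_sum,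
    ← Finset.mul_sum, hsign, cup_apply _ x v hxv, ofFn_inner h i x, ← hG, ← hF₁, ← hF₂, sAlpha_circ,
    ← Elt.circAt_mk h i, ← hl₁, Elt.plugAll_circAt (sEP_laws A) _ _ _ _ _ (by simp; omega)
      (by simp [hG]), averElt_smul]
  congr 1
  apply neg_one_pow_eq_of_even_sub
  rw [Elt.arity_mk]
  exact ⟨(n + 1) * (Elt.total F₁ + F₁.length), by ring⟩

end CupComp

/-! ### Substitution of trees -/

namespace NTree

variable {P : Operad k} {n n' : ℕ} {a : Fin n → ℕ} {b : Fin n' → ℕ} {l l' : ℕ}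

/-- The tree with the single white vertex `wᵢ`. -/
def corolla (i : Fin n) : NTree P a (a i) := white i leg

/-- Graft the trees `L j` onto the legs with the labels `j`. -/
def graft (L : Fin l → NTree P a l') : NTree P a l → NTree P a l'
  | leg j => L j
  | white i c => white i fun s => graft L (c s)
  | black h p c => black h p fun s => graft L (c s)

/-- Replace every white vertex `wᵢ` by the tree `W i`. -/
def subst (W : ∀ i, NTree P b (a i)) : NTree P a l → NTree P b l
  | leg j => leg j
  | white i c => graft (fun s => subst W (c s)) (W i)
  | black h p c => black h p fun s => subst W (c s)

theorem eval_graft (A : PAlg P) (φ : ∀ i, Ops (k := k) A.carrier (a i)) (x : Fin l' → A.carrier)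
    (L : Fin l → NTree P a l') (T : NTree P a l) :
    eval A φ x (graft L T) = eval A φ (fun s => eval A φ x (L s)) T := by
  induction T with
  | leg j => rfl
  | white i c ih => exact congrArg (φ i) (funext ih)
  | black h p c ih => exact congrArg (A.str.map _ p) (funext ih)

theorem eval_subst (A : PAlg P) (ψ : ∀ i, Ops (k := k) A.carrier (a i))
    (φ : ∀ i, Ops (k := k) A.carrier (b i)) (W : ∀ i, NTree P b (a i))
    (h : ∀ i y, ψ i y = eval A φ y (W i)) (x : Fin l → A.carrier) (T : NTree P a l) :
    eval A φ x (subst W T) = eval A ψ x T := by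
  induction T with
  | leg j => rfl
  | white i c ih =>
    rw [subst, eval_graft, ← h]
    exact congrArg (ψ i) (funext ih)
  | black h p c ih => exact congrArg (A.str.map _ p) (funext ih)

theorem legCount_graft (L : Fin l → NTree P a l') (j : Fin l') (T : NTree P a l) :
    legCount j (graft L T) = ∑ s, legCount s T * legCount j (L s) := by
  induction T with
  | leg i => simp [graft, legCount]
  | white i c ih =>
    simp only [graft, legCount, ih, Finset.sum_mul]
    exact Finset.sum_comm
  | black h p c ih =>
    simp only [graft, legCount, ih, Finset.sum_mul]
    exact Finset.sum_comm

theorem whiteCount_graft (L : Fin l → NTree P a l') (z : Fin n) (T : NTree P a l) :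
    whiteCount z (graft L T) = whiteCount z T + ∑ s, legCount s T * whiteCount z (L s) := by
  induction T with
  | leg i => simp [graft, legCount, whiteCount]
  | white i c ih =>
    simp only [graft, legCount, whiteCount, ih, Finset.sum_mul, Finset.sum_add_distrib]
    rw [Finset.sum_comm, add_assoc]
  | black h p c ih =>
    simp only [graft, legCount, whiteCount, ih, Finset.sum_mul, Finset.sum_add_distrib]
    rw [Finset.sum_comm]

theorem legCount_subst (W : ∀ i, NTree P b (a i)) (hW : ∀ i s, legCount s (W i) = 1) (j : Fin l)
    (T : NTree P a l) : legCount j (subst W T) = legCount j T := by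
  induction T with
  | leg i => rfl
  | white i c ih => simp only [subst, legCount_graft, hW, one_mul, ih, legCount]
  | black h p c ih => simp only [subst, legCount, ih]

theorem whiteCount_subst (W : ∀ i, NTree P b (a i)) (hW : ∀ i s, legCount s (W i) = 1) (z : Fin n')
    (T : NTree P a l) :
    whiteCount z (subst W T) = ∑ i, whiteCount i T * whiteCount z (W i) := by
  induction T with
  | leg i => simp [subst, whiteCount]
  | white i c ih =>
    simp only [subst, whiteCount_graft, hW, one_mul, ih, whiteCount, add_mul,
      Finset.sum_add_distrib, Finset.sum_mul, ite_mul, zero_mul, Finset.sum_ite_eq,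
      Finset.mem_univ, if_true]
    rw [Finset.sum_comm]
  | black h p c ih =>
    simp only [subst, whiteCount, ih, Finset.sum_mul]
    rw [Finset.sum_comm]

theorem legCount_corolla (i : Fin n) (s : Fin (a i)) :
    legCount s (corolla (P := P) (a := a) i) = 1 := by
  simp [corolla, legCount]

theorem whiteCount_corolla (i z : Fin n) :
    whiteCount z (corolla (P := P) (a := a) i) = if i = z then 1 else 0 := by
  simp [corolla, whiteCount]

end NTree

/-! ### Partial composition of multilinear maps in graded variables -/

section Plug

variable {m n r : ℕ} (h : r + 1 = m + n) (i : Fin m) {q : Fin m → ℕ} {p : Fin r → ℕ}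
  (hq : ∀ (j : Fin m) (hj : j ≠ i), p ((slot h i).symm (Sum.inl ⟨j, hj⟩)) = q j)

/-- The inputs of the outer map in a partial composition at the place `i`, for maps whose variables
have prescribed degrees: `y` at the place `i`, and the appropriate entries of `f` elsewhere. -/
def plug {C : ℕ → Type*} (y : C (q i)) (f : ∀ z, C (p z)) (j : Fin m) : C (q j) :=
  if hj : j = i then (hj.symm ▸ y : C (q j)) else (hq j hj ▸ f _ : C (q j))

theorem plug_self {C : ℕ → Type*} (y : C (q i)) (f : ∀ z, C (p z)) : plug h i hq y f i = y := by
  simp [plug]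

theorem plug_ne {C : ℕ → Type*} (y : C (q i)) (f : ∀ z, C (p z)) {j : Fin m} (hj : j ≠ i) :
    plug h i hq y f j = (hq j hj ▸ f _ : C (q j)) := by
  simp [plug, hj]

theorem rec_map {C D : ℕ → Type*} (τ : ∀ l, C l → D l) {a b : ℕ} (e : a = b) (x : C a) :
    τ b (e ▸ x) = e ▸ τ a x := by
  subst e; rfl

theorem rec_map₂ {B C D : ℕ → Type*} (τ : ∀ l, B l → C l → D l) {a b : ℕ} (e : a = b) (x : B a)
    (y : C a) : τ b (e ▸ x) (e ▸ y) = e ▸ τ a x y := by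
  subst e; rfl

theorem rec_const {D : Type*} {a b : ℕ} (e : a = b) (x : D) :
    (Eq.rec (motive := fun _ _ => D) x e : D) = x := by
  subst e; rfl

theorem plug_map {C D : ℕ → Type*} (τ : ∀ l, C l → D l) (y : C (q i)) (f : ∀ z, C (p z))
    (j : Fin m) : τ _ (plug h i hq y f j) = plug h i hq (τ _ y) (fun z => τ _ (f z)) j := by
  by_cases hj : j = i
  · subst hj; rw [plug_self, plug_self]
  · rw [plug_ne h i hq _ _ hj, plug_ne h i hq _ _ hj, rec_map τ]

theorem plug_map₂ {B C D : ℕ → Type*} (τ : ∀ l, B l → C l → D l) (x : B (q i)) (g : ∀ z, B (p z))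
    (y : C (q i)) (f : ∀ z, C (p z)) (j : Fin m) :
    τ _ (plug h i hq x g j) (plug h i hq y f j) =
      plug h i hq (τ _ x y) (fun z => τ _ (g z) (f z)) j := by
  by_cases hj : j = i
  · subst hj; simp only [plug_self]
  · simp only [plug_ne h i hq _ _ hj, rec_map₂ τ]

theorem plug_const {D : Type*} (y : D) (f : Fin r → D) (j : Fin m) :
    plug (C := fun _ => D) h i hq y f j =
      if hj : j = i then y else f ((slot h i).symm (Sum.inl ⟨j, hj⟩)) := by
  by_cases hj : j = i
  · subst hj; rw [plug_self]; simp
  · rw [plug_ne h i hq _ _ hj, dif_neg hj, rec_const]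

theorem plug_prop {C : ℕ → Type*} (Q : ∀ l, C l → Prop) (y : C (q i)) (f : ∀ z, C (p z))
    (hy : Q _ y) (hf : ∀ z, Q _ (f z)) (j : Fin m) : Q _ (plug h i hq y f j) := by
  by_cases hj : j = i
  · subst hj; rwa [plug_self]
  · rw [plug_ne h i hq _ _ hj]
    generalize hq j hj = e
    revert e
    generalize q j = b
    rintro rfl
    exact hf _

theorem plug_update_inr {C : ℕ → Type*} (y : C (q i)) (f : ∀ z, C (p z)) (s : Fin n)
    (v : C (p ((slot h i).symm (Sum.inr s)))) :
    plug h i hq y (Function.update f ((slot h i).symm (Sum.inr s)) v) = plug h i hq y f := by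
  funext j
  by_cases hj : j = i
  · subst hj; rw [plug_self, plug_self]
  · rw [plug_ne h i hq _ _ hj, plug_ne h i hq _ _ hj, Function.update_of_ne (by simp)]

theorem plug_update_inl {C : ℕ → Type*} (y : C (q i)) (f : ∀ z, C (p z)) (j : Fin m) (hj : j ≠ i)
    (v : C (p ((slot h i).symm (Sum.inl ⟨j, hj⟩)))) :
    plug h i hq y (Function.update f ((slot h i).symm (Sum.inl ⟨j, hj⟩)) v) =
      Function.update (plug h i hq y f) j (hq j hj ▸ v) := by
  funext l
  by_cases hl : l = i
  · subst hl; rw [plug_self, Function.update_of_ne (Ne.symm hj), plug_self]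
  · by_cases hlj : l = j
    · subst hlj
      rw [plug_ne h i hq _ _ hl, Function.update_self, Function.update_self]
    · rw [Function.update_of_ne hlj, plug_ne h i hq _ _ hl, plug_ne h i hq _ _ hl,
        Function.update_of_ne (by simpa using hlj)]

theorem plug_eq_update {C : ℕ → Type*} (y y' : C (q i)) (f : ∀ z, C (p z)) :
    plug h i hq y f = Function.update (plug h i hq y' f) i y := by
  funext j
  by_cases hj : j = i
  · subst hj; rw [plug_self, Function.update_self]
  · rw [Function.update_of_ne hj, plug_ne h i hq _ _ hj, plug_ne h i hq _ _ hj]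

variable (C : ℕ → Type*) [∀ l, AddCommGroup (C l)] [∀ l, Module k (C l)]
  {M : Type*} [AddCommGroup M] [Module k M]

/-- The partial composition `U ∘ᵢ W` of multilinear maps in graded variables. -/
def plugComp (U : MultilinearMap k (fun j => C (q j)) M)
    (W : MultilinearMap k (fun y => C (p ((slot h i).symm (Sum.inr y)))) (C (q i))) :
    MultilinearMap k (fun z => C (p z)) M :=
  MultilinearMap.mk'
    (fun f => U (plug h i hq (W fun y => f ((slot h i).symm (Sum.inr y))) f))
    (by
      intro f z v w
      revert v w
      refine slot_cases h i (fun j hj => ?_) (fun y => ?_) z <;> intro v w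
      · have e : ∀ v, (fun y => Function.update f ((slot h i).symm (Sum.inl ⟨j, hj⟩)) v
            ((slot h i).symm (Sum.inr y))) = fun y => f ((slot h i).symm (Sum.inr y)) := fun v =>
          funext fun y => Function.update_of_ne (by simp) _ _
        simp only [e, plug_update_inl]
        rw [← MultilinearMap.map_update_add]
        congr 2
        exact rec_map₂ (fun _ x y => x + y) _ _ _ |>.symm
      · have e : ∀ v, (fun y' => Function.update f ((slot h i).symm (Sum.inr y)) v
            ((slot h i).symm (Sum.inr y'))) =
            Function.update (fun y => f ((slot h i).symm (Sum.inr y))) y v := fun v => by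
          funext y'
          by_cases hy : y' = y
          · subst hy; simp
          · rw [Function.update_of_ne (by simpa using hy), Function.update_of_ne hy]
        simp only [e, plug_update_inr, MultilinearMap.map_update_add]
        rw [plug_eq_update h i hq _ 0, MultilinearMap.map_update_add, ← plug_eq_update,
          ← plug_eq_update])
    (by
      intro f z c v
      revert v
      refine slot_cases h i (fun j hj => ?_) (fun y => ?_) z <;> intro v
      · have e : ∀ v, (fun y => Function.update f ((slot h i).symm (Sum.inl ⟨j, hj⟩)) v
            ((slot h i).symm (Sum.inr y))) = fun y => f ((slot h i).symm (Sum.inr y)) := fun v =>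
          funext fun y => Function.update_of_ne (by simp) _ _
        simp only [e, plug_update_inl]
        rw [← MultilinearMap.map_update_smul]
        congr 2
        exact rec_map (fun _ x => c • x) _ _ |>.symm
      · have e : ∀ v, (fun y' => Function.update f ((slot h i).symm (Sum.inr y)) v
            ((slot h i).symm (Sum.inr y'))) =
            Function.update (fun y => f ((slot h i).symm (Sum.inr y))) y v := fun v => by
          funext y'
          by_cases hy : y' = y
          · subst hy; simp
          · rw [Function.update_of_ne (by simpa using hy), Function.update_of_ne hy]
        simp only [e, plug_update_inr, MultilinearMap.map_update_smul]
        rw [plug_eq_update h i hq _ 0, MultilinearMap.map_update_smul, ← plug_eq_update])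

theorem plugComp_apply (U : MultilinearMap k (fun j => C (q j)) M)
    (W : MultilinearMap k (fun y => C (p ((slot h i).symm (Sum.inr y)))) (C (q i)))
    (f : ∀ z, C (p z)) : plugComp h i hq C U W f =
      U (plug h i hq (W fun y => f ((slot h i).symm (Sum.inr y))) f) := rfl

theorem plugComp_add_right (U : MultilinearMap k (fun j => C (q j)) M)
    (W W' : MultilinearMap k (fun y => C (p ((slot h i).symm (Sum.inr y)))) (C (q i))) :
    plugComp h i hq C U (W + W') = plugComp h i hq C U W + plugComp h i hq C U W' := by
  ext f
  rw [add_apply, plugComp_apply, plugComp_apply, plugComp_apply, add_apply,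
    plug_eq_update h i hq _ 0, MultilinearMap.map_update_add, ← plug_eq_update, ← plug_eq_update]

theorem plugComp_smul_right (c : k) (U : MultilinearMap k (fun j => C (q j)) M)
    (W : MultilinearMap k (fun y => C (p ((slot h i).symm (Sum.inr y)))) (C (q i))) :
    plugComp h i hq C U (c • W) = c • plugComp h i hq C U W := by
  ext f
  rw [smul_apply, plugComp_apply, plugComp_apply, smul_apply,
    plug_eq_update h i hq _ 0, MultilinearMap.map_update_smul, ← plug_eq_update]

end Plug

/-! ### Natural operations form an operad -/

section NaturalOperad

variable {P : Operad k}

/-- Membership in `B^d_P(n)` in terms of the components, whose target degree `m` need not be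
syntactically `p₁ + ⋯ + pₙ + d`. -/
theorem mem_natOps_iff {n d : ℕ} {U : OpFamily P n} :
    U ∈ natOps P n d ↔ ∀ (p : Fin n → ℕ) (m : ℕ), m = ∑ i, p i + d → ∃ u ∈ treeSpan P p m,
      ∀ (A : PAlg P) (f : ∀ i, Cochain A (p i)),
        U A (fun i => ofDeg A (p i) (f i)) = ofDeg A m (u A f) := by
  constructor
  · rintro ⟨u, hu, rfl⟩ p m rfl
    exact ⟨u p, hu p trivial, fun A f => assemble_ofDeg A u p f⟩
  · intro h
    choose u hu hU using fun p => h p _ rfl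
    refine ⟨u, fun p _ => hu p, funext fun A => ops_ext_ofDeg A fun p f => ?_⟩
    rw [assemble_ofDeg, hU]

/-- Natural operations of degree `d` are homogeneous of degree `d`. -/
theorem eps_natOps {n d : ℕ} {U : OpFamily P n} (hU : U ∈ natOps P n d) (A : PAlg P)
    (x : Fin n → CTot A) : eps A (U A x) = (-1 : k) ^ d • U A (fun j => eps A (x j)) := by
  suffices h : (eps A).compMultilinearMap (U A) =
      (-1 : k) ^ d • (U A).compLinearMap (fun _ => eps A) from MultilinearMap.congr_fun h x
  refine ops_ext_ofDeg A fun p f => ?_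
  obtain ⟨u, -, hu⟩ := mem_natOps_iff.mp hU p _ rfl
  rw [LinearMap.compMultilinearMap_apply, hu, eps_ofDeg, smul_apply,
    MultilinearMap.compLinearMap_apply]
  simp only [eps_ofDeg]
  rw [MultilinearMap.map_smul_univ, hu, smul_smul, Finset.prod_pow_eq_pow_sum, ← pow_add,
    add_comm d]

/-! #### Partial compositions -/

section Circ

variable {m n r M : ℕ} (h : r + 1 = m + n) (i : Fin m) {q : Fin m → ℕ} {p : Fin r → ℕ}
  (hq : ∀ (j : Fin m) (hj : j ≠ i), p ((slot h i).symm (Sum.inl ⟨j, hj⟩)) = q j)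

/-- The partial composition of families of multilinear operations. -/
def homComp (u : HomFamily P q M)
    (w : HomFamily P (fun y => p ((slot h i).symm (Sum.inr y))) (q i)) : HomFamily P p M :=
  fun A => plugComp h i hq (Cochain A) (u A) (w A)

/-- The tree which is put at the place of the white vertex `wⱼ` in a partial composition: the tree
`S`, with the legs permuted by `τ` and the white vertices renumbered, for `j = i`, and a corolla for
all other vertices. -/
def circTree (τ : Equiv.Perm (Fin (q i + 1)))
    (S : NTree P (fun y => p ((slot h i).symm (Sum.inr y)) + 1) (q i + 1)) (j : Fin m) :
    NTree P (fun z => p z + 1) (q j + 1) :=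
  plug (C := fun l => NTree P (fun z => p z + 1) (l + 1)) h i hq
    (NTree.graft (fun s => NTree.leg (τ⁻¹ s))
      (NTree.subst (b := fun z => p z + 1)
        (fun y => NTree.corolla (P := P) (a := fun z => p z + 1) ((slot h i).symm (Sum.inr y))) S))
    (fun z => NTree.corolla (P := P) (a := fun z => p z + 1) z) j

theorem legCount_circTree (τ : Equiv.Perm (Fin (q i + 1)))
    (S : NTree P (fun y => p ((slot h i).symm (Sum.inr y)) + 1) (q i + 1)) (hS : S.IsProper)
    (j : Fin m) (s : Fin (q j + 1)) : NTree.legCount s (circTree h i hq τ S j) = 1 := by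
  refine plug_prop (C := fun l => NTree P (fun z => p z + 1) (l + 1)) h i hq
    (fun l T => ∀ s, NTree.legCount s T = 1) _ _ (fun s => ?_) (fun z s => ?_) j s
  · rw [NTree.legCount_graft, ← Equiv.sum_comp τ]
    simp only [NTree.legCount_subst _ (fun y => NTree.legCount_corolla _), hS.1, one_mul,
      perm_inv_apply_self, NTree.legCount]
    simp
  · exact NTree.legCount_corolla (P := P) (a := fun z => p z + 1) z s

theorem sum_whiteCount_circTree (τ : Equiv.Perm (Fin (q i + 1)))
    (S : NTree P (fun y => p ((slot h i).symm (Sum.inr y)) + 1) (q i + 1)) (hS : S.IsProper)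
    (z : Fin r) : ∑ j, NTree.whiteCount z (circTree h i hq τ S j) = 1 := by
  have e : ∀ j, NTree.whiteCount z (circTree h i hq τ S j) =
      if hj : j = i then ∑ y, (if (slot h i).symm (Sum.inr y) = z then 1 else 0) else
        (if (slot h i).symm (Sum.inl ⟨j, hj⟩) = z then 1 else 0) := fun j => by
    rw [circTree, plug_map h i hq (C := fun l => NTree P (fun z => p z + 1) (l + 1))
      (D := fun _ => ℕ) (fun l T => NTree.whiteCount z T), plug_const]
    simp only [NTree.whiteCount_corolla]
    congr 1
    funext _
    rw [NTree.whiteCount_graft, NTree.whiteCount_subst _ (fun y => NTree.legCount_corolla _)]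
    simp only [hS.2, one_mul, NTree.whiteCount_corolla, NTree.whiteCount, mul_zero,
      Finset.sum_const_zero, add_zero]
  have hz : ∑ z', (if z' = z then 1 else 0 : ℕ) = 1 := by simp
  refine Eq.trans ?_ hz
  rw [Fintype.sum_eq_add_sum_subtype_ne _ i, e, dif_pos rfl,
    ← Equiv.sum_comp (slot h i).symm (fun z' => if z' = z then 1 else 0), Fintype.sum_sum_type,
    add_comm]
  congr 1
  exact Finset.sum_congr rfl fun j _ => by rw [e, dif_neg j.2]

theorem isProper_subst_circTree (τ : Equiv.Perm (Fin (q i + 1))) (T : NTree P (fun j => q j + 1) M)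
    (S : NTree P (fun y => p ((slot h i).symm (Sum.inr y)) + 1) (q i + 1)) (hT : T.IsProper)
    (hS : S.IsProper) : (NTree.subst (circTree h i hq τ S) T).IsProper := by
  refine ⟨fun j => ?_, fun z => ?_⟩
  · rw [NTree.legCount_subst _ (legCount_circTree h i hq τ S hS), hT.1]
  · rw [NTree.whiteCount_subst _ (legCount_circTree h i hq τ S hS)]
    simp only [hT.2, one_mul]
    exact sum_whiteCount_circTree h i hq τ S hS z

/-- The composition of two operations `U_{(T,Φ)}` and `U_{(S,Ψ)}` is the average, over all
permutations of the legs of `S`, of the operations given by the tree that is obtained by inserting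
`S` into a white vertex of `T`. -/
theorem homComp_mem_of_isTreeOp {u : HomFamily P q M}
    {w : HomFamily P (fun y => p ((slot h i).symm (Sum.inr y))) (q i)}
    {T : NTree P (fun j => q j + 1) (M + 1)} {Φ} (hT : T.IsProper) (hu : IsTreeOp T Φ u)
    {S : NTree P (fun y => p ((slot h i).symm (Sum.inr y)) + 1) (q i + 1)} {Ψ} (hS : S.IsProper)
    (hw : IsTreeOp S Ψ w) : homComp h i hq u w ∈ treeSpan P p M := by
  choose TA U hTA hU hu using hu
  choose TB W hTB hW hw using hw
  let C := fun (A : PAlg P) (l : ℕ) => (sEP A).obj (l + 1)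
  let v : Equiv.Perm (Fin (q i + 1)) → HomFamily P p M := fun τ A =>
    (averC A M).compMultilinearMap
      ((plugComp h i hq (C A) (U A) (((sEP A).act τ).compMultilinearMap (W A))).compLinearMap
        (fun z => incl A (p z)))
  have hv : ∀ τ, v τ ∈ treeSpan P p M := fun τ => by
    refine Submodule.subset_span ⟨NTree.subst (circTree h i hq τ S) T,
      plugComp h i hq (fun l => (qdual P).obj (l + 1)) Φ
        ((((Equiv.Perm.sign τ : ℤ) : k) • (qdual P).act τ).compMultilinearMap Ψ),
      isProper_subst_circTree h i hq τ T S hT hS, fun A => ?_⟩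
    let ψ : (∀ z, Ops (k := k) A.carrier (p z + 1)) → ∀ j, Ops (k := k) A.carrier (q j + 1) :=
      fun φ => plug (C := fun l => Ops (k := k) A.carrier (l + 1)) h i hq
        ((EndOp A.carrier).act τ (TB A fun y => φ ((slot h i).symm (Sum.inr y)))) φ
    refine ⟨fun φ => TA A (ψ φ), plugComp h i hq (C A) (U A)
      (((sEP A).act τ).compMultilinearMap (W A)), fun φ x => ?_, fun φ y => ?_, fun f => rfl⟩
    · rw [hTA]
      refine (NTree.eval_subst A _ _ _ (fun j y => ?_) x T).symm
      have e1 := congrFun (plug_map h i hq (C := fun l => Ops (k := k) A.carrier (l + 1))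
        (D := fun l => (Fin (l + 1) → A.carrier) → A.carrier) (fun l g y => g y)
        ((EndOp A.carrier).act τ (TB A fun y => φ ((slot h i).symm (Sum.inr y)))) φ j) y
      have e2 := congrFun (plug_map h i hq (C := fun l => NTree P (fun z => p z + 1) (l + 1))
        (D := fun l => (Fin (l + 1) → A.carrier) → A.carrier) (fun l T y => NTree.eval A φ y T)
        (NTree.graft (fun s => NTree.leg (τ⁻¹ s)) (NTree.subst (b := fun z => p z + 1)
          (fun y => NTree.corolla (P := P) (a := fun z => p z + 1)
            ((slot h i).symm (Sum.inr y))) S))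
        (fun z => NTree.corolla (P := P) (a := fun z => p z + 1) z) j) y
      have e3 : (fun y =>
            (EndOp A.carrier).act τ (TB A fun y => φ ((slot h i).symm (Sum.inr y))) y) =
          fun y => NTree.eval A φ y (NTree.graft (fun s => NTree.leg (τ⁻¹ s))
            (NTree.subst (b := fun z => p z + 1) (fun y => NTree.corolla (P := P)
              (a := fun z => p z + 1) ((slot h i).symm (Sum.inr y))) S)) := by
        funext y
        rw [endOp_act_apply, hTB, NTree.eval_graft]
        exact (NTree.eval_subst A _ _ _ (fun _ _ => rfl) _ S).symm
      refine e1.trans (Eq.trans ?_ e2.symm)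
      exact congrFun (congrArg (fun g => plug (C := fun l => (Fin (l + 1) → A.carrier) → A.carrier)
        h i hq g (fun z y => φ z y) j) e3) y
    · rw [plugComp_apply, plugComp_apply, ← hU]
      congr 1
      funext j
      rw [plug_map₂ h i hq (B := fun l => Ops (k := k) A.carrier (l + 1))
        (C := fun l => (qdual P).obj (l + 1)) (D := C A) (fun l x y => x ⊗ₜ[k] y)]
      congr 1
      simp only [LinearMap.compMultilinearMap_apply]
      rw [hW]
      simp only [LinearMap.smul_apply, TensorProduct.map_tmul, TensorProduct.tmul_smul]
  have key : homComp h i hq u w = (Nat.factorial (q i + 1) : k)⁻¹ • ∑ τ, v τ := by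
    funext A
    ext f : 1
    have e1 : (fun j => incl A (q j) (plug (C := Cochain A) h i hq
        (w A fun y => f ((slot h i).symm (Sum.inr y))) f j)) =
        plug (C := C A) h i hq (incl A (q i) (averC A (q i) (W A fun y =>
          incl A _ (f ((slot h i).symm (Sum.inr y)))))) (fun z => incl A (p z) (f z)) := by
      funext j
      rw [plug_map h i hq (C := Cochain A) (D := C A) (fun l x => incl A l x), hw]
    rw [homComp, plugComp_apply, hu, e1, plug_eq_update h i hq _ 0, incl_averC,
      MultilinearMap.map_update_smul, MultilinearMap.map_update_sum, map_smul, map_sum,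
      Pi.smul_apply, smul_apply, Finset.sum_apply, sum_apply]
    congr 1
    refine Finset.sum_congr rfl fun τ _ => ?_
    rw [← plug_eq_update]
    rfl
  rw [key]
  exact Submodule.smul_mem _ _ (Submodule.sum_mem _ fun τ _ => hv τ)

theorem homComp_mem {u : HomFamily P q M}
    {w : HomFamily P (fun y => p ((slot h i).symm (Sum.inr y))) (q i)}
    (hu : u ∈ treeSpan P q M) (hw : w ∈ treeSpan P _ (q i)) :
    homComp h i hq u w ∈ treeSpan P p M := by
  induction hu using Submodule.span_induction with
  | zero =>
    have e : homComp h i hq (0 : HomFamily P q M) w = 0 := rfl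
    rw [e]; exact Submodule.zero_mem _
  | add x y _ _ hx hy =>
    have e : homComp h i hq (x + y) w = homComp h i hq x w + homComp h i hq y w := rfl
    rw [e]; exact Submodule.add_mem _ hx hy
  | smul c x _ hx =>
    have e : homComp h i hq (c • x) w = c • homComp h i hq x w := rfl
    rw [e]; exact Submodule.smul_mem _ _ hx
  | mem u hu =>
  obtain ⟨T, Φ, hT, hu⟩ := hu
  induction hw using Submodule.span_induction with
  | zero =>
    have e : homComp h i hq u 0 = 0 := funext fun A => by
      have := plugComp_smul_right h i hq (Cochain A) (0 : k) (u A) 0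
      rw [zero_smul, zero_smul] at this
      exact this
    rw [e]; exact Submodule.zero_mem _
  | add x y _ _ hx hy =>
    have e : homComp h i hq u (x + y) = homComp h i hq u x + homComp h i hq u y :=
      funext fun A => plugComp_add_right h i hq (Cochain A) (u A) (x A) (y A)
    rw [e]; exact Submodule.add_mem _ hx hy
  | smul c x _ hx =>
    have e : homComp h i hq u (c • x) = c • homComp h i hq u x :=
      funext fun A => plugComp_smul_right h i hq (Cochain A) c (u A) (x A)
    rw [e]; exact Submodule.smul_mem _ _ hx
  | mem w hw =>
    obtain ⟨S, Ψ, hS, hw⟩ := hw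
    exact homComp_mem_of_isTreeOp h i hq hT hu hS hw

end Circ

theorem natCirc_mem {m n r d d' : ℕ} (h : r + 1 = m + n) (i : Fin m) {U : OpFamily P m}
    {W : OpFamily P n} (hU : U ∈ natOps P m d) (hW : W ∈ natOps P n d') :
    natCirc d' h i U W ∈ natOps P r (d + d') := by
  refine mem_natOps_iff.mpr fun p M hM => ?_
  let q : Fin m → ℕ := fun j => if hj : j = i then ∑ y, p ((slot h i).symm (Sum.inr y)) + d' else
    p ((slot h i).symm (Sum.inl ⟨j, hj⟩))
  have hqi : q i = ∑ y, p ((slot h i).symm (Sum.inr y)) + d' := by simp [q]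
  have hq : ∀ (j : Fin m) (hj : j ≠ i), p ((slot h i).symm (Sum.inl ⟨j, hj⟩)) = q j :=
    fun j hj => by simp [q, hj]
  have hqM : M = ∑ j, q j + d := by
    rw [hM, Fintype.sum_eq_add_sum_subtype_ne _ i, hqi, ← Equiv.sum_comp (slot h i).symm,
      Fintype.sum_sum_type]
    have : ∑ x, p ((slot h i).symm (Sum.inl x)) = ∑ j : {j // j ≠ i}, q j :=
      Finset.sum_congr rfl fun j _ => hq j.1 j.2
    rw [this]; ring
  obtain ⟨u, hu, hU⟩ := mem_natOps_iff.mp hU q M hqM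
  obtain ⟨w, hw, hW⟩ := mem_natOps_iff.mp hW _ (q i) hqi
  refine ⟨(∏ j, (-1 : k) ^ (if j < i then d' * q j else 0)) • homComp h i hq u w,
    Submodule.smul_mem _ _ (homComp_mem h i hq hu hw), fun A f => ?_⟩
  rw [natCirc, gradedCirc_apply, hW]
  have e : circArg (eps A) d' h i (ofDeg A (q i) (w A fun y => f ((slot h i).symm (Sum.inr y))))
      (fun z => ofDeg A (p z) (f z)) = fun j => (-1 : k) ^ (if j < i then d' * q j else 0) •
        ofDeg A (q j) (plug (C := Cochain A) h i hq
          (w A fun y => f ((slot h i).symm (Sum.inr y))) f j) := by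
    funext j
    rw [plug_map h i hq (C := Cochain A) (D := fun _ => CTot A) (fun l x => ofDeg A l x),
      plug_const]
    by_cases hj : j = i
    · subst hj; simp [circArg]
    · simp only [circArg, dif_neg hj]
      split_ifs
      · rw [eps_pow_ofDeg, ← hq j hj]
      · rw [pow_zero, one_smul]
  rw [e, MultilinearMap.map_smul_univ, hU, ← map_smul]
  rfl

/-! #### Permutations -/

/-- Renumbering the variables of a multilinear map in graded variables. -/
def reindexVars {n : ℕ} (σ : Equiv.Perm (Fin n)) (p : Fin n → ℕ) (C : ℕ → Type*)
    [∀ l, AddCommGroup (C l)] [∀ l, Module k (C l)] (M : Type*) [AddCommGroup M] [Module k M] :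
    MultilinearMap k (fun i => C (p (σ⁻¹ i))) M ≃ₗ[k] MultilinearMap k (fun i => C (p i)) M :=
  (MultilinearMap.domDomCongrLinearEquiv' k k (fun i => C (p i)) M σ).symm

theorem reindexVars_mem {n M : ℕ} (σ : Equiv.Perm (Fin n)) (p : Fin n → ℕ)
    {u : HomFamily P (fun i => p (σ⁻¹ i)) M} (hu : u ∈ treeSpan P (fun i => p (σ⁻¹ i)) M) :
    (fun A => reindexVars σ p (Cochain A) _ (u A) : HomFamily P p M) ∈ treeSpan P p M := by
  induction hu using Submodule.span_induction with
  | zero => exact Submodule.zero_mem (treeSpan P p M)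
  | add x y _ _ hx hy => exact Submodule.add_mem _ hx hy
  | smul c x _ hx => exact Submodule.smul_mem _ c hx
  | mem u hu =>
    obtain ⟨T, Φ, hT, hu⟩ := hu
    refine Submodule.subset_span ⟨NTree.subst (b := fun z => p z + 1)
      (fun i => NTree.corolla (P := P) (a := fun z => p z + 1) (σ⁻¹ i)) T,
      reindexVars (k := k) σ p (fun l => (qdual P).obj (l + 1)) ((qdual P).obj (M + 1)) Φ,
      ⟨fun j => ?_, fun z => ?_⟩, fun A => ?_⟩
    · rw [NTree.legCount_subst _ (fun y => NTree.legCount_corolla _), hT.1]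
    · rw [NTree.whiteCount_subst _ (fun y => NTree.legCount_corolla _), ← Equiv.sum_comp σ]
      simp only [hT.2, one_mul, NTree.whiteCount_corolla, perm_inv_apply_self]
      simp
    · obtain ⟨TA, U, h1, h2, h3⟩ := hu A
      refine ⟨fun φ => TA fun i => φ (σ⁻¹ i),
        reindexVars (k := k) σ p (fun l => (sEP A).obj (l + 1)) ((sEP A).obj (M + 1)) U,
        fun φ x => ?_, fun φ y => ?_, fun f => ?_⟩
      · rw [h1]
        exact (NTree.eval_subst A _ _ _ (fun _ _ => rfl) x T).symm
      · exact h2 (fun i => φ (σ⁻¹ i)) (fun i => y (σ⁻¹ i))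
      · exact h3 fun i => f (σ⁻¹ i)

theorem natAct_mem [CharZero k] {n d : ℕ} (σ : Equiv.Perm (Fin n)) {U : OpFamily P n}
    (hU : U ∈ natOps P n d) : natAct σ U ∈ natOps P n d := by
  refine mem_natOps_iff.mpr fun p M hM => ?_
  obtain ⟨u, hu, hU⟩ := mem_natOps_iff.mp hU (fun i => p (σ⁻¹ i)) M
    (by rw [hM, Equiv.sum_comp σ⁻¹ p])
  refine ⟨koszulSign k σ (fun i => Fin.ofNat 2 (p i)) •
    (fun A => reindexVars σ p (Cochain A) _ (u A) : HomFamily P p M),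
    Submodule.smul_mem _ _ (reindexVars_mem σ p hu), fun A f => ?_⟩
  rw [natAct, gradedAct_apply (eps A) _ _ (fun i => Fin.ofNat 2 (p i)) _
    (fun i => eps_ofDeg_parity _ _), hU, ← map_smul]
  rfl

end NaturalOperad

/-! ### Cup products are natural operations -/

/-- In an operad that is generated by binary operations the only operations of arity one are the
multiples of the unit, and there are none in arity zero. -/
theorem interp_arity_le_one (P : Operad k) {n : ℕ} (t : Term k (P.obj 2) n) :
    (n = 0 → interp P t = 0) ∧
      ∀ e : 1 = n, ∃ c : k, interp P t = c • P.castArity e P.one := by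
  induction t with
  | gen x => exact ⟨fun e => by omega, fun e => by omega⟩
  | tri x => exact ⟨fun e => by omega, fun e => by omega⟩
  | one => exact ⟨fun e => by omega, fun e => ⟨1, by rw [one_smul]; rfl⟩⟩
  | @circ m n r h i p q hp hq =>
    have hi := i.isLt
    refine ⟨fun e => ?_, fun e => ?_⟩
    · rw [interp, hq.1 (by omega), map_zero]
    · by_cases hn : n = 0
      · exact ⟨0, by rw [interp, hq.1 hn, map_zero, zero_smul]⟩
      · obtain rfl : m = 1 := by omega
        obtain rfl : n = 1 := by omega
        obtain rfl : r = 1 := by omega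
        obtain ⟨c, hc⟩ := hp.2 rfl
        obtain ⟨c', hc'⟩ := hq.2 rfl
        obtain rfl : i = 0 := Subsingleton.elim _ _
        refine ⟨c' * c, ?_⟩
        rw [interp, hc, hc', map_smul, map_smul, LinearMap.smul_apply, smul_smul]
        congr 1
        exact P.one_circ _ _
  | act σ p hp =>
    refine ⟨fun e => by rw [interp, hp.1 e, map_zero], fun e => ?_⟩
    subst e
    obtain ⟨c, hc⟩ := hp.2 rfl
    obtain rfl : σ = 1 := Subsingleton.elim _ _
    exact ⟨c, by rw [interp, P.act_one, hc]⟩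
  | zero => exact ⟨fun _ => rfl, fun _ => ⟨0, by rw [zero_smul]; rfl⟩⟩
  | add p q hp hq =>
    refine ⟨fun e => by rw [interp, hp.1 e, hq.1 e, add_zero], fun e => ?_⟩
    obtain ⟨c, hc⟩ := hp.2 e
    obtain ⟨c', hc'⟩ := hq.2 e
    exact ⟨c + c', by rw [interp, hc, hc', add_smul]⟩
  | smul a p hp =>
    refine ⟨fun e => by rw [interp, hp.1 e, smul_zero], fun e => ?_⟩
    obtain ⟨c, hc⟩ := hp.2 e
    exact ⟨a * c, by rw [interp, hc, smul_smul]⟩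

theorem IsQuadratic.arity_one {P : Operad k} (hP : IsQuadratic P) (x : P.obj 1) :
    ∃ c : k, x = c • P.one := by
  obtain ⟨t, rfl⟩ := (hP 1).2 x
  induction t using Quot.ind with
  | mk t => exact (interp_arity_le_one P t).2 rfl

/-- The composition of the operad `𝔰(O ⊗ Q)` is, up to a sign that depends on the arities only, the
tensor product of the compositions of `O` and `Q`. -/
theorem gammaAux_susp_hadamard (n s N r : ℕ) (a : Fin n → ℕ) (hN : N = s + n)
    (hr : r = s + ∑ i, a i) : ∃ c : k, ∀ (O Q : OperadData k) (t : O.obj N) (t' : Q.obj N)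
      (f : ∀ i, O.obj (a i)) (f' : ∀ i, Q.obj (a i)),
      (O.hadamard Q).susp.gammaAux n s N r a hN hr (t ⊗ₜ[k] t') (fun i => f i ⊗ₜ[k] f' i) =
        c • (O.gammaAux n s N r a hN hr t f ⊗ₜ[k] Q.gammaAux n s N r a hN hr t' f') := by
  induction n generalizing s N with
  | zero =>
    have e : N = r := by simp at hr; omega
    subst e
    exact ⟨1, fun O Q t t' f f' => (one_smul _ _).symm⟩
  | succ n ih =>
    obtain ⟨c, hc⟩ := ih (s + a 0) (s + a 0 + n) (fun i => a i.succ) rfl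
      (by rw [hr, Fin.sum_univ_succ]; omega)
    refine ⟨(-1) ^ ((a 0 + 1) * s) * c, fun O Q t t' f f' => ?_⟩
    have e := hc O Q (O.circ (by omega) ⟨s, by omega⟩ t (f 0))
      (Q.circ (by omega) ⟨s, by omega⟩ t' (f' 0)) (fun i => f i.succ) (fun i => f' i.succ)
    rw [SemigroupAction.mul_smul]
    refine Eq.trans ?_ (congrArg (fun z => (-1 : k) ^ ((a 0 + 1) * s) • z) e)
    rw [← smul_apply, ← map_smul]
    rfl

/-- The composition in the endomorphism operad. -/
theorem endOp_gammaAux_apply {V : Type u} [AddCommGroup V] [Module k V] (n s N r : ℕ)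
    (a : Fin n → ℕ) (hN : N = s + n) (hr : r = s + ∑ i, a i)
    (t : MultilinearMap k (fun _ : Fin N => V) V)
    (f : ∀ i, MultilinearMap k (fun _ : Fin (a i) => V) V) (x : Fin r → V) (X : Fin N → V)
    (hX₁ : ∀ (j : Fin N) (z : Fin r), j.val < s → z.val = j.val → X j = x z)
    (hX₂ : ∀ (i : Fin n) (j : Fin N) (b : Fin (a i) → Fin r), j.val = s + i.val →
      (∀ y, (b y).val = s + ∑ i' : Fin i.val, a (Fin.castLE i.isLt.le i') + y.val) →
      X j = f i fun y => x (b y)) :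
    (EndOp (k := k) V).gammaAux n s N r a hN hr t f x = t X := by
  induction n generalizing s N with
  | zero =>
    have e : N = r := by simp at hr; omega
    subst e
    exact congrArg t (funext fun j => (hX₁ j j (by have := j.isLt; omega) rfl).symm)
  | succ n ih =>
    have hrs := hr
    rw [Fin.sum_univ_succ] at hrs
    have hN' : s + a 0 + n + 1 = N + a 0 := by omega
    -- the arguments after the first step
    let X' : Fin (s + a 0 + n) → V := fun j =>
      if hj : j.val < s + a 0 then x ⟨j.val, by omega⟩ else X ⟨j.val + 1 - a 0, by omega⟩
    refine (ih (s + a 0) (s + a 0 + n) (fun i => a i.succ) rfl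
      (by rw [hr, Fin.sum_univ_succ]; omega) ((EndOp V).circ hN' ⟨s, by omega⟩ t (f 0))
      (fun i => f i.succ) X' ?_ ?_).trans ?_
    · intro j z hj hz
      simp only [X', dif_pos hj]
      congr 1
      exact Fin.ext hz.symm
    · intro i j b hj hb
      have hlt : ¬ j.val < s + a 0 := by omega
      simp only [X', dif_neg hlt]
      refine hX₂ i.succ _ b ?_ fun y => ?_
      · simp only [Fin.val_succ]; omega
      · rw [hb]
        have : ∑ i' : Fin i.succ.val, a (Fin.castLE i.succ.isLt.le i') =
            a 0 + ∑ i' : Fin i.val, a (Fin.castLE i.isLt.le i').succ :=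
          Fin.sum_univ_succ (n := i.val) fun i' => a (Fin.castLE i.succ.isLt.le i')
        rw [this]
        omega
    · rw [endOp_circ_apply]
      congr 1
      funext j
      have hjl := j.isLt
      rcases lt_trichotomy j.val s with hj | hj | hj
      · rw [outerInput_lt hN' _ _ _ (by exact hj) ⟨j.val, by omega⟩ rfl]
        have hlt : j.val < s + a 0 := by omega
        simp only [X', dif_pos hlt]
        exact (hX₁ j _ hj rfl).symm
      · rw [show j = ⟨s, by omega⟩ from Fin.ext hj, outerInput_self]
        refine Eq.trans ?_ (hX₂ 0 _ (fun y => ⟨s + y.val, by omega⟩) (by simp)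
          (fun y => by simp)).symm
        congr 1
        funext y
        have hlt : ((slot hN' (⟨s, by omega⟩ : Fin N)).symm (Sum.inr y)).val < s + a 0 := by
          rw [slot_symm_inr_val]; simp
        simp only [X', dif_pos hlt]
        rfl
      · rw [outerInput_gt hN' _ _ _ (by exact hj) ⟨j.val + a 0 - 1, by omega⟩ (by simp only; omega)]
        have hlt : ¬ j.val + a 0 - 1 < s + a 0 := by omega
        simp only [X', dif_neg hlt]
        congr 1
        rw [Fin.ext_iff]
        simp only
        omega

section CupMem

variable {P : Operad k} {N : ℕ}

theorem sum_succ_eq {m : ℕ} {p : Fin (N + 1) → ℕ} (hm : m = ∑ i, p i + N) :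
    ∑ i, (p i + 1) = m + 1 := by
  simp only [Finset.sum_add_distrib, Finset.sum_const, Finset.card_univ, Fintype.card_fin,
    smul_eq_mul, mul_one]
  omega

/-- The label of the leg which is the input `y` of the white vertex `wᵢ`, if the legs are numbered
from the left to the right. -/
def blockLabel {m : ℕ} {p : Fin (N + 1) → ℕ} (hm : m = ∑ i, p i + N) (i : Fin (N + 1))
    (y : Fin (p i + 1)) : Fin (m + 1) :=
  Fin.cast (sum_succ_eq hm) (finSigmaFinEquiv ⟨i, y⟩)

/-- The corollas of the white vertices `w₁, …, wₙ`, with the legs numbered from the left to the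
right. -/
def blockTree {m : ℕ} {p : Fin (N + 1) → ℕ} (hm : m = ∑ i, p i + N) (i : Fin (N + 1)) :
    NTree P (fun i => p i + 1) (m + 1) :=
  NTree.white (a := fun i => p i + 1) i fun y => NTree.leg (blockLabel hm i y)

theorem sum_legCount_blockTree {m : ℕ} {p : Fin (N + 1) → ℕ} (hm : m = ∑ i, p i + N)
    (j : Fin (m + 1)) : ∑ i, NTree.legCount j (blockTree (P := P) hm i) = 1 := by
  have e : ∑ z : (i : Fin (N + 1)) × Fin (p i + 1),
      (if blockLabel hm z.1 z.2 = j then 1 else 0 : ℕ) = 1 := by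
    have := Equiv.sum_comp (finSigmaFinEquiv.trans (finCongr (sum_succ_eq hm)))
      fun z => (if z = j then 1 else 0 : ℕ)
    rw [Finset.sum_ite_eq' Finset.univ j, if_pos (Finset.mem_univ _)] at this
    exact this
  refine Eq.trans ?_ e
  rw [Fintype.sum_sigma]
  rfl

theorem sum_whiteCount_blockTree {m : ℕ} {p : Fin (N + 1) → ℕ} (hm : m = ∑ i, p i + N)
    (z : Fin (N + 1)) : ∑ i, NTree.whiteCount z (blockTree (P := P) hm i) = 1 := by
  simp [blockTree, NTree.whiteCount]

/-- The cup product with `x ⊗ y` is the natural operation given by any tree which has the operation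
`x` at the root and the corollas of the white vertices on top of it. -/
theorem isTreeOp_cupComp (p : Fin (N + 1) → ℕ) (x : P.obj (N + 1)) (y : (qdual P).obj (N + 1))
    (T : NTree P (fun i => p i + 1) (∑ i, p i + N + 1))
    (hT : ∀ (A : PAlg P) (φ : ∀ i, Ops (k := k) A.carrier (p i + 1)) v,
      T.eval A φ v = A.str.map _ x fun i => (blockTree rfl i).eval A φ v) :
    ∃ Φ, IsTreeOp T Φ (fun A => cupComp P N p A (x ⊗ₜ[k] y)) := by
  have hr : ∑ i, p i + N + 1 = 0 + ∑ i, (p i + 1) := by rw [sum_succ_eq rfl, zero_add]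
  have hN : N + 1 = 0 + (N + 1) := (zero_add _).symm
  obtain ⟨c, hc⟩ := gammaAux_susp_hadamard (k := k) (N + 1) 0 (N + 1) (∑ i, p i + N + 1)
    (fun i => p i + 1) hN hr
  refine ⟨c • (qdual P).gammaAux (N + 1) 0 (N + 1) _ (fun i => p i + 1) hN hr y, fun A =>
    ⟨(EndOp (k := k) A.carrier).gammaAux (N + 1) 0 (N + 1) _ (fun i => p i + 1) hN hr
      (A.str.map _ x), (sEP A).gammaAux (N + 1) 0 (N + 1) _ (fun i => p i + 1) hN hr
      (A.str.map _ x ⊗ₜ[k] y), fun φ v => ?_, fun φ q => ?_, fun f => rfl⟩⟩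
  · rw [hT]
    refine endOp_gammaAux_apply _ _ _ _ _ _ _ _ _ _ _ (fun j z hj => by omega)
      fun i j b hj hb => ?_
    obtain rfl : j = i := Fin.ext (by omega)
    refine congrArg (φ j) (funext fun y => congrArg v (Fin.ext ?_))
    rw [hb, zero_add]
    exact finSigmaFinEquiv_apply _
  · rw [smul_apply, TensorProduct.tmul_smul]
    exact hc _ _ _ _ _ _

theorem cupComp_mem (hP : IsQuadratic P) (p : Fin (N + 1) → ℕ) (t : (sPP P).obj (N + 1)) :
    (fun A => cupComp P N p A t) ∈ treeSpan P p (∑ i, p i + N) := by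
  induction t using TensorProduct.induction_on with
  | zero =>
    have e : (fun A => cupComp P N p A 0) = (0 : HomFamily P p (∑ i, p i + N)) :=
      funext fun A => map_zero _
    rw [e]
    exact Submodule.zero_mem _
  | add s t hs ht =>
    have e : (fun A => cupComp P N p A (s + t)) =
        (fun A => cupComp P N p A s : HomFamily P p (∑ i, p i + N)) + fun A => cupComp P N p A t :=
      funext fun A => map_add _ _ _
    rw [e]
    exact Submodule.add_mem _ hs ht
  | tmul x y =>
    obtain _ | N := N
    · -- operations of arity one are multiples of the unit, so that no black vertex is needed
      obtain ⟨c, rfl⟩ := hP.arity_one x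
      obtain ⟨Φ, hΦ⟩ := isTreeOp_cupComp p P.one y (blockTree rfl 0) fun A φ v => by
        rw [A.str.map_one]; rfl
      have e : (fun A => cupComp P 0 p A ((c • P.one) ⊗ₜ[k] y)) =
          c • (fun A => cupComp P 0 p A (P.one ⊗ₜ[k] y) : HomFamily P p (∑ i, p i + 0)) :=
        funext fun A => by rw [← TensorProduct.smul_tmul']; exact map_smul _ _ _
      rw [e]
      refine Submodule.smul_mem _ _ (Submodule.subset_span ⟨_, Φ, ⟨fun j => ?_, fun z => ?_⟩, hΦ⟩)
      · exact (Fin.sum_univ_one _).symm.trans (sum_legCount_blockTree (P := P) (p := p) rfl j)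
      · exact (Fin.sum_univ_one _).symm.trans (sum_whiteCount_blockTree (P := P) (p := p) rfl z)
    · obtain ⟨Φ, hΦ⟩ := isTreeOp_cupComp p x y (NTree.black (by omega) x fun i => blockTree rfl i)
        fun A φ v => rfl
      exact Submodule.subset_span
        ⟨_, Φ, ⟨sum_legCount_blockTree rfl, sum_whiteCount_blockTree rfl⟩, hΦ⟩

/-- Cup products are natural operations. -/
theorem cup_mem (hP : IsQuadratic P) (t : (sPP P).obj (N + 1)) :
    cup P N t ∈ natOps P (N + 1) N :=
  ⟨_, fun p _ => cupComp_mem hP p t, rfl⟩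

end CupMem

/-! ### The operad of natural operations is a differential graded operad -/

section Bilinear

variable {P : Operad k}

/-- The partial composition of `B_P` as a bilinear map. -/
def natCircL (e : ℕ) {m n r : ℕ} (h : r + 1 = m + n) (i : Fin m) :
    OpFamily P m →ₗ[k] OpFamily P n →ₗ[k] OpFamily P r :=
  LinearMap.mk₂ k (natCirc e h i) (fun _ _ _ => rfl) (fun _ _ _ => rfl)
    (fun U W W' => funext fun A => MultilinearMap.ext fun x => by
      simp only [natCirc, Pi.add_apply, add_apply, gradedCirc_apply]
      rw [circArg_eq_update, MultilinearMap.map_update_add, ← circArg_eq_update,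
        ← circArg_eq_update])
    (fun c U W => funext fun A => MultilinearMap.ext fun x => by
      simp only [natCirc, Pi.smul_apply, smul_apply, gradedCirc_apply]
      rw [circArg_eq_update, MultilinearMap.map_update_smul, ← circArg_eq_update])

/-- The action of a permutation on `B_P` as a linear map. -/
def natActL {n : ℕ} (σ : Equiv.Perm (Fin n)) : OpFamily P n →ₗ[k] OpFamily P n where
  toFun := natAct σ
  map_add' U W := funext fun A => MultilinearMap.ext fun x => by
    simp only [natAct, gradedAct, Pi.add_apply, map_add, add_apply, sum_apply, smul_apply,
      MultilinearMap.compLinearMap_apply, smul_add, Finset.sum_add_distrib]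
  map_smul' c U := funext fun A => MultilinearMap.ext fun x => by
    simp only [natAct, gradedAct, Pi.smul_apply, map_smul, sum_apply, smul_apply,
      MultilinearMap.compLinearMap_apply, RingHom.id_apply, Finset.smul_sum, smul_comm c]

variable [FiniteDimensional k (P.obj 2)]

theorem delta_apply (n d : ℕ) (U : OpFamily P n) (A : PAlg P) :
    delta P n d U A = opDiff (eps A) (totalD A) d (U A) := by
  simp only [delta, LinearMap.pi_apply, LinearMap.comp_apply, LinearMap.proj_apply,
    LinearMap.sub_apply, LinearMap.smul_apply, LinearMap.sum_apply]
  rfl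

/-- The Leibniz rule in `B_P`. -/
theorem delta_natCirc {m n r d d' : ℕ} (h : r + 1 = m + n) (i : Fin m) (U : OpFamily P m)
    {W : OpFamily P n} (hW : W ∈ natOps P n d') :
    delta P r (d + d') (natCirc d' h i U W) = natCirc d' h i (delta P m d U) W +
      (-1 : k) ^ d • natCirc (d' + 1) h i U (delta P n d' W) := by
  funext A
  simp only [Pi.add_apply, Pi.smul_apply, natCirc, delta_apply]
  exact opDiff_gradedCirc (eps_totalD A) d d' h i (U A) (W A) (eps_natOps hW A)

theorem delta_natAct [CharZero k] {n d : ℕ} (σ : Equiv.Perm (Fin n)) (U : OpFamily P n) :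
    delta P n d (natAct σ U) = natAct σ (delta P n d U) := by
  funext A
  simp only [natAct, delta_apply]
  exact opDiff_gradedAct (eps_eps A) (eps_totalD A) d σ (U A)

theorem mem_cocycles_iff {n d : ℕ} {U : OpFamily P n} :
    U ∈ cocycles P n d ↔ U ∈ natOps P n d ∧ delta P n d U = 0 := Iff.rfl

theorem natCirc_mem_cocycles {m n r d d' e : ℕ} (h : r + 1 = m + n) (he : e = d + d') (i : Fin m)
    {U : OpFamily P m} {W : OpFamily P n} (hU : U ∈ cocycles P m d) (hW : W ∈ cocycles P n d') :
    natCirc d' h i U W ∈ cocycles P r e := by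
  subst he
  refine mem_cocycles_iff.mpr ⟨natCirc_mem h i hU.1 hW.1, ?_⟩
  rw [delta_natCirc h i U hW.1, (mem_cocycles_iff.mp hU).2,
    (mem_cocycles_iff.mp hW).2]
  have e1 : natCirc d' h i 0 W = 0 := rfl
  have e2 : natCirc (d' + 1) h i U 0 = 0 := map_zero (natCircL (d' + 1) h i U)
  rw [e1, e2, smul_zero, add_zero]

theorem natCirc_mem_coboundaries_left {m n r d d' e : ℕ} (h : r + 1 = m + n) (he : e = d + d')
    (i : Fin m) {U : OpFamily P m} {W : OpFamily P n} (hU : U ∈ coboundaries P m d)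
    (hW : W ∈ cocycles P n d') : natCirc d' h i U W ∈ coboundaries P r e := by
  obtain _ | d := d
  · obtain rfl : U = 0 := hU
    exact Submodule.zero_mem _
  · obtain rfl : e = d + d' + 1 := by omega
    obtain ⟨U, hU, rfl⟩ := hU
    refine ⟨natCirc d' h i U W, natCirc_mem h i hU hW.1, ?_⟩
    have e2 : natCirc (d' + 1) h i U 0 = 0 := map_zero (natCircL (d' + 1) h i U)
    rw [delta_natCirc h i U hW.1, (mem_cocycles_iff.mp hW).2, e2, smul_zero, add_zero]

theorem natCirc_mem_coboundaries_right {m n r d d' e : ℕ} (h : r + 1 = m + n) (he : e = d + d')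
    (i : Fin m) {U : OpFamily P m} {W : OpFamily P n} (hU : U ∈ cocycles P m d)
    (hW : W ∈ coboundaries P n d') : natCirc d' h i U W ∈ coboundaries P r e := by
  obtain _ | d' := d'
  · obtain rfl : W = 0 := hW
    have e2 : natCirc 0 h i U 0 = 0 := map_zero (natCircL 0 h i U)
    rw [e2]
    exact Submodule.zero_mem _
  · obtain rfl : e = d + d' + 1 := by omega
    obtain ⟨W, hW, rfl⟩ := hW
    refine ⟨(-1 : k) ^ d • natCirc d' h i U W,
      Submodule.smul_mem _ _ (natCirc_mem h i hU.1 hW), ?_⟩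
    have e1 : natCirc d' h i 0 W = 0 := rfl
    rw [map_smul, delta_natCirc h i U hW, (mem_cocycles_iff.mp hU).2, e1, zero_add, smul_smul,
      neg_one_pow_mul_self, one_smul]

variable [CharZero k]

theorem natAct_mem_cocycles {n d : ℕ} (σ : Equiv.Perm (Fin n)) {U : OpFamily P n}
    (hU : U ∈ cocycles P n d) : natAct σ U ∈ cocycles P n d := by
  refine mem_cocycles_iff.mpr ⟨natAct_mem σ hU.1, ?_⟩
  rw [delta_natAct, (mem_cocycles_iff.mp hU).2]
  exact map_zero (natActL σ)

theorem natAct_mem_coboundaries {n d : ℕ} (σ : Equiv.Perm (Fin n)) {U : OpFamily P n}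
    (hU : U ∈ coboundaries P n d) : natAct σ U ∈ coboundaries P n d := by
  obtain _ | d := d
  · obtain rfl : U = 0 := hU
    rw [show natAct σ (0 : OpFamily P n) = 0 from map_zero (natActL σ)]
    exact Submodule.zero_mem _
  · obtain ⟨U, hU, rfl⟩ := hU
    exact ⟨natAct σ U, natAct_mem σ hU, delta_natAct σ U⟩

/-- The unit is natural, being the cup product with the unit of `𝔰(P ⊗ P^!)`. -/
theorem natOne_mem_cocycles (hP : IsQuadratic P) : natOne P ∈ cocycles P 1 0 := by
  refine ⟨?_, funext fun A => MultilinearMap.ext fun x => ?_⟩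
  · rw [← cup_one]
    exact cup_mem hP _
  · rw [delta_apply, opDiff_apply, Fin.sum_univ_one, natOne, endOp_one_apply, endOp_one_apply]
    simp [diffArg]

end Bilinear

/-! ### The operad structure on the cohomology of `B_P` -/

section CohomologyOperad

/-- A bilinear map that vanishes on two subspaces descends to the quotients. -/
def liftQ₂ {M N L : Type*} [AddCommGroup M] [Module k M] [AddCommGroup N] [Module k N]
    [AddCommGroup L] [Module k L] (S : Submodule k M) (T : Submodule k N) (f : M →ₗ[k] N →ₗ[k] L)
    (hS : ∀ x ∈ S, ∀ y, f x y = 0) (hT : ∀ x, ∀ y ∈ T, f x y = 0) :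
    (M ⧸ S) →ₗ[k] (N ⧸ T) →ₗ[k] L :=
  S.liftQ (T.liftQ f.flip fun y hy => LinearMap.ext fun x => hT x y hy).flip fun x hx => by
    refine LinearMap.ext fun y => ?_
    obtain ⟨y, rfl⟩ := T.mkQ_surjective y
    exact hS x hx y

variable {P : Operad k} [FiniteDimensional k (P.obj 2)]

theorem HB.mk_eq_zero {n d : ℕ} {U : cocycles P n d} (hU : U.1 ∈ coboundaries P n d) :
    HB.mk P n d U = 0 :=
  (Submodule.Quotient.mk_eq_zero _).mpr hU

theorem HB.mk_surjective {n d : ℕ} (x : HB P n d) : ∃ U, HB.mk P n d U = x :=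
  Submodule.mkQ_surjective _ x

/-- The partial composition of cocycles of `B_P`, with values in cohomology. -/
def cocycleCirc {m n r d d' e : ℕ} (h : r + 1 = m + n) (he : e = d + d') (i : Fin m) :
    cocycles P m d →ₗ[k] cocycles P n d' →ₗ[k] HB P r e :=
  LinearMap.mk₂ k
    (fun U W => HB.mk P r e ⟨natCirc d' h i U.1 W.1, natCirc_mem_cocycles h he i U.2 W.2⟩)
    (fun _ _ _ => rfl) (fun _ _ _ => rfl)
    (fun U W W' => by
      rw [← map_add]
      exact congrArg _ (Subtype.ext (map_add (natCircL d' h i U.1) W.1 W'.1)))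
    (fun c U W => by
      rw [← map_smul]
      exact congrArg _ (Subtype.ext (map_smul (natCircL d' h i U.1) c W.1)))

theorem cup_mem_cocycles (hP : IsQuadratic P) {N : ℕ} (t : ZP P N) :
    cup P N t.1 ∈ cocycles P (N + 1) N := ⟨cup_mem hP t.1, t.2⟩

theorem mem_ZP_of_cup_mem {N : ℕ} {t : (sPP P).obj (N + 1)}
    (h : cup P N t ∈ cocycles P (N + 1) N) : t ∈ ZP P N := h.2

/-- The map `t ↦ [cup(t)]`. -/
def cupClass (hP : IsQuadratic P) (N : ℕ) : ZP P N →ₗ[k] HB P (N + 1) N :=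
  HB.mk P (N + 1) N ∘ₗ (cup P N).restrict fun t ht => cup_mem_cocycles hP ⟨t, ht⟩

variable [CharZero k]

/-- The operad structure on the cohomology of `B_P`. -/
def hbOperad (hP : IsQuadratic P) : HBOperad P where
  one := HB.mk P 1 0 ⟨natOne P, natOne_mem_cocycles hP⟩
  circ h he i := liftQ₂ _ _ (cocycleCirc h he i)
    (fun _ hU W => HB.mk_eq_zero (natCirc_mem_coboundaries_left h he i hU W.2))
    (fun U _ hW => HB.mk_eq_zero (natCirc_mem_coboundaries_right h he i U.2 hW))
  act σ := Submodule.mapQ _ _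
    ((natActL σ).restrict fun _ hU => natAct_mem_cocycles σ hU)
    (fun _ hU => natAct_mem_coboundaries σ hU)
  one_eq := ⟨natOne_mem_cocycles hP, rfl⟩
  circ_mk h he i U W := ⟨natCirc_mem_cocycles h he i U.2 W.2, rfl⟩
  act_mk σ U := ⟨natAct_mem_cocycles σ U.2, rfl⟩

theorem zpIsSuboperad (hP : IsQuadratic P) : ZPIsSuboperad P where
  one_mem := mem_ZP_of_cup_mem (by rw [cup_one]; exact natOne_mem_cocycles hP)
  circ_mem h i t ht s hs := mem_ZP_of_cup_mem (by
    rw [cup_circ]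
    exact natCirc_mem_cocycles h (by omega) i (cup_mem_cocycles hP ⟨t, ht⟩)
      (cup_mem_cocycles hP ⟨s, hs⟩))
  act_mem σ t ht := mem_ZP_of_cup_mem (by
    rw [cup_act]
    exact natAct_mem_cocycles σ (cup_mem_cocycles hP ⟨t, ht⟩))

theorem isOperadMap_cupClass (hP : IsQuadratic P) :
    IsOperadMap (zpIsSuboperad hP) (hbOperad hP) (cupClass hP) where
  map_one := congrArg (HB.mk P 1 0) (Subtype.ext cup_one)
  map_circ h i t s := congrArg (HB.mk P _ _) (Subtype.ext (cup_circ h i t.1 s.1))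
  map_act σ t := congrArg (HB.mk P _ _) (Subtype.ext (cup_act σ t.1))

end CohomologyOperad

/-! ### The action on the operadic cohomology -/

section Action

/-- A multilinear map that vanishes as soon as one of its arguments lies in a subspace depends only
on the classes of its arguments modulo that subspace. -/
theorem multilinear_congr_of_sub_mem {ι M N : Type*} [Fintype ι] [DecidableEq ι]
    [AddCommGroup M] [Module k M] [AddCommGroup N] [Module k N] (S : Submodule k M)
    (F : MultilinearMap k (fun _ : ι => M) N) (hF : ∀ x i, x i ∈ S → F x = 0) {f g : ι → M}
    (h : ∀ i, f i - g i ∈ S) : F f = F g := by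
  suffices hs : ∀ s : Finset ι, F (s.piecewise f g) = F g by
    have := hs Finset.univ
    rwa [Finset.piecewise_univ] at this
  intro s
  induction s using Finset.induction_on with
  | empty => rw [Finset.piecewise_empty]
  | insert a s ha ih =>
    have e : s.piecewise f g = Function.update (s.piecewise f g) a (g a) := by
      rw [Function.eq_update_iff]
      exact ⟨Finset.piecewise_eq_of_notMem _ _ _ ha, fun _ _ => rfl⟩
    rw [← ih, Finset.piecewise_insert, ← sub_eq_zero]
    nth_rewrite 2 [e]
    rw [← MultilinearMap.map_update_sub]
    exact hF _ a (by rw [Function.update_self]; exact h a)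

section Complex

variable {V : Type u} [AddCommGroup V] [Module k V] {ε D : V →ₗ[k] V} {n e : ℕ}
  {U : Ops (k := k) V n}

theorem map_diffArg_eq_zero (U : Ops (k := k) V n) {x : Fin n → V} {i : Fin n} (hx : D (x i) = 0) :
    U (diffArg ε D i x) = 0 :=
  U.map_coord_zero i (by simp [diffArg, hx])

theorem opDiff_apply_cycles (U : Ops (k := k) V n) {x : Fin n → V} (hx : ∀ i, D (x i) = 0) :
    opDiff ε D e U x = D (U x) := by
  rw [opDiff_apply, Finset.sum_eq_zero fun i _ => map_diffArg_eq_zero U (hx i), smul_zero, sub_zero]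

/-- An operation that is a cocycle maps cycles, one of which is a boundary, to a boundary. The
preimage of the boundary is inserted into the operation, and signs are moved to the arguments before
it to compensate for those in the differential of the operation. -/
theorem mem_range_of_opDiff_eq_zero (hε : ∀ x, ε (ε x) = x) (hD : ∀ x, D (ε x) = -ε (D x))
    (hU : opDiff ε D e U = 0) {x : Fin n → V} (hx : ∀ i, D (x i) = 0) {i : Fin n}
    (hi : x i ∈ LinearMap.range D) : U x ∈ LinearMap.range D := by
  obtain ⟨y, hy⟩ := hi
  set z : Fin n → V := fun j => if j < i then ε (x j) else if j = i then y else x j with hz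
  have hzi : diffArg ε D i z = x := by
    funext j
    simp only [diffArg, hz]
    split_ifs with h1 h2
    · exact hε _
    · rw [h2, hy]
    · rfl
  have hzj : ∀ j, j ≠ i → D (z j) = 0 := fun j hj => by
    simp only [hz, if_neg hj]
    split_ifs
    · rw [hD, hx, map_zero, neg_zero]
    · exact hx j
  have h := MultilinearMap.congr_fun hU z
  rw [opDiff_apply, Finset.sum_eq_single i (fun j _ hj => map_diffArg_eq_zero U (hzj j hj))
    (by simp), hzi, zero_apply, sub_eq_zero] at h
  refine ⟨(-1 : k) ^ e • U z, ?_⟩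
  rw [map_smul, h, smul_smul, neg_one_pow_mul_self, one_smul]

end Complex

variable {P : Operad k} [FiniteDimensional k (P.obj 2)] (A : PAlg P)

theorem HP.mk_eq_zero {x : LinearMap.ker (totalD A)} (hx : x.1 ∈ LinearMap.range (totalD A)) :
    HP.mk A x = 0 :=
  (Submodule.Quotient.mk_eq_zero _).mpr hx

theorem HP.mk_surjective (x : HP A) : ∃ f, HP.mk A f = x := Submodule.mkQ_surjective _ x

theorem HP.sub_mem {x y : LinearMap.ker (totalD A)} (h : HP.mk A x = HP.mk A y) :
    x - y ∈ (LinearMap.range (totalD A)).submoduleOf (LinearMap.ker (totalD A)) :=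
  (Submodule.Quotient.eq _).mp h

variable {A}

theorem opDiff_of_mem_cocycles {n d : ℕ} {U : OpFamily P n} (hU : U ∈ cocycles P n d) :
    opDiff (eps A) (totalD A) d (U A) = 0 := by
  rw [← delta_apply, (mem_cocycles_iff.mp hU).2]
  rfl

theorem apply_mem_ker {n d : ℕ} {U : OpFamily P n} (hU : U ∈ cocycles P n d)
    (f : Fin n → LinearMap.ker (totalD A)) :
    U A (fun i => (f i).1) ∈ LinearMap.ker (totalD A) := by
  rw [LinearMap.mem_ker, ← opDiff_apply_cycles (ε := eps A) (e := d) (U A) (fun i => (f i).2),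
    opDiff_of_mem_cocycles hU]
  rfl

/-- The operation on cocycles of `A` given by a cocycle of `B_P`, with values in cohomology. -/
def cocycleOp {n d : ℕ} (U : cocycles P n d) :
    MultilinearMap k (fun _ : Fin n => LinearMap.ker (totalD A)) (HP A) :=
  (HP.mk A).compMultilinearMap (MultilinearMap.codRestrict
    ((U.1 A).compLinearMap fun _ => (LinearMap.ker (totalD A)).subtype) (LinearMap.ker (totalD A))
    fun f => apply_mem_ker U.2 f)

theorem cocycleOp_apply {n d : ℕ} (U : cocycles P n d) (f : Fin n → LinearMap.ker (totalD A)) :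
    cocycleOp U f = HP.mk A ⟨U.1 A fun i => (f i).1, apply_mem_ker U.2 f⟩ := rfl

theorem cocycleOp_congr {n d : ℕ} (U : cocycles P n d) {f g : Fin n → LinearMap.ker (totalD A)}
    (h : ∀ i, HP.mk A (f i) = HP.mk A (g i)) : cocycleOp U f = cocycleOp U g :=
  multilinear_congr_of_sub_mem
    ((LinearMap.range (totalD A)).submoduleOf (LinearMap.ker (totalD A))) (cocycleOp U)
    (fun x _ hx => HP.mk_eq_zero A (mem_range_of_opDiff_eq_zero (eps_eps A) (eps_totalD A)
      (opDiff_of_mem_cocycles U.2) (fun i => (x i).2) hx)) fun i => HP.sub_mem A (h i)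

theorem apply_mem_range {n d : ℕ} {U : OpFamily P n} (hU : U ∈ coboundaries P n d)
    (f : Fin n → LinearMap.ker (totalD A)) :
    U A (fun i => (f i).1) ∈ LinearMap.range (totalD A) := by
  obtain _ | d := d
  · obtain rfl : U = 0 := hU
    exact Submodule.zero_mem _
  · obtain ⟨W, -, rfl⟩ := hU
    refine ⟨W A fun i => (f i).1, ?_⟩
    rw [delta_apply]
    exact (opDiff_apply_cycles (W A) fun i => (f i).2).symm

theorem cocycleOp_of_mem_coboundaries {n d : ℕ} {U : cocycles P n d}
    (hU : U.1 ∈ coboundaries P n d) (f : Fin n → LinearMap.ker (totalD A)) : cocycleOp U f = 0 :=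
  HP.mk_eq_zero A (apply_mem_range hU f)

variable (A) in
/-- A choice of representing cocycles which is linear in the cohomology class. -/
theorem HP.exists_section :
    ∃ s : HP A →ₗ[k] LinearMap.ker (totalD A), HP.mk A ∘ₗ s = LinearMap.id :=
  (HP.mk A).exists_rightInverse_of_surjective
    (LinearMap.range_eq_top.mpr (HP.mk_surjective A))

variable (A) in
/-- The action of `H^*(B_P, δ_P)` on `H^*_P(A;A)`. -/
theorem exists_cohomologyAction : ∃ a : ∀ n d, HB P n d →ₗ[k] Ops (k := k) (HP A) n,
    ∀ (n d : ℕ) (U : cocycles P n d) (f : Fin n → LinearMap.ker (totalD A)),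
      a n d (HB.mk P n d U) (fun i => HP.mk A (f i)) = cocycleOp U f := by
  obtain ⟨s, hs⟩ := HP.exists_section A
  let b : ∀ n d, cocycles P n d →ₗ[k] Ops (k := k) (HP A) n := fun n d =>
    { toFun := fun U => (cocycleOp U).compLinearMap fun _ => s
      map_add' := fun _ _ => rfl
      map_smul' := fun _ _ => rfl }
  refine ⟨fun n d => Submodule.liftQ _ (b n d) fun U hU => MultilinearMap.ext fun x =>
    cocycleOp_of_mem_coboundaries hU _, fun n d U f => ?_⟩
  exact cocycleOp_congr U fun i => LinearMap.congr_fun hs _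

theorem epsH_mk (x : LinearMap.ker (totalD A)) :
    ∃ h, epsH A (HP.mk A x) = HP.mk A ⟨eps A x.1, h⟩ := ⟨_, rfl⟩

theorem epsH_pow_mk (e : ℕ) (x : LinearMap.ker (totalD A)) :
    ∃ h, (epsH A ^ e) (HP.mk A x) = HP.mk A ⟨(eps A ^ e) x.1, h⟩ := by
  induction e with
  | zero => exact ⟨x.2, rfl⟩
  | succ e ih =>
    obtain ⟨h, he⟩ := ih
    obtain ⟨h', he'⟩ := epsH_mk (A := A) ⟨(eps A ^ e) x.1, h⟩
    simp only [pow_succ', Module.End.mul_apply]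
    exact ⟨h', by rw [he, he']⟩

theorem epsH_epsH (x : HP A) : epsH A (epsH A x) = x := by
  obtain ⟨f, rfl⟩ := HP.mk_surjective A x
  exact congrArg (HP.mk A) (Subtype.ext (eps_eps A f.1))

theorem circArg_mk {e m n r : ℕ} (h : r + 1 = m + n) (i : Fin m) (w : LinearMap.ker (totalD A))
    (f : Fin r → LinearMap.ker (totalD A)) (j : Fin m) :
    ∃ hc, circArg (epsH A) e h i (HP.mk A w) (fun z => HP.mk A (f z)) j =
      HP.mk A ⟨circArg (eps A) e h i w.1 (fun z => (f z).1) j, hc⟩ := by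
  by_cases hj : j = i
  · subst hj
    have e₁ := circArg_self (eps A) e h j w.1 fun z => (f z).1
    exact ⟨by rw [e₁]; exact w.2, (circArg_self _ _ _ _ _ _).trans
      (congrArg (HP.mk A) (Subtype.ext e₁.symm))⟩
  · simp only [circArg, dif_neg hj]
    split_ifs
    · exact epsH_pow_mk e _
    · exact ⟨(f _).2, rfl⟩

/-- Algebras over an operad are pulled back along morphisms of operads. -/
theorem IsHBAlgebra.comp {hZ : ZPIsSuboperad P} {H : HBOperad P}
    {c : ∀ N, ZP P N →ₗ[k] HB P (N + 1) N} (hc : IsOperadMap hZ H c)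
    {a : ∀ n d, HB P n d →ₗ[k] Ops (k := k) (HP A) n} (ha : IsHBAlgebra H A a) :
    IsZPAlgebra hZ A (fun N => a (N + 1) N ∘ₗ c N) where
  map_one := by rw [LinearMap.comp_apply, hc.map_one, ha.map_one]
  map_circ h i t s := by
    simp only [LinearMap.comp_apply]
    rw [hc.map_circ, ha.map_circ]
  map_act σ t := by
    simp only [LinearMap.comp_apply]
    rw [hc.map_act, ha.map_act]

variable [CharZero k]

/-- A class of parity `b` is represented by a cocycle of parity `b`. -/
theorem exists_mk_of_parity {b : Fin 2} {x : HP A} (hx : epsH A x = (-1 : k) ^ b.val • x) :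
    ∃ f : LinearMap.ker (totalD A), HP.mk A f = x ∧ eps A f.1 = (-1 : k) ^ b.val • f.1 := by
  obtain ⟨f, rfl⟩ := HP.mk_surjective A x
  have hf : parityPart (eps A) b f.1 ∈ LinearMap.ker (totalD A) := by
    have hf := f.2
    rw [LinearMap.mem_ker] at hf ⊢
    simp [parityPart, eps_totalD, hf]
  refine ⟨⟨_, hf⟩, ?_, eps_parityPart _ (eps_eps A) b f.1⟩
  have := parityPart_of_parity (epsH A) hx b
  rw [if_pos rfl] at this
  exact this

/-- Maps which are given by `[U]([f₁], …) = [U(f₁, …)]` form an action, since the composition, the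
unit and the symmetric group actions are computed on representatives. For the latter the
representatives have to be chosen of the same parity as their classes. -/
theorem isHBAlgebra_of_apply_mk (hP : IsQuadratic P)
    {a : ∀ n d, HB P n d →ₗ[k] Ops (k := k) (HP A) n}
    (ha : ∀ (n d : ℕ) (U : cocycles P n d) (f : Fin n → LinearMap.ker (totalD A)),
      a n d (HB.mk P n d U) (fun i => HP.mk A (f i)) = cocycleOp U f) :
    IsHBAlgebra (hbOperad hP) A a where
  map_one := by
    ext x
    choose f hf using fun i => HP.mk_surjective A (x i)
    obtain rfl : (fun i => HP.mk A (f i)) = x := funext hf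
    exact ha _ _ _ _
  map_circ {m n r d d' e} h he i U W := by
    obtain ⟨U, rfl⟩ := HB.mk_surjective U
    obtain ⟨W, rfl⟩ := HB.mk_surjective W
    obtain ⟨hc, e₁⟩ := (hbOperad hP).circ_mk h he i U W
    ext x
    choose f hf using fun i => HP.mk_surjective A (x i)
    obtain rfl : (fun i => HP.mk A (f i)) = x := funext hf
    rw [e₁, ha, gradedCirc_apply, ha, cocycleOp_apply W]
    choose hv e₂ using circArg_mk (e := d') h i
      ⟨W.1 A fun y => (f ((slot h i).symm (Sum.inr y))).1, apply_mem_ker W.2 _⟩ f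
    rw [funext e₂, ha]
    refine congrArg (HP.mk A) (Subtype.ext ?_)
    exact gradedCirc_apply (eps A) d' h i (U.1 A) (W.1 A) fun z => (f z).1
  map_act {n d} σ U := by
    obtain ⟨U, rfl⟩ := HB.mk_surjective U
    obtain ⟨hc, e₁⟩ := (hbOperad hP).act_mk σ U
    refine ops_ext_parity (epsH A) epsH_epsH fun b x hx => ?_
    choose f hf hf' using fun i => exists_mk_of_parity (hx i)
    obtain rfl : (fun i => HP.mk A (f i)) = x := funext hf
    rw [e₁, ha, gradedAct_apply (epsH A) σ _ b _ hx, ha, cocycleOp_apply U, ← map_smul]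
    refine congrArg (HP.mk A) (Subtype.ext ?_)
    exact gradedAct_apply (eps A) σ (U.1 A) b (fun i => (f i).1) hf'

end Action

end OperadicCohomology

end

theorem mainTheorem10 {k : Type u} [Field k] [CharZero k] (P : Operad k)
    [FiniteDimensional k (P.obj 2)] (hP : IsQuadratic P) :
    ∃ (hZ : ZPIsSuboperad P) (H : HBOperad P) (c : ∀ N, ZP P N →ₗ[k] HB P (N + 1) N),
      (∀ (N : ℕ) (t : ZP P N), ∃ hc : cup P N t.1 ∈ cocycles P (N + 1) N,
        c N t = HB.mk P (N + 1) N ⟨cup P N t.1, hc⟩) ∧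
      IsOperadMap hZ H c ∧
      ∀ A : PAlg P, ∃ a : ∀ n d, HB P n d →ₗ[k] Ops (k := k) (HP A) n,
        (∀ (n d : ℕ) (U : cocycles P n d) (f : Fin n → LinearMap.ker (totalD A)),
          ∃ hf : U.1 A (fun i => (f i).1) ∈ LinearMap.ker (totalD A),
            a n d (HB.mk P n d U) (fun i => HP.mk A (f i)) = HP.mk A ⟨_, hf⟩) ∧
        IsHBAlgebra H A a ∧
        IsZPAlgebra hZ A (fun N => a (N + 1) N ∘ₗ c N) := by
  refine ⟨zpIsSuboperad hP, hbOperad hP, cupClass hP,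
    fun N t => ⟨cup_mem_cocycles hP t, rfl⟩, isOperadMap_cupClass hP, fun A => ?_⟩
  obtain ⟨a, ha⟩ := exists_cohomologyAction A
  have hA := isHBAlgebra_of_apply_mk hP ha
  exact ⟨a, fun n d U f => ⟨apply_mem_ker U.2 f, ha n d U f⟩, hA, hA.comp (isOperadMap_cupClass hP)⟩
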